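/- **Theorem 4.3.** *Setting.* Let $(\mathsf X,\mathcal X)$ be a measurable space with countably generated $\sigma$-algebra, $(\Theta,\mathcal T)$ a measurable space, $\pi$ a probability measure on $\mathsf X$, and $\{P_\theta\}_{\theta\in\Theta}$ Markov kernels on $\mathsf X$ such that $(\theta,x)\mapsto P_\theta(x,A)$ is measurable for every $A\in\mathcal X$ and $\pi P_\theta=\pi$ for every $\theta$. Let $\{(X_n,\theta_n)\}_{n\ge0}$ be an $\mathsf X\times\Theta$-valued process on a probability space with natural filtration $(\mathcal F_n)$ such that, for all $n\ge0$ and all nonnegative measurable $f$, $\mathbb E(f(X_{n+1})\mid\mathcal F_n)=P_{\theta_n}f(X_n)$ a.s. For $W>0$ put $|f|_W=\sup_x|f(x)|/W(x)$, let $\mathcal L_W$ be the set of measurable $f$ with $|f|_W<\infty$, put $\|\mu\|_W=\sup_{|g|_W\le1}|\mu(g)|$ for signed measures $\mu$, and $D_\beta(\theta,\theta')=\sup_{|f|_{V^\beta}\le1}\sup_x|P_\theta f(x)-P_{\theta'}f(x)|/V^\beta(x)$, where suprema run over measurable functions. *Assumptions.* * **A1.** Each $P_\theta$ is phi-irreducible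 and aperiodic. There is a measurable $V:\mathsf X\to[1,\infty)$ with $\mathbb E\,V(X_0)<\infty$ such that for every $\beta\in(0,1]$ there are $\rho\in(0,1)$, $C\in(0,\infty)$ with $\|P_\theta^n(x,\cdot)-\pi\|_{V^\beta}\le C\rho^nV^\beta(x)$ for all $x,\theta$ and $n\ge0$; and there are $\bar b\in(0,\infty)$, $\lambda\in(0,1)$ with $P_\theta V(x)\le\lambda V(x)+\bar b$ for all $x,\theta$. * **A2.** There are $\eta\in[0,1/2)$ and a nonincreasing sequence of positive numbers $(\gamma_n)_{n\ge1}$ with $\gamma_n=O(n^{-\alpha})$ for some $\alpha>1/2$ such that for every $\beta\in[0,1]$ there is a finite constant $C$ with $D_\beta(\theta_{n-1},\theta_n)\le C\gamma_nV^\eta(X_n)$ a.s. for all $n\ge1$. * **A4.** $w:\mathbb R\to\mathbb R$ is even, $w(0)=1$, $w(x)=0$ for $|x|\ge1$, and the restriction $w:[0,1]\to\mathbb R$ is $(r+1)$-times continuously differentiable, for some integer $r\ge2$. * **Bandwidth.** $(b_n)_{n\ge1}$ is a nonincreasing sequence of positive numbers with $b_n^{-1}=O(n^{1/2})$ and $|b_n-b_{n-1}|=O(b_nn^{-1})$.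 Let $\beta\in(0,1/2-\eta)$, $h\in\mathcal L_{V^\beta}$, and let $p>1$ be such that $2p(\beta+\eta)\le1$. Suppose that $$\sum_{n\ge1}(n^{-1}b_n^{-1})^p<\infty,\quad \sum_{n\ge1}(n^{-2}b_n^{-1})^{1\wedge(p/2)}<\infty,\quad \sum_{n\ge1}n^{-2+\frac12\vee\frac1p}\,b_n^{-1/2}<\infty,\quad \sum_{n\ge1}b_n^{(r-1)p}<\infty .$$ Put $\pi_n(h)=n^{-1}\sum_{k=1}^nh(X_k)$; $\gamma_n(k)=n^{-1}\sum_{j=1}^{n-|k|}(h(X_j)-\pi_n(h))(h(X_{j+|k|})-\pi_n(h))$ for $|k|<n$ and $\gamma_n(k)=0$ for $|k|\ge n$; $\Gamma_n^2(h)=\sum_{k=-n}^nw(kb_n)\gamma_n(k)$; $g_\theta=\sum_{j\ge0}(P_\theta-\pi)^jh$ and $G_\theta(x,y)=g_\theta(y)-P_\theta g_\theta(x)$. Then $$\lim_{n\to\infty}\Big(\Gamma_n^2(h)-\frac1n\sum_{k=1}^nG_{\theta_{k-1}}^2(X_{k-1},X_k)\Big)=0\qquad\text{almost surely.}$$ 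-/

import Mathlib

open MeasureTheory ProbabilityTheory Filter Topology
open scoped ENNReal

namespace AdaptiveMCMC

noncomputable section

section Norms

/-- The weighted sup norm `|f|_W = sup_x |f x| / W x`, as an extended nonnegative real. -/
def wNorm {S : Type*} (W : S → ℝ) (f : S → ℝ) : ℝ≥0∞ :=
  ⨆ x, ENNReal.ofReal (|f x| / W x)

/-- The space `L_W` of measurable functions with finite `W`-norm. -/
def LW {S : Type*} [MeasurableSpace S] (W : S → ℝ) : Set (S → ℝ) :=
  {f | Measurable f ∧ wNorm W f < ∞}

/-- The `W`-norm `‖μ - ν‖_W = sup {|μ f - ν f| : f measurable, |f|_W ≤ 1}` of the difference of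
two measures. The supremum runs over the `f` whose integrals are both defined, so that the junk
value `0` of a divergent integral never enters. For probability measures every bounded `f`
qualifies; hence, for measurable positive `W`, the value is the integral of `W` against the total
variation of `μ - ν`, and it is `∞` when that integral diverges. -/
def wNormSub {S : Type*} [MeasurableSpace S] (W : S → ℝ) (μ ν : Measure S) : ℝ≥0∞ :=
  ⨆ (f : S → ℝ) (_ : Measurable f ∧ wNorm W f ≤ 1 ∧ Integrable f μ ∧ Integrable f ν),
    ENNReal.ofReal |∫ y, f y ∂μ - ∫ y, f y ∂ν|

end Norms

section Kernels

/-- `κ` is phi-irreducible: irreducible with respect to some nonzero σ-finite measure. -/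
def IsPhiIrreducible {S : Type*} [MeasurableSpace S] (κ : Kernel S S) : Prop :=
  ∃ φ : Measure S, SigmaFinite φ ∧ φ ≠ 0 ∧ Kernel.IsIrreducible φ κ

/-- `κ`, with invariant distribution `π`, is aperiodic: there is no cycle of `d ≥ 2` disjoint
measurable sets of positive `π`-measure that `κ` visits in cyclic order with probability one. -/
def IsAperiodic {S : Type*} [MeasurableSpace S] (π : Measure S) (κ : Kernel S S) : Prop :=
  ¬ ∃ d : ℕ, 2 ≤ d ∧ ∃ E : ZMod d → Set S,
    (∀ i, MeasurableSet (E i)) ∧ Pairwise (fun i j => Disjoint (E i) (E j)) ∧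
    (∀ i, ∀ x ∈ E i, κ x (E (i + 1)) = 1) ∧ 0 < π (E 0)

end Kernels

section Family

/-! The family `{P_θ}` is a kernel `P` from `Θ × S` to `S`; its member `P_θ` is `P.sectR θ`. -/

variable {S Θ Ω : Type*} [MeasurableSpace S] [MeasurableSpace Θ]

/-- The pseudo-metric
`D_β(θ, θ') = sup_{|f|_{V^β} ≤ 1} sup_x |P_θ f(x) - P_θ' f(x)| / V^β(x)`. -/
def D (P : Kernel (Θ × S) S) (V : S → ℝ) (β : ℝ) (θ θ' : Θ) : ℝ≥0∞ :=
  ⨆ (f : S → ℝ) (_ : Measurable f ∧ wNorm (fun x => V x ^ β) f ≤ 1) (x : S),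
    ENNReal.ofReal (|∫ y, f y ∂(P.sectR θ x) - ∫ y, f y ∂(P.sectR θ' x)| / V x ^ β)

/-- The operator `P̄_θ = P_θ - π` acting on functions. -/
def barP (P : Kernel (Θ × S) S) (π : Measure S) (θ : Θ) (f : S → ℝ) (x : S) : ℝ :=
  ∫ y, f y ∂(P.sectR θ x) - ∫ y, f y ∂π

/-- The resolvent function `g_θ = ∑_{j ≥ 0} P̄_θ^j h`. -/
def resolvent (P : Kernel (Θ × S) S) (π : Measure S) (h : S → ℝ) (θ : Θ) (x : S) : ℝ :=
  ∑' j : ℕ, (barP P π θ)^[j] h x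

/-- `G_θ(x, y) = g_θ(y) - P_θ g_θ(x)`. -/
def G (P : Kernel (Θ × S) S) (π : Measure S) (h : S → ℝ) (θ : Θ) (x y : S) : ℝ :=
  resolvent P π h θ y - ∫ z, resolvent P π h θ z ∂(P.sectR θ x)

/-- The σ-algebra generated by `(X_k, θ_k)`, `k ≤ n`. -/
abbrev natFiltration (X : ℕ → Ω → S) (θ : ℕ → Ω → Θ) (n : ℕ) : MeasurableSpace Ω :=
  ⨆ k ≤ n, MeasurableSpace.comap (fun ω => (X k ω, θ k ω)) inferInstance

/-- `(X_n, θ_n)` is an adaptive chain for the family `P`: the conditional law of `X_{n+1}` given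
the past is `P_{θ_n}(X_n, ·)`. The law of `θ_{n+1}` given the past and `X_{n+1}` is free, and so is
the initial law. -/
structure IsAdaptiveChain [MeasurableSpace Ω] (P : Kernel (Θ × S) S) (Pr : Measure Ω)
    (X : ℕ → Ω → S) (θ : ℕ → Ω → Θ) : Prop where
  measurable_state : ∀ n, Measurable (X n)
  measurable_param : ∀ n, Measurable (θ n)
  condExp_next : ∀ (n : ℕ) (f : S → ℝ≥0∞), Measurable f →
    condLExp (natFiltration X θ n) Pr (fun ω => f (X (n + 1) ω))
      =ᵐ[Pr] fun ω => ∫⁻ y, f y ∂(P.sectR (θ n ω) (X n ω))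

/-- Assumption A1 (uniform geometric ergodicity and drift), for the function `V` and the initial
law `μ₀` of `(X_0, θ_0)`. -/
structure A1 (P : Kernel (Θ × S) S) (π : Measure S) (V : S → ℝ) (μ₀ : Measure (S × Θ)) :
    Prop where
  irreducible : ∀ θ, IsPhiIrreducible (P.sectR θ)
  aperiodic : ∀ θ, IsAperiodic π (P.sectR θ)
  measurable_V : Measurable V
  one_le_V : ∀ x, 1 ≤ V x
  initial : ∫⁻ z, ENNReal.ofReal (V z.1) ∂μ₀ < ∞
  ergodic : ∀ β : ℝ, 0 < β → β ≤ 1 → ∃ ρ C : ℝ, 0 < ρ ∧ ρ < 1 ∧ 0 < C ∧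
    ∀ (x : S) (θ : Θ) (n : ℕ),
      wNormSub (fun y => V y ^ β) ((P.sectR θ ^ n) x) π ≤ ENNReal.ofReal (C * ρ ^ n * V x ^ β)
  drift : ∃ b lam : ℝ, 0 < b ∧ 0 < lam ∧ lam < 1 ∧ ∀ (x : S) (θ : Θ),
    ∫⁻ y, ENNReal.ofReal (V y) ∂(P.sectR θ x) ≤ ENNReal.ofReal (lam * V x + b)

/-- Assumption A2 (diminishing adaptation) with exponent `η`, for the function `V`. Only the terms
with index `n ≥ 1` of the sequence `γ` matter. -/
def A2 [MeasurableSpace Ω] (P : Kernel (Θ × S) S) (V : S → ℝ) (Pr : Measure Ω)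
    (X : ℕ → Ω → S) (θ : ℕ → Ω → Θ) (η : ℝ) : Prop :=
  0 ≤ η ∧ η < 1 / 2 ∧ ∃ (γ : ℕ → ℝ) (α : ℝ), 1 / 2 < α ∧
    (∀ n, 1 ≤ n → 0 < γ n) ∧ AntitoneOn γ (Set.Ici 1) ∧
    γ =O[atTop] (fun n : ℕ => (n : ℝ) ^ (-α)) ∧
    ∀ β : ℝ, 0 ≤ β → β ≤ 1 → ∃ C : ℝ, ∀ n, 1 ≤ n → ∀ᵐ ω ∂Pr,
      D P V β (θ (n - 1) ω) (θ n ω) ≤ ENNReal.ofReal (C * γ n * V (X n ω) ^ η)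

end Family

section Estimator

/-- Assumption A4 with smoothness index `r`, for a kernel `w` supported in `[-1, 1]`. -/
structure A4 (w : ℝ → ℝ) (r : ℕ) : Prop where
  support : ∀ x, 1 ≤ |x| → w x = 0
  even : ∀ x, w (-x) = w x
  zero : w 0 = 1
  two_le : 2 ≤ r
  smooth : ContDiffOn ℝ ((r + 1 : ℕ) : WithTop ℕ∞) w (Set.Icc 0 1)

/-- Standing assumptions on the bandwidth sequence `(b_n)_{n ≥ 1}`; the value `b 0` plays no
role. -/
structure IsBandwidth (b : ℕ → ℝ) : Prop where
  pos : ∀ n, 1 ≤ n → 0 < b n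
  antitone : AntitoneOn b (Set.Ici 1)
  inv_isBigO : (fun n : ℕ => (b n)⁻¹) =O[atTop] (fun n : ℕ => (n : ℝ) ^ (1 / 2 : ℝ))
  sub_isBigO : (fun n : ℕ => b n - b (n - 1)) =O[atTop] (fun n : ℕ => b n * (n : ℝ)⁻¹)

/-- The sample mean `n⁻¹ ∑_{k=1}^n y_k`. -/
def sampleMean (y : ℕ → ℝ) (n : ℕ) : ℝ :=
  (n : ℝ)⁻¹ * ∑ k ∈ Finset.Icc 1 n, y k

/-- The sample autocovariance at lag `k` of `y_1, …, y_n`; it is even in `k` and vanishes for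
`|k| ≥ n`. -/
def sampleAutocov (y : ℕ → ℝ) (n : ℕ) (k : ℤ) : ℝ :=
  if n ≤ k.natAbs then 0 else
    (n : ℝ)⁻¹ * ∑ j ∈ Finset.Icc 1 (n - k.natAbs),
      (y j - sampleMean y n) * (y (j + k.natAbs) - sampleMean y n)

/-- The kernel estimator `∑_{k=-n}^n w(k b_n) γ_n(k)` computed from `y_1, …, y_n`. -/
def kernelEstimator (w : ℝ → ℝ) (b : ℕ → ℝ) (y : ℕ → ℝ) (n : ℕ) : ℝ :=
  ∑ k ∈ Finset.Icc (-(n : ℤ)) (n : ℤ), w ((k : ℝ) * b n) * sampleAutocov y n k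

end Estimator

end

end AdaptiveMCMC

/-! Put `z_j = G_{θ_{j-1}}(X_{j-1}, X_j)`, `u_j = P_{θ_j} g_{θ_j}(X_j)` and `e_j = g_{θ_j}(X_j) -
g_{θ_{j-1}}(X_j)`. The Poisson equation (`integral_resolvent_kernel`) gives `h(X_j) - π(h) = z_j +
(u_{j-1} - u_j) + e_j`: martingale differences, a telescoping part, and an error due to adaptation.
The resolvent is Lipschitz in `θ` for `D_β` (`abs_resolvent_sub_le`), so `E e_j² = O(γ_j²)`, and `∑
e_j² < ∞` almost surely because `γ_j = O(j^{-α})` with `α > 1/2` (`A2.ae_exists_sum_sq_le`). With `s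
= min p 2`, both `z_j` and `u_j` are bounded in `L^{2s}`, since `2sβ ≤ 1` and `V(X_n)` has bounded
mean.

The estimator is `n⁻¹` times the quadratic form with matrix `w((i - j) b_n)` in the centred
observations (`kernelEstimator_eq_lagForm`). Evaluated at `z`, its diagonal is exactly `∑ z_k²`,
because `w(0) = 1`. Three remainders have to vanish after division by `n`.

The off-diagonal form in `z` (`IsMartingaleDiff.tendsto_lagOffDiag`). Passing from `n - 1` to `n`
adds a new row, which is a martingale difference, and replaces the weights `w(k b_{n-1})` by `w(k
b_n)` on the old indices. Divided by `n`, the rows form a convergent martingale series by the von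
Bahr-Esseen inequality, and the weight changes form an absolutely convergent series, since the
squares of these changes sum to `O(n⁻² b_n⁻¹)`. The Kronecker lemma finishes.

The form with `d_j = (u_{j-1} - u_j) + e_j` in one argument and `2z + d` in the other
(`WindowBounds.abs_lagForm_le`). This is pathwise: summation by parts moves the differences onto the
window, whose first differences have bounded absolute sum and whose second differences sum to
`O(b_n)`. The partial sums of `2z + d` are Hölder of some order `τ < 1` around each index `i`, with
constants whose squares grow slowly on average (`ae_exists_increment_bound`). The `u` part is then
of order `b_n^{1-τ} n^ε`, which vanishes because `b_n` decays polynomially; the `e` part is treated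
by Cauchy-Schwarz. Only `b_n⁻¹ = O(n^{1/2})` and `τ < 1` are needed there.

The corrections for the sample mean. The partial sums of the centred observations are `O(n^κ)` with
`κ < 3/4`, so these terms are `O(n^{2κ - 3/2})`. `tendsto_kernelEstimator_sub` assembles the three
estimates for a single path. -/

namespace AdaptiveMCMC

/-! ### Lag windows: sizes and differences of the weights. -/

section Window

/-- An interval of half-length `r` contains at most `2r + 1` integers. -/
theorem sum_abs_le_of_support {g : ℤ → ℝ} {c r A : ℝ} (hr : 0 ≤ r) (hA : 0 ≤ A)
    (hsupp : ∀ k : ℤ, g k ≠ 0 → |(k : ℝ) - c| ≤ r) (hg : ∀ k, |g k| ≤ A) (F : Finset ℤ) :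
    ∑ k ∈ F, |g k| ≤ A * (2 * r + 1) := by
  classical
  calc ∑ k ∈ F, |g k| = ∑ k ∈ F.filter (fun k => g k ≠ 0), |g k| := by
        rw [Finset.sum_filter]
        refine Finset.sum_congr rfl fun k _ => ?_
        by_cases hk : g k = 0 <;> simp [hk]
    _ ≤ ∑ _k ∈ F.filter (fun k => g k ≠ 0), A := Finset.sum_le_sum fun k _ => hg k
    _ = A * (F.filter (fun k => g k ≠ 0)).card := by simp [mul_comm]
    _ ≤ A * (2 * r + 1) := by
        refine mul_le_mul_of_nonneg_left ?_ hA
        have hsub : F.filter (fun k => g k ≠ 0) ⊆ Finset.Icc ⌈c - r⌉ ⌊c + r⌋ := by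
          intro k hk
          have := abs_le.1 (hsupp k (Finset.mem_filter.1 hk).2)
          rw [Finset.mem_Icc]
          exact ⟨Int.ceil_le.2 (by linarith), Int.le_floor.2 (by linarith)⟩
        have h1 := Finset.card_le_card hsub
        rw [Int.card_Icc] at h1
        have h2 : ((⌊c + r⌋ + 1 - ⌈c - r⌉).toNat : ℝ) ≤ 2 * r + 1 := by
          rcases le_total (⌊c + r⌋ + 1 - ⌈c - r⌉) 0 with h | h
          · rw [Int.toNat_of_nonpos h]; push_cast; linarith
          · have h3 : (((⌊c + r⌋ + 1 - ⌈c - r⌉).toNat : ℤ) : ℝ)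
                = ((⌊c + r⌋ + 1 - ⌈c - r⌉ : ℤ) : ℝ) := by rw [Int.toNat_of_nonneg h]
            rw [Int.cast_natCast] at h3
            rw [h3]; push_cast
            have := Int.floor_le (c + r)
            have := Int.le_ceil (c - r)
            linarith
        exact (Nat.cast_le.2 h1).trans h2

/-- Bounds for the weights `K k` of a lag window with bandwidth `b`. -/
structure WindowBounds (K : ℤ → ℝ) (b L : ℝ) : Prop where
  even : ∀ k, K (-k) = K k
  abs_le : ∀ k, |K k| ≤ L
  support : ∀ k, K k ≠ 0 → |(k : ℝ)| ≤ b⁻¹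
  sum_abs : ∀ F : Finset ℤ, ∑ k ∈ F, |K k| ≤ L * b⁻¹
  diff : ∀ k, |K (k + 1) - K k| ≤ L * b
  sum_diff : ∀ F : Finset ℤ, ∑ k ∈ F, |K (k + 1) - K k| ≤ L
  sum_diff_two : ∀ F : Finset ℤ, ∑ k ∈ F, |K (k + 1) - 2 * K k + K (k - 1)| ≤ L * b

theorem exists_lipschitz_Icc {f : ℝ → ℝ} (hf : ContDiffOn ℝ 1 f (Set.Icc 0 1)) :
    ∃ L : ℝ, 0 ≤ L ∧ ∀ x ∈ Set.Icc (0 : ℝ) 1, ∀ y ∈ Set.Icc (0 : ℝ) 1,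
      |f x - f y| ≤ L * |x - y| := by
  have hd : DifferentiableOn ℝ f (Set.Icc 0 1) := hf.differentiableOn one_ne_zero
  have hc : ContinuousOn (derivWithin f (Set.Icc 0 1)) (Set.Icc 0 1) :=
    hf.continuousOn_derivWithin (uniqueDiffOn_Icc zero_lt_one) le_rfl
  obtain ⟨L, hL⟩ := isCompact_Icc.exists_bound_of_continuousOn hc
  refine ⟨L, (norm_nonneg _).trans (hL 0 (by simp)), fun x hx y hy => ?_⟩
  have := (convex_Icc (0 : ℝ) 1).norm_image_sub_le_of_norm_derivWithin_le hd hL hy hx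
  simpa [Real.norm_eq_abs] using this

/-- By the mean value theorem on either side of `x`, the second difference is `b (f' d - f' c)` with
`|d - c| ≤ 2b`, and `f'` is Lipschitz. The three points must stay in `[0, 1]`, since an even window
may have corners at `0` and `±1`. -/
theorem exists_second_diff_bound {f : ℝ → ℝ} (hf : ContDiffOn ℝ 2 f (Set.Icc 0 1)) :
    ∃ L : ℝ, 0 ≤ L ∧ ∀ x b : ℝ, 0 < b → 0 ≤ x - b → x + b ≤ 1 →
      |f (x + b) - 2 * f x + f (x - b)| ≤ L * b ^ 2 := by
  have hu : UniqueDiffOn ℝ (Set.Icc (0 : ℝ) 1) := uniqueDiffOn_Icc zero_lt_one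
  have h1 : ContDiffOn ℝ 1 (derivWithin f (Set.Icc 0 1)) (Set.Icc 0 1) :=
    hf.derivWithin hu (by norm_num)
  obtain ⟨L, hL0, hL⟩ := exists_lipschitz_Icc h1
  have hd : DifferentiableOn ℝ f (Set.Icc 0 1) := hf.differentiableOn two_ne_zero
  have key : ∀ u v : ℝ, 0 ≤ u → u < v → v ≤ 1 →
      ∃ c ∈ Set.Ioo u v, derivWithin f (Set.Icc 0 1) c = (f v - f u) / (v - u) := by
    intro u v hu0 huv hv1
    refine exists_hasDerivAt_eq_slope f _ huv
      (hd.continuousOn.mono (Set.Icc_subset_Icc hu0 hv1)) fun c hc => ?_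
    have hc' : Set.Icc (0 : ℝ) 1 ∈ 𝓝 c :=
      Icc_mem_nhds (hu0.trans_lt hc.1) (hc.2.trans_le hv1)
    exact ((hd c (mem_of_mem_nhds hc')).hasDerivWithinAt).hasDerivAt hc'
  refine ⟨2 * L, by positivity, fun x b hb h0 h1' => ?_⟩
  obtain ⟨c, hc, hcs⟩ := key (x - b) x h0 (by linarith) (by linarith)
  obtain ⟨d, hd', hds⟩ := key x (x + b) (by linarith) (by linarith) h1'
  have hcb : f x - f (x - b) = derivWithin f (Set.Icc 0 1) c * b := by
    rw [hcs, sub_sub_cancel, div_mul_cancel₀ _ hb.ne']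
  have hdb : f (x + b) - f x = derivWithin f (Set.Icc 0 1) d * b := by
    rw [hds, add_sub_cancel_left, div_mul_cancel₀ _ hb.ne']
  have hle := hL d ⟨by linarith [hd'.1], by linarith [hd'.2]⟩ c
    ⟨by linarith [hc.1], by linarith [hc.2]⟩
  have habs : |d - c| ≤ 2 * b := by
    rw [abs_le]; constructor <;> linarith [hd'.1, hd'.2, hc.1, hc.2]
  have : f (x + b) - 2 * f x + f (x - b)
      = (derivWithin f (Set.Icc 0 1) d - derivWithin f (Set.Icc 0 1) c) * b := by
    linear_combination hdb - hcb
  rw [this, abs_mul, abs_of_pos hb]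
  calc _ ≤ (L * (2 * b)) * b := by gcongr; exact hle.trans (by gcongr)
    _ = 2 * L * b ^ 2 := by ring

theorem A4.eq_min {w : ℝ → ℝ} {r : ℕ} (hw : A4 w r) (x : ℝ) : w x = w (min |x| 1) := by
  rcases le_total |x| 1 with h | h
  · rw [min_eq_left h]
    rcases abs_choice x with h' | h' <;> rw [h']
    exact (hw.even x).symm
  · rw [min_eq_right h, hw.support x h, hw.support 1 (by simp)]

/-- The map `x ↦ min |x| 1` is 1-Lipschitz into `[0, 1]`, so a Lipschitz constant of the restriction
serves on the whole line despite the corners; comparison with `w 1 = 0` bounds `w`. -/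
theorem A4.exists_lipschitz {w : ℝ → ℝ} {r : ℕ} (hw : A4 w r) :
    ∃ L : ℝ, 0 < L ∧ (∀ x, |w x| ≤ L) ∧ ∀ x y, |w x - w y| ≤ L * |x - y| := by
  have h1 : ContDiffOn ℝ 1 w (Set.Icc 0 1) := hw.smooth.of_le (by
    exact_mod_cast (by omega : 1 ≤ r + 1))
  obtain ⟨L, hL0, hL⟩ := exists_lipschitz_Icc h1
  have hmem : ∀ x : ℝ, min |x| 1 ∈ Set.Icc (0 : ℝ) 1 := fun x =>
    ⟨le_min (abs_nonneg _) zero_le_one, min_le_right _ _⟩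
  have hlip : ∀ x y, |w x - w y| ≤ L * |x - y| := by
    intro x y
    rw [hw.eq_min x, hw.eq_min y]
    refine (hL _ (hmem x) _ (hmem y)).trans ?_
    refine mul_le_mul_of_nonneg_left ?_ hL0
    have h3 := abs_min_sub_min_le_max |x| 1 |y| 1
    simp only [sub_self, abs_zero] at h3
    rw [max_eq_left (abs_nonneg _)] at h3
    exact h3.trans (abs_abs_sub_abs_le_abs_sub x y)
  refine ⟨L + 1, by positivity, fun x => ?_, fun x y => (hlip x y).trans (by gcongr; linarith)⟩
  have h2 := hL _ (hmem x) 1 (by simp)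
  rw [← hw.eq_min x, hw.support 1 (by simp), sub_zero] at h2
  refine h2.trans ?_
  have : |min |x| 1 - 1| ≤ 1 := by
    rw [abs_le]; constructor <;> linarith [(hmem x).1, (hmem x).2]
  nlinarith

/-- About `b⁻¹` lags are active. First differences are `O(b)`; second differences are `O(b²)` except
at boundedly many lags near the corners of `w`, where they are still `O(b)`, so they sum to `O(b)`.
The cap `B` on `b` lets additive constants be absorbed into multiples of `b⁻¹`. -/
theorem A4.windowBounds {w : ℝ → ℝ} {r : ℕ} (hw : A4 w r) (B : ℝ) :
    ∃ L : ℝ, 0 < L ∧ ∀ b, 0 < b → b ≤ B → WindowBounds (fun k => w ((k : ℝ) * b)) b L := by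
  obtain ⟨L₁, hL₁, habs, hlip⟩ := hw.exists_lipschitz
  obtain ⟨L₂, hL₂, hsd⟩ := exists_second_diff_bound (f := w) (hw.smooth.of_le (by
    have := hw.two_le
    exact_mod_cast (by omega : 2 ≤ r + 1)))
  have hsupp : ∀ b, 0 < b → ∀ k : ℤ, w (k * b) ≠ 0 → |(k : ℝ)| ≤ b⁻¹ := by
    intro b hb k hk
    by_contra hcon
    refine hk (hw.support _ ?_)
    rw [abs_mul, abs_of_pos hb]
    have := mul_lt_mul_of_pos_right (not_le.1 hcon) hb
    rw [inv_mul_cancel₀ hb.ne'] at this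
    exact this.le
  have hdiff : ∀ b, 0 < b → ∀ k : ℤ, |w ((k + 1 : ℤ) * b) - w (k * b)| ≤ L₁ * b := by
    intro b hb k
    refine (hlip _ _).trans (le_of_eq ?_)
    congr 1
    push_cast
    rw [show ((k : ℝ) + 1) * b - k * b = b by ring, abs_of_pos hb]
  -- The first three summands serve `sum_abs`, `sum_diff` and `sum_diff_two` in turn, the last one
  -- the pointwise bounds.
  refine ⟨L₁ * (2 + |B|) + L₁ * (2 + 3 * |B|) + (L₂ * (2 + |B|) + 20 * L₁) + L₁,
    by positivity, fun b hb hbB => ?_⟩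
  have hbB' : b ≤ |B| := hbB.trans (le_abs_self _)
  have hB0 : 0 ≤ |B| := abs_nonneg B
  have hp1 : 0 ≤ L₁ * (2 + |B|) := by positivity
  have hp2 : 0 ≤ L₁ * (2 + 3 * |B|) := by positivity
  have hp3 : 0 ≤ L₂ * (2 + |B|) + 20 * L₁ := by positivity
  have hbinv : 0 < b⁻¹ := by positivity
  have hbb : b * b⁻¹ = 1 := mul_inv_cancel₀ hb.ne'
  refine ⟨fun k => ?_, fun k => ?_, hsupp b hb, fun F => ?_, fun k => ?_, fun F => ?_,
    fun F => ?_⟩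
  · rw [← hw.even]; congr 1; push_cast; ring
  · exact (habs _).trans (by linarith)
  · refine (sum_abs_le_of_support (c := 0) hbinv.le hL₁.le
      (fun k hk => by simpa using hsupp b hb k hk) (fun k => habs _) F).trans ?_
    calc L₁ * (2 * b⁻¹ + 1) = L₁ * (2 + b) * b⁻¹ := by linear_combination -L₁ * hbb
      _ ≤ L₁ * (2 + |B|) * b⁻¹ := by gcongr
      _ ≤ _ := by gcongr; linarith
  · refine (hdiff b hb k).trans ?_
    gcongr; linarith
  · refine (sum_abs_le_of_support (c := 0) (r := b⁻¹ + 1) (by positivity)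
      (by positivity : 0 ≤ L₁ * b) (fun k hk => ?_) (fun k => hdiff b hb k) F).trans ?_
    · rw [sub_zero]
      by_contra hcon
      refine hk ?_
      have h1 : w ((k : ℝ) * b) = 0 := by
        by_contra h
        have := hsupp b hb k h
        linarith
      have h2 : w (((k + 1 : ℤ) : ℝ) * b) = 0 := by
        by_contra h
        have := hsupp b hb (k + 1) h
        push_cast at this
        have h5 := abs_add_le ((k : ℝ) + 1) (-1)
        norm_num at h5
        linarith
      rw [h1, h2, sub_zero]
    · calc L₁ * b * (2 * (b⁻¹ + 1) + 1) = L₁ * (2 + 3 * b) := by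
            linear_combination 2 * L₁ * hbb
        _ ≤ L₁ * (2 + 3 * |B|) := by gcongr
        _ ≤ _ := by linarith
  · classical
    -- `g₀` dominates the second difference in the smooth range; `g₁ c`, for `c = 0, b⁻¹, -b⁻¹`,
    -- dominates it within one lag of a corner.
    let g₀ : ℤ → ℝ := fun k => if |(k : ℝ) - 0| ≤ b⁻¹ then L₂ * b ^ 2 else 0
    let g₁ : ℝ → ℤ → ℝ := fun c k => if |(k : ℝ) - c| ≤ 1 then 2 * L₁ * b else 0
    have hg₀ : ∀ k, 0 ≤ g₀ k := fun k => by simp only [g₀]; split_ifs <;> positivity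
    have hg₁ : ∀ c k, 0 ≤ g₁ c k := fun c k => by simp only [g₁]; split_ifs <;> positivity
    have hcrude : ∀ k : ℤ, |w ((k + 1 : ℤ) * b) - 2 * w (k * b) + w ((k - 1 : ℤ) * b)|
        ≤ 2 * L₁ * b := by
      intro k
      have h1 := hdiff b hb k
      have h2 := hdiff b hb (k - 1)
      rw [sub_add_cancel] at h2
      rw [abs_le] at *
      constructor <;> linarith [h1.1, h1.2, h2.1, h2.2]
    have hpos : ∀ k : ℤ, 0 ≤ k → |w ((k + 1 : ℤ) * b) - 2 * w (k * b) + w ((k - 1 : ℤ) * b)|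
        ≤ g₀ k + g₁ 0 k + g₁ b⁻¹ k := by
      intro k hk
      by_cases hc1 : |(k : ℝ) - 0| ≤ 1
      · have : g₁ 0 k = 2 * L₁ * b := if_pos hc1
        linarith [hcrude k, hg₀ k, hg₁ b⁻¹ k]
      by_cases hc2 : |(k : ℝ) - b⁻¹| ≤ 1
      · have : g₁ b⁻¹ k = 2 * L₁ * b := if_pos hc2
        linarith [hcrude k, hg₀ k, hg₁ 0 k]
      have hk' : (0 : ℝ) ≤ k := by exact_mod_cast hk
      rw [sub_zero, abs_of_nonneg hk', not_le] at hc1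
      rcases lt_or_ge (k : ℝ) b⁻¹ with hlt | hge
      · have hlt' : (k : ℝ) + 1 < b⁻¹ := by
          rw [abs_of_neg (by linarith), not_le] at hc2; linarith
        have : g₀ k = L₂ * b ^ 2 := if_pos (by rw [sub_zero, abs_of_nonneg hk']; exact hlt.le)
        have h1 : ((k : ℝ) + 1) * b < 1 := by
          have := mul_lt_mul_of_pos_right hlt' hb
          rwa [inv_mul_cancel₀ hb.ne'] at this
        have h2 := hsd (k * b) b hb (by nlinarith) (by nlinarith)
        have e1 : (((k + 1 : ℤ) : ℝ)) * b = k * b + b := by push_cast; ring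
        have e2 : (((k - 1 : ℤ) : ℝ)) * b = k * b - b := by push_cast; ring
        rw [e1, e2]
        linarith [hg₁ 0 k, hg₁ b⁻¹ k]
      · have hge' : b⁻¹ + 1 < (k : ℝ) := by
          rw [abs_of_nonneg (by linarith), not_le] at hc2; linarith
        have hz : ∀ j : ℤ, (j : ℝ) ≥ k - 1 → w (j * b) = 0 := by
          intro j hj
          by_contra h
          have := hsupp b hb j h
          have := le_abs_self (j : ℝ)
          linarith
        rw [hz (k + 1) (by push_cast; linarith), hz k (by linarith),
          hz (k - 1) (by push_cast; linarith)]
        simp only [mul_zero, sub_zero, add_zero, abs_zero]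
        linarith [hg₀ k, hg₁ 0 k, hg₁ b⁻¹ k]
    have hall : ∀ k : ℤ, |w ((k + 1 : ℤ) * b) - 2 * w (k * b) + w ((k - 1 : ℤ) * b)|
        ≤ g₀ k + g₁ 0 k + g₁ b⁻¹ k + g₁ (-b⁻¹) k := by
      intro k
      rcases le_total 0 k with hk | hk
      · linarith [hpos k hk, hg₁ (-b⁻¹) k]
      · have h1 := hpos (-k) (by omega)
        have e0 : g₀ (-k) = g₀ k := by
          simp only [g₀]; push_cast; rw [sub_zero, sub_zero, abs_neg]
        have e1 : g₁ 0 (-k) = g₁ 0 k := by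
          simp only [g₁]; push_cast; rw [sub_zero, sub_zero, abs_neg]
        have e2 : g₁ b⁻¹ (-k) = g₁ (-b⁻¹) k := by
          simp only [g₁]; push_cast
          rw [show -(k : ℝ) - b⁻¹ = -((k : ℝ) - -b⁻¹) by ring, abs_neg]
        rw [e0, e1, e2] at h1
        have e3 : w (((-k + 1 : ℤ) : ℝ) * b) = w (((k - 1 : ℤ) : ℝ) * b) := by
          rw [← hw.even]; congr 1; push_cast; ring
        have e4 : w (((-k - 1 : ℤ) : ℝ) * b) = w (((k + 1 : ℤ) : ℝ) * b) := by
          rw [← hw.even]; congr 1; push_cast; ring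
        have e5 : w (((-k : ℤ) : ℝ) * b) = w ((k : ℝ) * b) := by
          rw [← hw.even]; congr 1; push_cast; ring
        rw [e3, e4, e5] at h1
        have : w (((k - 1 : ℤ) : ℝ) * b) - 2 * w ((k : ℝ) * b) + w (((k + 1 : ℤ) : ℝ) * b)
          = w (((k + 1 : ℤ) : ℝ) * b) - 2 * w ((k : ℝ) * b) + w (((k - 1 : ℤ) : ℝ) * b) := by
          ring
        rw [this] at h1
        linarith [hg₁ b⁻¹ k]
    have hs₀ : ∑ k ∈ F, g₀ k ≤ L₂ * b ^ 2 * (2 * b⁻¹ + 1) := by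
      refine (Finset.sum_le_sum fun k _ => le_abs_self _).trans
        (sum_abs_le_of_support (c := 0) hbinv.le (by positivity) (fun k hk => ?_)
        (fun k => ?_) F)
      · by_contra h; exact hk (if_neg h)
      · rw [abs_of_nonneg (hg₀ k)]; simp only [g₀]; split_ifs
        · exact le_rfl
        · positivity
    have hs₁ : ∀ c, ∑ k ∈ F, g₁ c k ≤ 2 * L₁ * b * (2 * 1 + 1) := by
      intro c
      refine (Finset.sum_le_sum fun k _ => le_abs_self _).trans
        (sum_abs_le_of_support (c := c) zero_le_one (by positivity) (fun k hk => ?_)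
        (fun k => ?_) F)
      · by_contra h; exact hk (if_neg h)
      · rw [abs_of_nonneg (hg₁ c k)]; simp only [g₁]; split_ifs
        · exact le_rfl
        · positivity
    calc _ ≤ ∑ k ∈ F, (g₀ k + g₁ 0 k + g₁ b⁻¹ k + g₁ (-b⁻¹) k) :=
          Finset.sum_le_sum fun k _ => hall k
      _ = ∑ k ∈ F, g₀ k + ∑ k ∈ F, g₁ 0 k + ∑ k ∈ F, g₁ b⁻¹ k + ∑ k ∈ F, g₁ (-b⁻¹) k := by
          simp only [Finset.sum_add_distrib]
      _ ≤ L₂ * b ^ 2 * (2 * b⁻¹ + 1) + 3 * (2 * L₁ * b * (2 * 1 + 1)) := by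
          linarith [hs₁ 0, hs₁ b⁻¹, hs₁ (-b⁻¹)]
      _ = (L₂ * (2 + b) + 18 * L₁) * b := by linear_combination 2 * L₂ * b * hbb
      _ ≤ (L₂ * (2 + |B|) + 18 * L₁) * b := by gcongr
      _ ≤ _ := mul_le_mul_of_nonneg_right (by linarith) hb.le

end Window

/-! ### The estimator as a quadratic form, and summation by parts. -/

section QuadraticForm

/-- The bilinear form `∑_{i,j=1}^n K (i - j) x_i y_j`. -/
noncomputable def lagForm (K : ℤ → ℝ) (n : ℕ) (x y : ℕ → ℝ) : ℝ :=
  ∑ i ∈ Finset.Icc 1 n, ∑ j ∈ Finset.Icc 1 n, K ((i : ℤ) - j) * (x i * y j)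

/-- The strictly lower triangular part `∑_{1 ≤ i < j ≤ n} K (j - i) x_i x_j`. -/
noncomputable def lagOffDiag (K : ℤ → ℝ) (n : ℕ) (x : ℕ → ℝ) : ℝ :=
  ∑ j ∈ Finset.Icc 1 n, x j * ∑ i ∈ Finset.Ico 1 j, K ((j : ℤ) - i) * x i

/-- Group the pairs `(i, j)` by the lag `k = i - j`: they are `(j + k, j)` for `k ≥ 0` and `(j, j +
|k|)` for `k ≤ 0`, and there are none when `|k| ≥ n`. -/
theorem kernelEstimator_eq_lagForm {w : ℝ → ℝ} (b : ℕ → ℝ) (y : ℕ → ℝ) (n : ℕ) :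
    kernelEstimator w b y n = (n : ℝ)⁻¹ * lagForm (fun k => w ((k : ℝ) * b n)) n
      (fun j => y j - sampleMean y n) (fun j => y j - sampleMean y n) := by
  classical
  set c : ℕ → ℝ := fun j => y j - sampleMean y n with hc
  set s := (Finset.Icc 1 n ×ˢ Finset.Icc 1 n : Finset (ℕ × ℕ)) with hs
  have hmaps : ∀ q ∈ s, ((q.1 : ℤ) - q.2) ∈ Finset.Icc (-(n : ℤ)) n := by
    intro q hq
    simp only [hs, Finset.mem_product, Finset.mem_Icc] at hq ⊢
    omega
  unfold kernelEstimator lagForm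
  rw [← Finset.sum_product', ← Finset.sum_fiberwise_of_maps_to hmaps, Finset.mul_sum]
  refine Finset.sum_congr rfl fun k hk => ?_
  have h1 : ∑ q ∈ s with ((q.1 : ℤ) - q.2) = k,
      w (((((q.1 : ℤ) - q.2 : ℤ)) : ℝ) * b n) * (c q.1 * c q.2)
      = w (k * b n) * ∑ q ∈ s with ((q.1 : ℤ) - q.2) = k, c q.1 * c q.2 := by
    rw [Finset.mul_sum]
    refine Finset.sum_congr rfl fun q hq => ?_
    rw [(Finset.mem_filter.1 hq).2]
  rw [h1, mul_left_comm]
  congr 1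
  unfold sampleAutocov
  split_ifs with hnk
  · rw [Finset.sum_eq_zero, mul_zero]
    intro q hq
    exfalso
    simp only [hs, Finset.mem_filter, Finset.mem_product, Finset.mem_Icc] at hq
    omega
  · congr 1
    rcases le_total 0 k with hk0 | hk0
    · refine Finset.sum_bij' (fun j _ => (j + k.natAbs, j)) (fun q _ => q.2) ?_ ?_ ?_ ?_ ?_
      · intro j hj
        simp only [hs, Finset.mem_filter, Finset.mem_product, Finset.mem_Icc] at hj ⊢
        omega
      · intro q hq
        simp only [hs, Finset.mem_filter, Finset.mem_product, Finset.mem_Icc] at hq ⊢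
        omega
      · intro j hj; rfl
      · rintro ⟨q1, q2⟩ hq
        simp only [hs, Finset.mem_filter, Finset.mem_product, Finset.mem_Icc] at hq
        simp only [Prod.mk.injEq, and_true]
        omega
      · intro j hj
        simp only [hc]; ring
    · refine Finset.sum_bij' (fun j _ => (j, j + k.natAbs)) (fun q _ => q.1) ?_ ?_ ?_ ?_ ?_
      · intro j hj
        simp only [hs, Finset.mem_filter, Finset.mem_product, Finset.mem_Icc] at hj ⊢
        omega
      · intro q hq
        simp only [hs, Finset.mem_filter, Finset.mem_product, Finset.mem_Icc] at hq ⊢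
        omega
      · intro j hj; rfl
      · rintro ⟨q1, q2⟩ hq
        simp only [hs, Finset.mem_filter, Finset.mem_product, Finset.mem_Icc] at hq
        simp only [Prod.mk.injEq, true_and]
        omega
      · intro j hj
        simp only [hc]

theorem lagForm_self_eq {K : ℤ → ℝ} (hK : ∀ k, K (-k) = K k) (n : ℕ) (x : ℕ → ℝ) :
    lagForm K n x x = K 0 * ∑ i ∈ Finset.Icc 1 n, x i ^ 2 + 2 * lagOffDiag K n x := by
  induction n with
  | zero => simp [lagForm, lagOffDiag]
  | succ n ih =>
    unfold lagForm lagOffDiag at *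
    have e : (Finset.Ico 1 (n + 1)) = Finset.Icc 1 n := rfl
    simp only [Finset.sum_Icc_succ_top (Nat.le_add_left 1 n), Finset.sum_add_distrib, e, ih]
    have h1 : ∑ i ∈ Finset.Icc 1 n, K ((i : ℤ) - ((n + 1 : ℕ) : ℤ)) * (x i * x (n + 1))
        = x (n + 1) * ∑ i ∈ Finset.Icc 1 n, K (((n + 1 : ℕ) : ℤ) - i) * x i := by
      rw [Finset.mul_sum]
      refine Finset.sum_congr rfl fun i _ => ?_
      rw [← hK, neg_sub]; ring
    have h2 : ∑ i ∈ Finset.Icc 1 n, K (((n + 1 : ℕ) : ℤ) - i) * (x (n + 1) * x i)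
        = x (n + 1) * ∑ i ∈ Finset.Icc 1 n, K (((n + 1 : ℕ) : ℤ) - i) * x i := by
      rw [Finset.mul_sum]
      refine Finset.sum_congr rfl fun i _ => ?_
      ring
    rw [h1, h2, sub_self]
    ring

theorem lagForm_comm {K : ℤ → ℝ} (hK : ∀ k, K (-k) = K k) (n : ℕ) (x y : ℕ → ℝ) :
    lagForm K n x y = lagForm K n y x := by
  unfold lagForm
  rw [Finset.sum_comm]
  refine Finset.sum_congr rfl fun i _ => Finset.sum_congr rfl fun j _ => ?_
  rw [← hK, neg_sub]; ring

theorem lagForm_add_left (K : ℤ → ℝ) (n : ℕ) (x x' y : ℕ → ℝ) :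
    lagForm K n (fun i => x i + x' i) y = lagForm K n x y + lagForm K n x' y := by
  simp only [lagForm, ← Finset.sum_add_distrib]
  refine Finset.sum_congr rfl fun i _ => Finset.sum_congr rfl fun j _ => ?_
  ring

theorem lagForm_congr {K : ℤ → ℝ} {n : ℕ} {x x' y y' : ℕ → ℝ}
    (hx : ∀ i, 1 ≤ i → x i = x' i) (hy : ∀ i, 1 ≤ i → y i = y' i) :
    lagForm K n x y = lagForm K n x' y' := by
  unfold lagForm
  refine Finset.sum_congr rfl fun i hi => Finset.sum_congr rfl fun j hj => ?_
  rw [hx i (Finset.mem_Icc.1 hi).1, hy j (Finset.mem_Icc.1 hj).1]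

theorem lagForm_sub_const {K : ℤ → ℝ} (hK : ∀ k, K (-k) = K k) (n : ℕ) (a : ℕ → ℝ) (m : ℝ) :
    lagForm K n (fun i => a i - m) (fun i => a i - m)
      = lagForm K n a a - 2 * m * lagForm K n (fun _ => 1) a
        + m ^ 2 * lagForm K n (fun _ => 1) (fun _ => 1) := by
  have h : lagForm K n (fun _ => 1) a = lagForm K n a (fun _ => 1) := lagForm_comm hK n _ _
  have h' : 2 * m * lagForm K n (fun _ => 1) a
      = m * lagForm K n (fun _ => 1) a + m * lagForm K n a (fun _ => 1) := by rw [← h]; ring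
  rw [h']
  simp only [lagForm, Finset.mul_sum, ← Finset.sum_add_distrib, ← Finset.sum_sub_distrib]
  refine Finset.sum_congr rfl fun i _ => Finset.sum_congr rfl fun j _ => ?_
  ring

/-- A difference of squares. With `a = z + d` it isolates the small part `d` in one argument, and
leaves in the other a sequence whose partial sums are under control. -/
theorem lagForm_self_sub_self {K : ℤ → ℝ} (hK : ∀ k, K (-k) = K k) (n : ℕ) (a z : ℕ → ℝ) :
    lagForm K n a a - lagForm K n z z
      = lagForm K n (fun i => a i - z i) (fun i => a i + z i) := by
  have h : lagForm K n a z = lagForm K n z a := lagForm_comm hK n _ _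
  have h' : lagForm K n a a - lagForm K n z z
      = lagForm K n a a - lagForm K n z z + lagForm K n a z - lagForm K n z a := by
    rw [h]; ring
  rw [h']
  simp only [lagForm, ← Finset.sum_add_distrib, ← Finset.sum_sub_distrib]
  refine Finset.sum_congr rfl fun i _ => Finset.sum_congr rfl fun j _ => ?_
  ring

/-- Summation by parts. -/
theorem sum_mul_sub_prev (f X : ℕ → ℝ) (c : ℝ) {n : ℕ} (hn : 1 ≤ n) :
    ∑ j ∈ Finset.Icc 1 n, f j * (X j - X (j - 1))
      = f n * (X n - c) - f 1 * (X 0 - c)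
        - ∑ j ∈ Finset.Ico 1 n, (f (j + 1) - f j) * (X j - c) := by
  induction n, hn using Nat.le_induction with
  | base => simp; ring
  | succ n hn ih =>
    rw [Finset.sum_Icc_succ_top (by omega), ih, Finset.sum_Ico_succ_top hn, Nat.add_sub_cancel]
    ring

/-- Increments of `X` do not see the constant `c`, and the deviation from `c` matters only where `f`
or its difference is nonzero. For `f` supported in a window, `c` can therefore be the value of `X`
at its centre. -/
theorem abs_sum_mul_sub_prev_le {f X : ℕ → ℝ} {c R : ℝ} {n : ℕ} (hn : 1 ≤ n)
    (h0 : f 1 ≠ 0 → |X 0 - c| ≤ R) (h1 : f n ≠ 0 → |X n - c| ≤ R)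
    (h2 : ∀ j ∈ Finset.Ico 1 n, f (j + 1) - f j ≠ 0 → |X j - c| ≤ R) :
    |∑ j ∈ Finset.Icc 1 n, f j * (X j - X (j - 1))|
      ≤ R * (|f n| + |f 1| + ∑ j ∈ Finset.Ico 1 n, |f (j + 1) - f j|) := by
  have key : ∀ u v : ℝ, (u ≠ 0 → |v| ≤ R) → |u * v| ≤ R * |u| := by
    intro u v huv
    by_cases hu : u = 0
    · simp [hu]
    · rw [abs_mul, mul_comm]
      exact mul_le_mul_of_nonneg_right (huv hu) (abs_nonneg _)
  rw [sum_mul_sub_prev f X c hn]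
  have e1 := key _ _ h1
  have e2 := key _ _ h0
  have e3 : |∑ j ∈ Finset.Ico 1 n, (f (j + 1) - f j) * (X j - c)|
      ≤ R * ∑ j ∈ Finset.Ico 1 n, |f (j + 1) - f j| := by
    rw [Finset.mul_sum]
    exact (Finset.abs_sum_le_sum_abs _ _).trans
      (Finset.sum_le_sum fun j hj => key _ _ (h2 j hj))
  have := abs_sub (f n * (X n - c) - f 1 * (X 0 - c))
    (∑ j ∈ Finset.Ico 1 n, (f (j + 1) - f j) * (X j - c))
  have := abs_sub (f n * (X n - c)) (f 1 * (X 0 - c))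
  linarith

variable {K : ℤ → ℝ} {b L : ℝ}

theorem WindowBounds.nonneg (hK : WindowBounds K b L) : 0 ≤ L :=
  (abs_nonneg _).trans (hK.abs_le 0)

theorem sum_comp_le_of_forall_sum_le {g : ℤ → ℝ} {A : ℝ} (h : ∀ F : Finset ℤ, ∑ k ∈ F, g k ≤ A)
    (F : Finset ℕ) (φ : ℕ → ℤ) (hφ : Function.Injective φ) : ∑ j ∈ F, g (φ j) ≤ A := by
  classical
  rw [← Finset.sum_image (f := g) (g := φ) (fun a _ b _ hab => hφ hab)]
  exact h _

theorem WindowBounds.abs_lagSum_le (hK : WindowBounds K b L) {X : ℕ → ℝ} {n : ℕ} {R : ℝ}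
    (hX : ∀ j ≤ n, |X j| ≤ R) (hn : 1 ≤ n) (i : ℕ) :
    |∑ j ∈ Finset.Icc 1 n, K ((i : ℤ) - j) * (X j - X (j - 1))| ≤ 3 * L * R := by
  have hR : 0 ≤ R := (abs_nonneg _).trans (hX 0 (Nat.zero_le _))
  refine (abs_sum_mul_sub_prev_le (f := fun j => K ((i : ℤ) - j)) (c := 0) hn
    (fun _ => by simpa using hX 0 (Nat.zero_le _)) (fun _ => by simpa using hX n le_rfl)
    (fun j hj _ => by simpa using hX j (Finset.mem_Ico.1 hj).2.le)).trans ?_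
  have h3 : ∑ j ∈ Finset.Ico 1 n, |K ((i : ℤ) - ((j + 1 : ℕ) : ℤ)) - K ((i : ℤ) - j)| ≤ L := by
    refine le_trans (le_of_eq ?_) (sum_comp_le_of_forall_sum_le hK.sum_diff (Finset.Ico 1 n)
      (fun j => (i : ℤ) - j - 1) (fun a b hab => by simpa using hab))
    refine Finset.sum_congr rfl fun j _ => ?_
    rw [abs_sub_comm]; congr 3 <;> push_cast <;> ring
  have := hK.abs_le ((i : ℤ) - n)
  have := hK.abs_le ((i : ℤ) - (1 : ℕ))
  calc _ ≤ R * (L + L + L) := by gcongr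
    _ = 3 * L * R := by ring

/-- Summation by parts around `X i`: the weights live within `b⁻¹` of `i`, so only local deviations
of `X` enter. The `+ 2` leaves room for the index shifts. -/
theorem WindowBounds.abs_lagSum_le_local (hK : WindowBounds K b L) {X : ℕ → ℝ} {n i : ℕ}
    {y τ : ℝ} (hτ : 0 ≤ τ) (hy : 0 ≤ y) (hb : 0 < b)
    (hX : ∀ j : ℕ, |X j - X i| ≤ y * |(j : ℝ) - i| ^ τ) (hn : 1 ≤ n) :
    |∑ j ∈ Finset.Icc 1 n, K ((i : ℤ) - j) * (X j - X (j - 1))|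
      ≤ 3 * L * (y * (b⁻¹ + 2) ^ τ) := by
  have hbi : 0 < b⁻¹ := inv_pos.2 hb
  have hwin : ∀ j : ℕ, |(j : ℝ) - i| ≤ b⁻¹ + 2 → |X j - X i| ≤ y * (b⁻¹ + 2) ^ τ :=
    fun j hj => (hX j).trans (by gcongr)
  have hsup : ∀ j : ℕ, K ((i : ℤ) - j) ≠ 0 → |(j : ℝ) - i| ≤ b⁻¹ := by
    intro j hj
    have := hK.support _ hj
    push_cast at this
    rwa [abs_sub_comm] at this
  refine (abs_sum_mul_sub_prev_le (f := fun j => K ((i : ℤ) - j)) (c := X i) (R := y * (b⁻¹ + 2) ^ τ) hn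
    (fun h => hwin 0 ?_) (fun h => hwin n ?_) (fun j hj h => hwin j ?_)).trans ?_
  · have := _root_.abs_le.1 (hsup 1 h)
    push_cast at *
    rw [_root_.abs_le]; constructor <;> linarith
  · exact (hsup n h).trans (by linarith)
  · by_contra hcon
    refine h ?_
    have h1 : K ((i : ℤ) - j) = 0 := by
      by_contra h'
      have := hsup j h'
      linarith
    have h2 : K ((i : ℤ) - ((j + 1 : ℕ) : ℤ)) = 0 := by
      by_contra h'
      have := hsup _ h'
      push_cast at this
      refine hcon ?_
      rw [_root_.abs_le] at *; constructor <;> linarith [this.1, this.2]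
    simp only [h1, h2, sub_zero]
  · have h3 : ∑ j ∈ Finset.Ico 1 n, |K ((i : ℤ) - ((j + 1 : ℕ) : ℤ)) - K ((i : ℤ) - j)| ≤ L := by
      refine le_trans (le_of_eq ?_) (sum_comp_le_of_forall_sum_le hK.sum_diff (Finset.Ico 1 n)
        (fun j => (i : ℤ) - j - 1) (fun a b hab => by simpa using hab))
      refine Finset.sum_congr rfl fun j _ => ?_
      rw [abs_sub_comm]; congr 3 <;> push_cast <;> ring
    have := hK.abs_le ((i : ℤ) - n)
    have := hK.abs_le ((i : ℤ) - (1 : ℕ))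
    calc _ ≤ (y * (b⁻¹ + 2) ^ τ) * (L + L + L) := by gcongr
      _ = _ := by ring

/-- Moving `i` by one replaces the weights by their first differences, and summation by parts then
brings in the second differences. This gains the factor `b` over `WindowBounds.abs_lagSum_le_local`.
-/
theorem WindowBounds.abs_lagSum_succ_sub_le_local (hK : WindowBounds K b L) {X : ℕ → ℝ}
    {n i : ℕ} {y τ : ℝ} (hτ : 0 ≤ τ) (hy : 0 ≤ y) (hb : 0 < b)
    (hX : ∀ j : ℕ, |X j - X i| ≤ y * |(j : ℝ) - i| ^ τ) (hn : 1 ≤ n) :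
    |∑ j ∈ Finset.Icc 1 n, K (((i + 1 : ℕ) : ℤ) - j) * (X j - X (j - 1))
      - ∑ j ∈ Finset.Icc 1 n, K ((i : ℤ) - j) * (X j - X (j - 1))|
      ≤ 3 * L * b * (y * (b⁻¹ + 2) ^ τ) := by
  have hbi : 0 < b⁻¹ := inv_pos.2 hb
  have hwin : ∀ j : ℕ, |(j : ℝ) - i| ≤ b⁻¹ + 2 → |X j - X i| ≤ y * (b⁻¹ + 2) ^ τ :=
    fun j hj => (hX j).trans (by gcongr)
  have hsup : ∀ j : ℕ, K (((i + 1 : ℕ) : ℤ) - j) - K ((i : ℤ) - j) ≠ 0 →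
      (i : ℝ) - b⁻¹ ≤ j ∧ (j : ℝ) ≤ i + b⁻¹ + 1 := by
    intro j hj
    by_contra hcon
    refine hj ?_
    have h1 : K ((i : ℤ) - j) = 0 := by
      by_contra h'
      have := _root_.abs_le.1 (hK.support _ h')
      push_cast at this
      exact hcon ⟨by linarith [this.1, this.2], by linarith [this.1, this.2]⟩
    have h2 : K (((i + 1 : ℕ) : ℤ) - j) = 0 := by
      by_contra h'
      have := _root_.abs_le.1 (hK.support _ h')
      push_cast at this
      exact hcon ⟨by linarith [this.1, this.2], by linarith [this.1, this.2]⟩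
    rw [h1, h2, sub_zero]
  rw [← Finset.sum_sub_distrib]
  simp only [← sub_mul]
  refine (abs_sum_mul_sub_prev_le
    (f := fun j => K (((i + 1 : ℕ) : ℤ) - j) - K ((i : ℤ) - j)) (c := X i) (R := y * (b⁻¹ + 2) ^ τ) hn
    (fun h => hwin 0 ?_) (fun h => hwin n ?_) (fun j hj h => hwin j ?_)).trans ?_
  · have := hsup 1 h
    push_cast at *
    rw [_root_.abs_le]; constructor <;> linarith [this.1, this.2]
  · have := hsup n h
    rw [_root_.abs_le]; constructor <;> linarith [this.1, this.2]
  · by_cases h1 : K (((i + 1 : ℕ) : ℤ) - j) - K ((i : ℤ) - j) = 0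
    · have h2 : K (((i + 1 : ℕ) : ℤ) - ((j + 1 : ℕ) : ℤ)) - K ((i : ℤ) - ((j + 1 : ℕ) : ℤ)) ≠ 0 := by
        intro h3
        exact h (by simp only [h1, h3, sub_zero])
      have := hsup _ h2
      push_cast at this
      rw [_root_.abs_le]; constructor <;> linarith [this.1, this.2]
    · have := hsup j h1
      rw [_root_.abs_le]; constructor <;> linarith [this.1, this.2]
  · have h3 : ∑ j ∈ Finset.Ico 1 n,
        |(K (((i + 1 : ℕ) : ℤ) - ((j + 1 : ℕ) : ℤ)) - K ((i : ℤ) - ((j + 1 : ℕ) : ℤ)))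
          - (K (((i + 1 : ℕ) : ℤ) - j) - K ((i : ℤ) - j))| ≤ L * b := by
      refine le_trans (le_of_eq ?_) (sum_comp_le_of_forall_sum_le hK.sum_diff_two
        (Finset.Ico 1 n) (fun j => (i : ℤ) - j) (fun a b hab => by simpa using hab))
      refine Finset.sum_congr rfl fun j _ => ?_
      have e1 : ((i + 1 : ℕ) : ℤ) - ((j + 1 : ℕ) : ℤ) = i - j := by push_cast; ring
      have e2 : (i : ℤ) - ((j + 1 : ℕ) : ℤ) = i - j - 1 := by push_cast; ring
      have e3 : ((i + 1 : ℕ) : ℤ) - (j : ℤ) = i - j + 1 := by push_cast; ring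
      rw [e1, e2, e3, ← abs_neg]
      congr 1; ring
    have key : ∀ j : ℕ, |K (((i + 1 : ℕ) : ℤ) - j) - K ((i : ℤ) - j)| ≤ L * b := by
      intro j
      have := hK.diff ((i : ℤ) - j)
      rwa [show (i : ℤ) - j + 1 = ((i + 1 : ℕ) : ℤ) - j by push_cast; ring] at this
    have := key n
    have := key 1
    calc _ ≤ (y * (b⁻¹ + 2) ^ τ) * (L * b + L * b + L * b) := by gcongr
      _ = _ := by ring

/-- The column sums of the window are `O(b⁻¹)`. Their differences telescope to two boundary weights,
so their total variation is `O(b⁻¹)` as well. -/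
theorem WindowBounds.abs_lagForm_one_le (hK : WindowBounds K b L) {A : ℕ → ℝ} {n : ℕ} {R : ℝ}
    (hA : ∀ j ≤ n, |A j| ≤ R) (hn : 1 ≤ n) :
    |lagForm K n (fun _ => 1) (fun j => A j - A (j - 1))| ≤ 4 * L * b⁻¹ * R := by
  have hR : 0 ≤ R := (abs_nonneg _).trans (hA 0 (Nat.zero_le _))
  set s : ℕ → ℝ := fun j => ∑ i ∈ Finset.Icc 1 n, K ((i : ℤ) - j) with hs
  have hsle : ∀ j, |s j| ≤ L * b⁻¹ := fun j =>
    (Finset.abs_sum_le_sum_abs _ _).trans (sum_comp_le_of_forall_sum_le hK.sum_abs _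
      (fun i : ℕ => (i : ℤ) - j) (fun a b hab => by simpa using hab))
  have hsd : ∀ j, s (j + 1) - s j = K (-(j : ℤ)) - K ((n : ℤ) - j) := by
    intro j
    simp only [hs, ← Finset.sum_sub_distrib]
    have : ∀ m : ℕ, ∑ i ∈ Finset.Icc 1 m, (K ((i : ℤ) - ((j + 1 : ℕ) : ℤ)) - K ((i : ℤ) - j))
        = K (-(j : ℤ)) - K ((m : ℤ) - j) := by
      intro m
      induction m with
      | zero => simp
      | succ m ih =>
        rw [Finset.sum_Icc_succ_top (by omega), ih,
          show ((m + 1 : ℕ) : ℤ) - ((j + 1 : ℕ) : ℤ) = m - j by push_cast; ring]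
        ring
    exact this n
  have hform : lagForm K n (fun _ => 1) (fun j => A j - A (j - 1))
      = ∑ j ∈ Finset.Icc 1 n, s j * (A j - A (j - 1)) := by
    unfold lagForm
    rw [Finset.sum_comm]
    refine Finset.sum_congr rfl fun j _ => ?_
    rw [Finset.sum_mul]
    simp
  rw [hform]
  refine (abs_sum_mul_sub_prev_le (c := 0) hn
    (fun _ => by simpa using hA 0 (Nat.zero_le _)) (fun _ => by simpa using hA n le_rfl)
    (fun j hj _ => by simpa using hA j (Finset.mem_Ico.1 hj).2.le)).trans ?_
  have h3 : ∑ j ∈ Finset.Ico 1 n, |s (j + 1) - s j| ≤ L * b⁻¹ + L * b⁻¹ := by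
    have h1 := sum_comp_le_of_forall_sum_le hK.sum_abs (Finset.Ico 1 n)
      (fun j : ℕ => -(j : ℤ)) (fun a b hab => by simpa using hab)
    have h2 := sum_comp_le_of_forall_sum_le hK.sum_abs (Finset.Ico 1 n)
      (fun j : ℕ => (n : ℤ) - j) (fun a b hab => by simpa using hab)
    calc _ ≤ ∑ j ∈ Finset.Ico 1 n, (|K (-(j : ℤ))| + |K ((n : ℤ) - j)|) :=
          Finset.sum_le_sum fun j _ => by rw [hsd]; exact abs_sub _ _
      _ ≤ _ := by rw [Finset.sum_add_distrib]; exact add_le_add h1 h2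
  have := hsle n
  have := hsle 1
  calc _ ≤ R * (L * b⁻¹ + L * b⁻¹ + (L * b⁻¹ + L * b⁻¹)) := by gcongr
    _ = _ := by ring

theorem WindowBounds.abs_lagForm_one_one_le (hK : WindowBounds K b L) (n : ℕ) :
    |lagForm K n (fun _ => 1) (fun _ => 1)| ≤ n * (L * b⁻¹) := by
  unfold lagForm
  refine (Finset.abs_sum_le_sum_abs _ _).trans ?_
  calc _ ≤ ∑ _i ∈ Finset.Icc 1 n, L * b⁻¹ := by
        refine Finset.sum_le_sum fun i _ => (Finset.abs_sum_le_sum_abs _ _).trans ?_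
        simp only [mul_one]
        exact sum_comp_le_of_forall_sum_le hK.sum_abs _
          (fun j : ℕ => (i : ℤ) - j) (fun a b hab => by simpa using hab)
    _ = _ := by simp

/-- The bound for the bilinear form against increments `Δu` plus a square summable
perturbation. -/
theorem WindowBounds.abs_lagForm_le (hK : WindowBounds K b L) (hb : 0 < b) {X u e y : ℕ → ℝ}
    {n : ℕ} {R τ : ℝ} (hn : 1 ≤ n) (hτ : 0 ≤ τ) (hy : ∀ i, 0 ≤ y i)
    (hR : ∀ j ≤ n, |X j| ≤ R)
    (hX : ∀ i j : ℕ, |X j - X i| ≤ y i * |(j : ℝ) - i| ^ τ) :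
    |lagForm K n (fun i => (u (i - 1) - u i) + e i) (fun j => X j - X (j - 1))|
      ≤ 3 * L * R * (|u n| + |u 0|)
        + 3 * L * b * (b⁻¹ + 2) ^ τ * ∑ i ∈ Finset.Icc 1 n, (y i ^ 2 + u i ^ 2)
        + 3 * L * (b⁻¹ + 2) ^ τ *
          (√(∑ i ∈ Finset.Icc 1 n, e i ^ 2) * √(∑ i ∈ Finset.Icc 1 n, (y i ^ 2 + u i ^ 2))) := by
  have hL := hK.nonneg
  have hbi : 0 < b⁻¹ := inv_pos.2 hb
  set z : ℕ → ℝ := fun i => ∑ j ∈ Finset.Icc 1 n, K ((i : ℤ) - j) * (X j - X (j - 1)) with hz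
  have hform : ∀ v : ℕ → ℝ, lagForm K n v (fun j => X j - X (j - 1))
      = ∑ i ∈ Finset.Icc 1 n, v i * z i := by
    intro v
    unfold lagForm
    refine Finset.sum_congr rfl fun i _ => ?_
    rw [hz, Finset.mul_sum]
    refine Finset.sum_congr rfl fun j _ => ?_
    ring
  have hz1 : ∀ i, |z i| ≤ 3 * L * R := hK.abs_lagSum_le hR hn
  have hz2 : ∀ i, |z i| ≤ 3 * L * (y i * (b⁻¹ + 2) ^ τ) := fun i =>
    hK.abs_lagSum_le_local hτ (hy i) hb (hX i) hn
  have hz3 : ∀ i, |z (i + 1) - z i| ≤ 3 * L * b * (y i * (b⁻¹ + 2) ^ τ) := fun i =>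
    hK.abs_lagSum_succ_sub_le_local hτ (hy i) hb (hX i) hn
  rw [lagForm_add_left, hform, hform]
  -- A second summation by parts, now in `i`, moves the difference from `u` to `z`, whose increments
  -- carry the extra factor `b`.
  have hU : ∑ i ∈ Finset.Icc 1 n, (u (i - 1) - u i) * z i
      = z n * (-u n) - z 1 * (-u 0) - ∑ j ∈ Finset.Ico 1 n, (z (j + 1) - z j) * (-u j) := by
    have := sum_mul_sub_prev z (fun i => -u i) 0 hn
    simp only [sub_zero] at this
    rw [← this]
    refine Finset.sum_congr rfl fun i _ => ?_
    ring
  have hU1 : |z n * (-u n)| ≤ 3 * L * R * |u n| := by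
    rw [abs_mul, abs_neg]; exact mul_le_mul_of_nonneg_right (hz1 n) (abs_nonneg _)
  have hU2 : |z 1 * (-u 0)| ≤ 3 * L * R * |u 0| := by
    rw [abs_mul, abs_neg]; exact mul_le_mul_of_nonneg_right (hz1 1) (abs_nonneg _)
  have hU3 : |∑ j ∈ Finset.Ico 1 n, (z (j + 1) - z j) * (-u j)|
      ≤ 3 * L * b * (b⁻¹ + 2) ^ τ * ∑ i ∈ Finset.Icc 1 n, (y i ^ 2 + u i ^ 2) := by
    refine (Finset.abs_sum_le_sum_abs _ _).trans ?_
    rw [Finset.mul_sum]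
    refine (Finset.sum_le_sum fun j _ => ?_).trans
      (Finset.sum_le_sum_of_subset_of_nonneg Finset.Ico_subset_Icc_self
        fun i _ _ => by positivity)
    rw [abs_mul, abs_neg]
    calc _ ≤ 3 * L * b * (y j * (b⁻¹ + 2) ^ τ) * |u j| :=
          mul_le_mul_of_nonneg_right (hz3 j) (abs_nonneg _)
      _ = 3 * L * b * (b⁻¹ + 2) ^ τ * (y j * |u j|) := by ring
      _ ≤ _ := by
        gcongr
        rw [← sq_abs (u j)]
        nlinarith [sq_nonneg (y j - |u j|), sq_nonneg (y j), sq_nonneg |u j|]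
  -- No cancellation is available in `e`; the local bound on `z` and Cauchy-Schwarz are used
  -- instead.
  have hE : |∑ i ∈ Finset.Icc 1 n, e i * z i| ≤ 3 * L * (b⁻¹ + 2) ^ τ *
      (√(∑ i ∈ Finset.Icc 1 n, e i ^ 2) * √(∑ i ∈ Finset.Icc 1 n, (y i ^ 2 + u i ^ 2))) := by
    refine (Finset.abs_sum_le_sum_abs _ _).trans ?_
    calc _ ≤ ∑ i ∈ Finset.Icc 1 n, 3 * L * (b⁻¹ + 2) ^ τ * (|e i| * y i) := by
          refine Finset.sum_le_sum fun i _ => ?_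
          rw [abs_mul]
          calc _ ≤ |e i| * (3 * L * (y i * (b⁻¹ + 2) ^ τ)) := by gcongr; exact hz2 i
            _ = _ := by ring
      _ = 3 * L * (b⁻¹ + 2) ^ τ * ∑ i ∈ Finset.Icc 1 n, |e i| * y i := by rw [Finset.mul_sum]
      _ ≤ _ := by
        gcongr
        refine (Real.sum_mul_le_sqrt_mul_sqrt _ _ _).trans ?_
        simp only [sq_abs]
        gcongr with i
        nlinarith [sq_nonneg (u i)]
  rw [hU]
  have t1 := abs_sub (z n * (-u n) - z 1 * (-u 0))
    (∑ j ∈ Finset.Ico 1 n, (z (j + 1) - z j) * (-u j))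
  have t2 := abs_sub (z n * (-u n)) (z 1 * (-u 0))
  have t3 := abs_add_le (z n * (-u n) - z 1 * (-u 0)
    - ∑ j ∈ Finset.Ico 1 n, (z (j + 1) - z j) * (-u j)) (∑ i ∈ Finset.Icc 1 n, e i * z i)
  linarith

end QuadraticForm

/-! ### The pathwise limit. -/

section DeterministicLimit

theorem tendsto_const_mul_rpow_neg (C : ℝ) {s : ℝ} (hs : s < 0) :
    Tendsto (fun n : ℕ => C * (n : ℝ) ^ s) atTop (𝓝 0) := by
  have h := (tendsto_rpow_neg_atTop (neg_pos.2 hs)).comp tendsto_natCast_atTop_atTop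
  simpa using h.const_mul C

theorem sampleMean_sub_const (y : ℕ → ℝ) (c : ℝ) {n : ℕ} (hn : 1 ≤ n) :
    sampleMean (fun j => y j - c) n = sampleMean y n - c := by
  have : (n : ℝ) ≠ 0 := by positivity
  simp only [sampleMean, Finset.sum_sub_distrib, Finset.sum_const, Nat.card_Icc,
    Nat.add_sub_cancel, nsmul_eq_mul]
  field_simp

theorem partialSum_sub_prev (f : ℕ → ℝ) {j : ℕ} (hj : 1 ≤ j) :
    ∑ i ∈ Finset.Icc 1 j, f i - ∑ i ∈ Finset.Icc 1 (j - 1), f i = f j := by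
  obtain ⟨k, rfl⟩ := Nat.exists_eq_add_of_le' hj
  rw [Nat.add_sub_cancel, Finset.sum_Icc_succ_top (by omega)]
  ring

theorem sum_prev_sub (u : ℕ → ℝ) (n : ℕ) :
    ∑ i ∈ Finset.Icc 1 n, (u (i - 1) - u i) = u 0 - u n := by
  induction n with
  | zero => simp
  | succ n ih => rw [Finset.sum_Icc_succ_top (by omega), ih, Nat.add_sub_cancel]; ring

theorem abs_sum_le_sqrt_mul_sqrt (e : ℕ → ℝ) (n : ℕ) :
    |∑ i ∈ Finset.Icc 1 n, e i| ≤ √n * √(∑ i ∈ Finset.Icc 1 n, e i ^ 2) := by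
  refine (Finset.abs_sum_le_sum_abs _ _).trans ?_
  have := Real.sum_mul_le_sqrt_mul_sqrt (Finset.Icc 1 n) (fun _ => 1) (fun i => |e i|)
  simpa using this

/-- Since `w 0 = 1`, the subtracted sum of squares cancels the diagonal of the form at `z`. The four
terms left are the ones estimated separately. -/
theorem kernelEstimator_sub_eq {w : ℝ → ℝ} {b : ℕ → ℝ} (hw0 : w 0 = 1)
    (hw : ∀ x, w (-x) = w x) {y z d : ℕ → ℝ} {c : ℝ}
    (hy : ∀ j, 1 ≤ j → y j - c = z j + d j) {n : ℕ} (hn : 1 ≤ n) :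
    let K : ℤ → ℝ := fun k => w ((k : ℝ) * b n)
    let m := sampleMean (fun j => y j - c) n
    kernelEstimator w b y n - (n : ℝ)⁻¹ * ∑ k ∈ Finset.Icc 1 n, z k ^ 2
      = (n : ℝ)⁻¹ * (2 * lagOffDiag K n z + lagForm K n d (fun j => 2 * z j + d j)
        - 2 * m * lagForm K n (fun _ => 1) (fun j => y j - c)
        + m ^ 2 * lagForm K n (fun _ => 1) (fun _ => 1)) := by
  intro K m
  have hK : ∀ k, K (-k) = K k := by
    intro k
    simp only [K]
    rw [← hw]; congr 1; push_cast; ring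
  have h1 : lagForm K n (fun j => y j - sampleMean y n) (fun j => y j - sampleMean y n)
      = lagForm K n (fun j => (y j - c) - m) (fun j => (y j - c) - m) := by
    simp only [m, sampleMean_sub_const y c hn, sub_sub_sub_cancel_right]
  have h2 := lagForm_sub_const hK n (fun j => y j - c) m
  have h3 := lagForm_self_sub_self hK n (fun j => y j - c) z
  have h4 := lagForm_self_eq hK n z
  have h5 : lagForm K n (fun j => (y j - c) - z j) (fun j => (y j - c) + z j)
      = lagForm K n d (fun j => 2 * z j + d j) :=
    lagForm_congr (fun i hi => by rw [hy i hi]; ring) (fun i hi => by rw [hy i hi]; ring)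
  have hK0 : K 0 = 1 := by simp [K, hw0]
  rw [hK0] at h4
  rw [h5] at h3
  rw [kernelEstimator_eq_lagForm, h1, h2]
  linear_combination (n : ℝ)⁻¹ * h3 + (n : ℝ)⁻¹ * h4

set_option maxHeartbeats 1000000 in
/-- The deterministic part of the limit theorem: a sequence that decomposes as a noise `z`, the
increments of a sequence `u` and a square summable perturbation `e`. -/
theorem tendsto_kernelEstimator_sub {w : ℝ → ℝ} {r : ℕ} (hw : A4 w r) {b : ℕ → ℝ}
    (hb : IsBandwidth b) {δ Kb : ℝ} (hδ : 0 < δ) (hbδ : ∀ n : ℕ, 1 ≤ n → b n ≤ Kb * (n : ℝ) ^ (-δ))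
    {y z u e v : ℕ → ℝ} {c σ κ τ : ℝ}
    (hy : ∀ j, 1 ≤ j → y j - c = z j + ((u (j - 1) - u j) + e j))
    (hσκ : κ + σ < 1) (hσ : σ ≤ κ) (hκ : κ < 3 / 4) (hκ' : 1 / 2 ≤ κ) (hτ : 0 ≤ τ) (hτ1 : τ < 1)
    (hv : ∀ i, 0 ≤ v i)
    (hX : ∀ i j : ℕ, |∑ k ∈ Finset.Icc 1 j, (2 * z k + ((u (k - 1) - u k) + e k))
        - ∑ k ∈ Finset.Icc 1 i, (2 * z k + ((u (k - 1) - u k) + e k))|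
          ≤ v i * |(j : ℝ) - i| ^ τ)
    (hsq : ∀ ε : ℝ, 0 < ε → ∃ C : ℝ, ∀ n : ℕ, 1 ≤ n →
      ∑ i ∈ Finset.Icc 1 n, (v i ^ 2 + u i ^ 2) ≤ C * (n : ℝ) ^ (1 + ε))
    (he : ∃ C : ℝ, ∀ n : ℕ, ∑ i ∈ Finset.Icc 1 n, e i ^ 2 ≤ C)
    (hM : ∃ C : ℝ, ∀ n : ℕ, 1 ≤ n → |∑ i ∈ Finset.Icc 1 n, z i| ≤ C * (n : ℝ) ^ κ)
    (hu : ∃ C : ℝ, ∀ n : ℕ, 1 ≤ n → |u n| ≤ C * (n : ℝ) ^ σ)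
    (hoff : Tendsto (fun n : ℕ => (n : ℝ)⁻¹ * lagOffDiag (fun k => w ((k : ℝ) * b n)) n z)
      atTop (𝓝 0)) :
    Tendsto (fun n : ℕ => kernelEstimator w b y n - (n : ℝ)⁻¹ * ∑ k ∈ Finset.Icc 1 n, z k ^ 2)
      atTop (𝓝 0) := by
  obtain ⟨Ce, hCe⟩ := he
  obtain ⟨CM, hCM⟩ := hM
  obtain ⟨Cu, hCu⟩ := hu
  have hbpos := hb.pos
  have hbB : ∀ n, 1 ≤ n → b n ≤ b 1 := fun n hn =>
    hb.antitone (Set.mem_Ici.2 le_rfl) (Set.mem_Ici.2 hn) hn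
  obtain ⟨L, hL, hWB⟩ := hw.windowBounds (b 1)
  obtain ⟨Ci, hCi⟩ := hb.inv_isBigO.bound
  -- Smaller than both `δ (1 - τ)` and `1 - τ`, which makes the third and fourth exponents in
  -- `hTbound` negative.
  set ε : ℝ := min δ 1 * (1 - τ) / 2 with hε
  have h1τ : 0 < 1 - τ := by linarith
  have hmin : 0 < min δ 1 := lt_min hδ one_pos
  have hε0 : 0 < ε := by positivity
  have hεδ : ε < δ * (1 - τ) := by
    have : min δ 1 * (1 - τ) ≤ δ * (1 - τ) := by gcongr; exact min_le_left _ _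
    linarith
  have hε1 : ε < 1 - τ := by
    have : min δ 1 * (1 - τ) ≤ 1 * (1 - τ) := by gcongr; exact min_le_right _ _
    linarith
  obtain ⟨CS, hCS⟩ := hsq ε hε0
  have hCe0 : 0 ≤ Ce := by simpa using hCe 0
  have hCM0 : 0 ≤ CM := by simpa using (abs_nonneg _).trans (hCM 1 le_rfl)
  have hCu0 : 0 ≤ Cu := by simpa using (abs_nonneg _).trans (hCu 1 le_rfl)
  have hCS0 : 0 ≤ CS := by
    have h := hCS 1 le_rfl
    simp only [Finset.Icc_self, Finset.sum_singleton, Nat.cast_one, Real.one_rpow, mul_one] at h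
    exact le_trans (by positivity) h
  have hKb0 : 0 < Kb := by simpa using (hbpos 1 le_rfl).trans_le (hbδ 1 le_rfl)
  have hb1 : 0 < b 1 := hbpos 1 le_rfl
  set CA : ℝ := CM + |u 0| + Cu + √Ce with hCA
  have hCA0 : 0 ≤ CA := by positivity
  set d : ℕ → ℝ := fun k => (u (k - 1) - u k) + e k with hd
  set A : ℕ → ℝ := fun j => ∑ k ∈ Finset.Icc 1 j, (y k - c) with hA
  set X : ℕ → ℝ := fun j => ∑ k ∈ Finset.Icc 1 j, (2 * z k + d k) with hXdef
  have hAb : ∀ n : ℕ, 1 ≤ n → ∀ j ≤ n, |A j| ≤ CA * (n : ℝ) ^ κ := by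
    intro n hn j hj
    have hn1 : (1 : ℝ) ≤ n := by exact_mod_cast hn
    rcases Nat.eq_zero_or_pos j with rfl | hj0
    · simp only [hA]; simp; positivity
    have hjn : (j : ℝ) ≤ n := by exact_mod_cast hj
    have hj1 : (1 : ℝ) ≤ j := by exact_mod_cast hj0
    have eA : A j = ∑ i ∈ Finset.Icc 1 j, z i + (u 0 - u j) + ∑ i ∈ Finset.Icc 1 j, e i := by
      rw [← sum_prev_sub, ← Finset.sum_add_distrib, ← Finset.sum_add_distrib]
      refine Finset.sum_congr rfl fun i hi => ?_
      rw [hy i (Finset.mem_Icc.1 hi).1]; ring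
    have hκ0 : 0 ≤ κ := by linarith
    have b1 : |∑ i ∈ Finset.Icc 1 j, z i| ≤ CM * (n : ℝ) ^ κ :=
      (hCM j hj0).trans (by gcongr)
    have b2 : |u 0| ≤ |u 0| * (n : ℝ) ^ κ :=
      le_mul_of_one_le_right (abs_nonneg _) (Real.one_le_rpow hn1 hκ0)
    have b3 : |u j| ≤ Cu * (n : ℝ) ^ κ := by
      refine (hCu j hj0).trans ?_
      gcongr
      exact (Real.rpow_le_rpow_of_exponent_le hj1 hσ).trans (by gcongr)
    have b4 : |∑ i ∈ Finset.Icc 1 j, e i| ≤ √Ce * (n : ℝ) ^ κ := by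
      refine (abs_sum_le_sqrt_mul_sqrt e j).trans ?_
      rw [mul_comm]
      gcongr
      · exact hCe j
      · rw [Real.sqrt_eq_rpow]
        exact (Real.rpow_le_rpow_of_exponent_le hj1 hκ').trans (by gcongr)
    rw [eA]
    have t1 := abs_add_le (∑ i ∈ Finset.Icc 1 j, z i + (u 0 - u j)) (∑ i ∈ Finset.Icc 1 j, e i)
    have t2 := abs_add_le (∑ i ∈ Finset.Icc 1 j, z i) (u 0 - u j)
    have t3 := abs_sub (u 0) (u j)
    have : CA * (n : ℝ) ^ κ = CM * (n : ℝ) ^ κ + |u 0| * (n : ℝ) ^ κ + Cu * (n : ℝ) ^ κ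
      + √Ce * (n : ℝ) ^ κ := by rw [hCA]; ring
    linarith
  have hXb : ∀ n : ℕ, 1 ≤ n → ∀ j ≤ n, |X j| ≤ (CA + CM) * (n : ℝ) ^ κ := by
    intro n hn j hj
    rcases Nat.eq_zero_or_pos j with rfl | hj0
    · simp only [hXdef]; simp; positivity
    have eX : X j = A j + ∑ i ∈ Finset.Icc 1 j, z i := by
      simp only [hA, hXdef]
      rw [← Finset.sum_add_distrib]
      refine Finset.sum_congr rfl fun i hi => ?_
      rw [hy i (Finset.mem_Icc.1 hi).1]; simp only [hd]; ring
    have b1 : |∑ i ∈ Finset.Icc 1 j, z i| ≤ CM * (n : ℝ) ^ κ := by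
      refine (hCM j hj0).trans ?_
      gcongr
    rw [eX, add_mul]
    exact (abs_add_le _ _).trans (add_le_add (hAb n hn j hj) b1)
  -- the remainder
  set T : ℕ → ℝ := fun n => (n : ℝ)⁻¹ * (lagForm (fun k => w ((k : ℝ) * b n)) n d
      (fun j => 2 * z j + d j)
    - 2 * sampleMean (fun j => y j - c) n
      * lagForm (fun k => w ((k : ℝ) * b n)) n (fun _ => 1) (fun j => y j - c)
    + sampleMean (fun j => y j - c) n ^ 2
      * lagForm (fun k => w ((k : ℝ) * b n)) n (fun _ => 1) (fun _ => 1)) with hT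
  set c₁ : ℝ := (1 + 2 * b 1) ^ τ with hc₁
  have hc₁0 : 0 ≤ c₁ := by positivity
  -- In order: the two boundary terms of the summation by parts in `u`, its interior part, the
  -- contribution of `e`, and the corrections for the sample mean.
  have hTbound : ∀ᶠ n : ℕ in atTop, ‖T n‖ ≤
      (3 * L * (CA + CM) * Cu) * (n : ℝ) ^ (κ + σ - 1)
      + (3 * L * (CA + CM) * |u 0|) * (n : ℝ) ^ (κ - 1)
      + (3 * L * c₁ * Kb ^ (1 - τ) * CS) * (n : ℝ) ^ (ε - δ * (1 - τ))
      + (3 * L * c₁ * |Ci| ^ τ * (√Ce * √CS)) * (n : ℝ) ^ ((τ + ε - 1) / 2)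
      + (9 * L * CA ^ 2 * |Ci|) * (n : ℝ) ^ (2 * κ - 3 / 2) := by
    filter_upwards [hCi, eventually_ge_atTop 1] with n hCin hn
    have hbn : 0 < b n := hbpos n hn
    have hN : (0 : ℝ) < n := by exact_mod_cast hn
    have hN1 : (1 : ℝ) ≤ n := by exact_mod_cast hn
    have hK := hWB (b n) hbn (hbB n hn)
    have hinv : (b n)⁻¹ ≤ |Ci| * (n : ℝ) ^ (1 / 2 : ℝ) := by
      rw [Real.norm_eq_abs, Real.norm_eq_abs, abs_of_pos (inv_pos.2 hbn),
        abs_of_nonneg (by positivity)] at hCin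
      exact hCin.trans (by gcongr; exact le_abs_self _)
    have hW : ((b n)⁻¹ + 2) ^ τ ≤ c₁ * ((b n)⁻¹) ^ τ := by
      rw [hc₁, ← Real.mul_rpow (by positivity) (by positivity)]
      gcongr
      have := mul_le_mul_of_nonneg_right (hbB n hn) (inv_pos.2 hbn).le
      rw [mul_inv_cancel₀ hbn.ne'] at this
      linarith
    have hmul : ∀ s : ℝ, (n : ℝ) * (n : ℝ) ^ s = (n : ℝ) ^ (1 + s) := fun s => by
      rw [Real.rpow_add hN, Real.rpow_one]
    have hS0 : 0 ≤ ∑ i ∈ Finset.Icc 1 n, (v i ^ 2 + u i ^ 2) :=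
      Finset.sum_nonneg fun i _ => by positivity
    -- the main form
    have hmain := hK.abs_lagForm_le hbn (X := X) (u := u) (e := e) (y := v) hn hτ hv
      (hXb n hn) hX
    have hmeq : lagForm (fun k => w ((k : ℝ) * b n)) n d (fun j => 2 * z j + d j)
        = lagForm (fun k => w ((k : ℝ) * b n)) n (fun i => (u (i - 1) - u i) + e i)
          (fun j => X j - X (j - 1)) :=
      lagForm_congr (fun i _ => rfl) (fun i hi => (partialSum_sub_prev (fun k => 2 * z k + d k) hi).symm)
    rw [← hmeq] at hmain
    have m1 : 3 * L * ((CA + CM) * (n : ℝ) ^ κ) * (|u n| + |u 0|)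
        ≤ (n : ℝ) * ((3 * L * (CA + CM) * Cu) * (n : ℝ) ^ (κ + σ - 1)
        + (3 * L * (CA + CM) * |u 0|) * (n : ℝ) ^ (κ - 1)) := by
      have e1 : (n : ℝ) ^ (κ + σ - 1) = (n : ℝ) ^ κ * (n : ℝ) ^ σ * (n : ℝ)⁻¹ := by
        rw [Real.rpow_sub_one hN.ne', Real.rpow_add hN, div_eq_mul_inv]
      have e2 : (n : ℝ) ^ (κ - 1) = (n : ℝ) ^ κ * (n : ℝ)⁻¹ := by
        rw [Real.rpow_sub_one hN.ne', div_eq_mul_inv]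
      rw [e1, e2]
      calc _ ≤ 3 * L * ((CA + CM) * (n : ℝ) ^ κ) * (Cu * (n : ℝ) ^ σ + |u 0|) := by
            gcongr; exact hCu n hn
        _ = _ := by field_simp
    have m2 : 3 * L * b n * ((b n)⁻¹ + 2) ^ τ * ∑ i ∈ Finset.Icc 1 n, (v i ^ 2 + u i ^ 2)
        ≤ (n : ℝ) * ((3 * L * c₁ * Kb ^ (1 - τ) * CS) * (n : ℝ) ^ (ε - δ * (1 - τ))) := by
      have e1 : (n : ℝ) * (n : ℝ) ^ (ε - δ * (1 - τ))
          = ((n : ℝ) ^ (-δ)) ^ (1 - τ) * (n : ℝ) ^ (1 + ε) := by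
        rw [← Real.rpow_mul hN.le, ← Real.rpow_add hN, hmul]
        congr 1; ring
      -- The polynomial decay of the bandwidth is essential here: `b ^ (1 - τ)` must beat `n ^ ε`.
      have e2 : b n * ((b n)⁻¹) ^ τ ≤ Kb ^ (1 - τ) * ((n : ℝ) ^ (-δ)) ^ (1 - τ) := by
        have : b n * ((b n)⁻¹) ^ τ = (b n) ^ (1 - τ) := by
          rw [Real.rpow_sub hbn, Real.rpow_one, Real.inv_rpow hbn.le, div_eq_mul_inv]
        rw [this, ← Real.mul_rpow hKb0.le (by positivity)]
        gcongr
        exact hbδ n hn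
      calc _ ≤ 3 * L * b n * (c₁ * ((b n)⁻¹) ^ τ) * (CS * (n : ℝ) ^ (1 + ε)) := by
            gcongr; exact hCS n hn
        _ = 3 * L * c₁ * (b n * ((b n)⁻¹) ^ τ) * (CS * (n : ℝ) ^ (1 + ε)) := by ring
        _ ≤ 3 * L * c₁ * (Kb ^ (1 - τ) * ((n : ℝ) ^ (-δ)) ^ (1 - τ))
            * (CS * (n : ℝ) ^ (1 + ε)) := by gcongr
        _ = (3 * L * c₁ * Kb ^ (1 - τ) * CS)
            * (((n : ℝ) ^ (-δ)) ^ (1 - τ) * (n : ℝ) ^ (1 + ε)) := by ring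
        _ = _ := by rw [← e1]; ring
    have m3 : 3 * L * ((b n)⁻¹ + 2) ^ τ * (√(∑ i ∈ Finset.Icc 1 n, e i ^ 2)
          * √(∑ i ∈ Finset.Icc 1 n, (v i ^ 2 + u i ^ 2)))
        ≤ (n : ℝ) * ((3 * L * c₁ * |Ci| ^ τ * (√Ce * √CS)) * (n : ℝ) ^ ((τ + ε - 1) / 2)) := by
      have e1 : (n : ℝ) * (n : ℝ) ^ ((τ + ε - 1) / 2)
          = ((n : ℝ) ^ (1 / 2 : ℝ)) ^ τ * √((n : ℝ) ^ (1 + ε)) := by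
        rw [Real.sqrt_eq_rpow, ← Real.rpow_mul hN.le, ← Real.rpow_mul hN.le, ← Real.rpow_add hN,
          hmul]
        congr 1; ring
      calc _ ≤ 3 * L * (c₁ * (|Ci| * (n : ℝ) ^ (1 / 2 : ℝ)) ^ τ)
            * (√Ce * √(CS * (n : ℝ) ^ (1 + ε))) := by
            gcongr
            · exact hW.trans (by gcongr)
            · exact hCe n
            · exact hCS n hn
        _ = (3 * L * c₁ * |Ci| ^ τ * (√Ce * √CS))
            * (((n : ℝ) ^ (1 / 2 : ℝ)) ^ τ * √((n : ℝ) ^ (1 + ε))) := by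
            rw [Real.mul_rpow (abs_nonneg _) (by positivity), Real.sqrt_mul hCS0]
            ring
        _ = _ := by rw [← e1]; ring
    -- the terms with the sample mean
    set m := sampleMean (fun j => y j - c) n with hm
    have hmle : |m| ≤ (n : ℝ)⁻¹ * (CA * (n : ℝ) ^ κ) := by
      rw [hm, sampleMean, abs_mul, abs_of_pos (inv_pos.2 hN)]
      gcongr
      exact hAb n hn n le_rfl
    have h1 := hK.abs_lagForm_one_le (hAb n hn) hn
    have h1eq : lagForm (fun k => w ((k : ℝ) * b n)) n (fun _ => 1) (fun j => A j - A (j - 1))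
        = lagForm (fun k => w ((k : ℝ) * b n)) n (fun _ => 1) (fun j => y j - c) :=
      lagForm_congr (fun i _ => rfl) (fun i hi => partialSum_sub_prev _ hi)
    rw [h1eq] at h1
    have h11 := hK.abs_lagForm_one_one_le n
    have m4 : |2 * m * lagForm (fun k => w ((k : ℝ) * b n)) n (fun _ => 1) (fun j => y j - c)|
        + |m ^ 2 * lagForm (fun k => w ((k : ℝ) * b n)) n (fun _ => 1) (fun _ => 1)|
        ≤ (n : ℝ) * ((9 * L * CA ^ 2 * |Ci|) * (n : ℝ) ^ (2 * κ - 3 / 2)) := by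
      have e1 : (n : ℝ) * (n : ℝ) ^ (2 * κ - 3 / 2)
          = (n : ℝ)⁻¹ * (n : ℝ) ^ κ * (n : ℝ) ^ κ * (n : ℝ) ^ (1 / 2 : ℝ) := by
        rw [← Real.rpow_neg_one, ← Real.rpow_add hN, ← Real.rpow_add hN, ← Real.rpow_add hN,
          hmul]
        congr 1; ring
      rw [abs_mul, abs_mul, abs_mul, abs_pow, abs_two]
      calc _ ≤ 2 * ((n : ℝ)⁻¹ * (CA * (n : ℝ) ^ κ))
              * (4 * L * (|Ci| * (n : ℝ) ^ (1 / 2 : ℝ)) * (CA * (n : ℝ) ^ κ))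
            + ((n : ℝ)⁻¹ * (CA * (n : ℝ) ^ κ)) ^ 2
              * (n * (L * (|Ci| * (n : ℝ) ^ (1 / 2 : ℝ)))) := by
            gcongr
            · exact h1.trans (by gcongr)
            · exact h11.trans (by gcongr)
        _ = (9 * L * CA ^ 2 * |Ci|)
            * ((n : ℝ)⁻¹ * (n : ℝ) ^ κ * (n : ℝ) ^ κ * (n : ℝ) ^ (1 / 2 : ℝ)) := by
            field_simp; ring
        _ = _ := by rw [← e1]; ring
    rw [Real.norm_eq_abs, hT, abs_mul, abs_of_pos (inv_pos.2 hN), inv_mul_le_iff₀ hN]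
    have t1 := abs_add_le (lagForm (fun k => w ((k : ℝ) * b n)) n d (fun j => 2 * z j + d j)
      - 2 * m * lagForm (fun k => w ((k : ℝ) * b n)) n (fun _ => 1) (fun j => y j - c))
      (m ^ 2 * lagForm (fun k => w ((k : ℝ) * b n)) n (fun _ => 1) (fun _ => 1))
    have t2 := abs_sub (lagForm (fun k => w ((k : ℝ) * b n)) n d (fun j => 2 * z j + d j))
      (2 * m * lagForm (fun k => w ((k : ℝ) * b n)) n (fun _ => 1) (fun j => y j - c))
    linarith
  have hTlim : Tendsto T atTop (𝓝 0) := by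
    refine squeeze_zero_norm' hTbound ?_
    have := ((((tendsto_const_mul_rpow_neg (3 * L * (CA + CM) * Cu)
      (by linarith : κ + σ - 1 < 0)).add
      (tendsto_const_mul_rpow_neg (3 * L * (CA + CM) * |u 0|) (by linarith : κ - 1 < 0))).add
      (tendsto_const_mul_rpow_neg (3 * L * c₁ * Kb ^ (1 - τ) * CS)
        (by linarith : ε - δ * (1 - τ) < 0))).add
      (tendsto_const_mul_rpow_neg (3 * L * c₁ * |Ci| ^ τ * (√Ce * √CS))
        (by linarith : (τ + ε - 1) / 2 < 0))).add
      (tendsto_const_mul_rpow_neg (9 * L * CA ^ 2 * |Ci|) (by linarith : 2 * κ - 3 / 2 < 0))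
    simpa using this
  have hsum := (hoff.const_mul 2).add hTlim
  rw [mul_zero, zero_add] at hsum
  refine hsum.congr' ?_
  filter_upwards [eventually_ge_atTop 1] with n hn
  rw [kernelEstimator_sub_eq (b := b) hw.zero hw.even hy hn]
  simp only [hT, hd]
  ring

end DeterministicLimit

/-! ### Taylor-type inequalities for powers. -/

section PowerInequalities

/-- For `|t| ≤ 1`, split off one factor `1 + t` and apply Bernoulli to the power `p - 1 ∈ [0, 1]`;
the quadratic remainder is at most `|t| ^ p`. For `|t| > 1` the last term dominates. -/
theorem abs_one_add_rpow_le {p : ℝ} (hp1 : 1 ≤ p) (hp2 : p ≤ 2) (t : ℝ) :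
    |1 + t| ^ p ≤ 1 + p * t + 4 * |t| ^ p := by
  rcases le_or_gt |t| 1 with h | h
  · have ht := abs_le.1 h
    rw [abs_of_nonneg (by linarith : 0 ≤ 1 + t)]
    have h1 : (1 + t) ^ p ≤ 1 + p * t + (p - 1) * t ^ 2 := by
      rcases eq_or_lt_of_le (by linarith : 0 ≤ 1 + t) with h0 | h0
      · rw [← h0, Real.zero_rpow (by linarith)]
        have : t = -1 := by linarith
        rw [this]; linarith
      · have h2 := rpow_one_add_le_one_add_mul_self ht.1 (p := p - 1) (by linarith) (by linarith)
        calc (1 + t) ^ p = (1 + t) ^ (p - 1) * (1 + t) := by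
              rw [Real.rpow_sub_one h0.ne']; field_simp
          _ ≤ (1 + (p - 1) * t) * (1 + t) := by gcongr
          _ = _ := by ring
    have h3 : t ^ 2 ≤ |t| ^ p := by
      rw [← sq_abs, ← Real.rpow_natCast]
      exact Real.rpow_le_rpow_of_exponent_ge' (abs_nonneg _) h (by linarith)
        (by push_cast; exact hp2)
    nlinarith [sq_nonneg t]
  · have h4 : |t| ≤ |t| ^ p := by
      simpa using Real.rpow_le_rpow_of_exponent_le h.le hp1
    rcases le_or_gt 0 t with h0 | h0
    · rw [abs_of_nonneg (by linarith : 0 ≤ 1 + t)]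
      rw [abs_of_nonneg h0] at h
      calc (1 + t) ^ p ≤ (2 * t) ^ p := by gcongr; linarith
        _ = 2 ^ p * t ^ p := by rw [Real.mul_rpow (by norm_num) h0]
        _ ≤ 4 * |t| ^ p := by
          rw [abs_of_nonneg h0]
          gcongr
          calc (2 : ℝ) ^ p ≤ 2 ^ (2 : ℝ) := by gcongr; norm_num
            _ = 4 := by norm_num
        _ ≤ _ := by nlinarith
    · have : |1 + t| ^ p ≤ |t| ^ p := by
        refine Real.rpow_le_rpow (abs_nonneg _) ?_ (by linarith)
        have := abs_of_neg h0
        rw [abs_le]; constructor <;> linarith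
      have h5 : -|t| ≤ t := neg_abs_le t
      nlinarith [abs_nonneg t]

/-- For `|t| ≤ 1`, square the corresponding estimate for the exponent `q / 2 ∈ [1, 2]`; for `|t| >
1` use `(2|t|) ^ q ≤ 16 |t| ^ q`. -/
theorem abs_one_add_rpow_le_of_two_le {q : ℝ} (hq1 : 2 ≤ q) (hq2 : q ≤ 4) (t : ℝ) :
    |1 + t| ^ q ≤ 1 + q * t + 20 * (t ^ 2 + |t| ^ q) := by
  have hq0 : 0 ≤ |t| ^ q := by positivity
  rcases le_or_gt |t| 1 with h | h
  · have ht := abs_le.1 h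
    have h1 := abs_one_add_rpow_le (by linarith : 1 ≤ q / 2) (by linarith) t
    set s := q / 2 with hs
    have h2 : (1 + t) ^ s ≤ 1 + s * t + (s - 1) * t ^ 2 := by
      rcases eq_or_lt_of_le (by linarith : 0 ≤ 1 + t) with h0 | h0
      · rw [← h0, Real.zero_rpow (by linarith)]
        have : t = -1 := by linarith
        rw [this]; linarith
      · have h2 := rpow_one_add_le_one_add_mul_self ht.1 (p := s - 1) (by linarith) (by linarith)
        calc (1 + t) ^ s = (1 + t) ^ (s - 1) * (1 + t) := by
              rw [Real.rpow_sub_one h0.ne']; field_simp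
          _ ≤ (1 + (s - 1) * t) * (1 + t) := by gcongr
          _ = _ := by ring
    have h0 : 0 ≤ 1 + t := by linarith
    have h3 : |1 + t| ^ q = ((1 + t) ^ s) ^ 2 := by
      rw [abs_of_nonneg h0, ← Real.rpow_natCast, ← Real.rpow_mul h0]
      congr 1; rw [hs]; push_cast; ring
    have h4 : (0 : ℝ) ≤ (1 + t) ^ s := by positivity
    have ht2 : t ^ 2 ≤ 1 := by nlinarith
    have h5 : ((1 + t) ^ s) ^ 2 ≤ (1 + s * t + (s - 1) * t ^ 2) ^ 2 := by gcongr
    have h6 : (1 + s * t + (s - 1) * t ^ 2) ^ 2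
        = 1 + q * t + t ^ 2 * (s ^ 2 + (s - 1) ^ 2 * t ^ 2 + 2 * (s - 1) + 2 * s * (s - 1) * t) := by
      rw [show q = 2 * s by rw [hs]; ring]; ring
    have hs1 : 0 ≤ s - 1 := by linarith
    have hs2 : s - 1 ≤ 1 := by linarith
    have h7 : s ^ 2 + (s - 1) ^ 2 * t ^ 2 + 2 * (s - 1) + 2 * s * (s - 1) * t ≤ 20 := by
      have a1 : s ^ 2 ≤ 4 := by nlinarith
      have a2 : (s - 1) ^ 2 * t ^ 2 ≤ 1 * 1 := by gcongr; nlinarith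
      have a3 : 2 * s * (s - 1) * t ≤ 2 * 2 * 1 * 1 := by
        calc 2 * s * (s - 1) * t ≤ 2 * s * (s - 1) * 1 := by gcongr; exact ht.2
          _ ≤ 2 * 2 * 1 * 1 := by gcongr; linarith
      linarith
    rw [h3]
    nlinarith [sq_nonneg t]
  · have h4 : |t| ≤ |t| ^ q := by
      simpa using Real.rpow_le_rpow_of_exponent_le h.le (by linarith : (1 : ℝ) ≤ q)
    have h5 : |1 + t| ^ q ≤ 16 * |t| ^ q := by
      calc |1 + t| ^ q ≤ (2 * |t|) ^ q := by
            gcongr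
            have := abs_add_le 1 t
            rw [abs_one] at this
            linarith
        _ = 2 ^ q * |t| ^ q := by rw [Real.mul_rpow (by norm_num) (abs_nonneg _)]
        _ ≤ 16 * |t| ^ q := by
          gcongr
          calc (2 : ℝ) ^ q ≤ 2 ^ (4 : ℝ) := by gcongr; norm_num
            _ = 16 := by norm_num
    have h6 : -|t| ≤ t := neg_abs_le t
    nlinarith [abs_nonneg t, sq_nonneg t]

theorem abs_rpow_mul_sq {x q : ℝ} (hx : x ≠ 0) : |x| ^ (q - 2) * x ^ 2 = |x| ^ q := by
  have hx' : 0 < |x| := abs_pos.2 hx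
  rw [← sq_abs, ← Real.rpow_natCast |x| 2, ← Real.rpow_add hx']
  congr 1; push_cast; ring

theorem abs_add_rpow_le {p : ℝ} (hp1 : 1 ≤ p) (hp2 : p ≤ 2) (x y : ℝ) :
    |x + y| ^ p ≤ |x| ^ p + p * (|x| ^ (p - 2) * x * y) + 4 * |y| ^ p := by
  by_cases hx : x = 0
  · subst hx
    simp only [zero_add, mul_zero, zero_mul, abs_zero, Real.zero_rpow (by linarith : p ≠ 0)]
    nlinarith [Real.rpow_nonneg (abs_nonneg y) p]
  · have h := mul_le_mul_of_nonneg_left (abs_one_add_rpow_le hp1 hp2 (y / x))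
      (Real.rpow_nonneg (abs_nonneg x) p)
    rw [← Real.mul_rpow (abs_nonneg _) (abs_nonneg _), ← abs_mul, mul_add, mul_one,
      mul_div_cancel₀ _ hx] at h
    have e1 : |x| ^ p * |y / x| ^ p = |y| ^ p := by
      rw [← Real.mul_rpow (abs_nonneg _) (abs_nonneg _), ← abs_mul, mul_div_cancel₀ _ hx]
    have e2 : |x| ^ p * (y / x) = |x| ^ (p - 2) * x * y := by
      rw [← abs_rpow_mul_sq hx]; field_simp
    calc _ ≤ _ := h
      _ = |x| ^ p + p * (|x| ^ p * (y / x)) + 4 * (|x| ^ p * |y / x| ^ p) := by ring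
      _ = _ := by rw [e1, e2]

theorem abs_add_rpow_le_of_two_le {q : ℝ} (hq1 : 2 < q) (hq2 : q ≤ 4) (x y : ℝ) :
    |x + y| ^ q ≤ |x| ^ q + q * (|x| ^ (q - 2) * x * y)
      + 20 * (|x| ^ (q - 2) * y ^ 2 + |y| ^ q) := by
  by_cases hx : x = 0
  · subst hx
    simp only [zero_add, mul_zero, zero_mul, abs_zero, Real.zero_rpow (by linarith : q ≠ 0),
      Real.zero_rpow (by linarith : q - 2 ≠ 0)]
    nlinarith [Real.rpow_nonneg (abs_nonneg y) q]
  · have h := mul_le_mul_of_nonneg_left (abs_one_add_rpow_le_of_two_le hq1.le hq2 (y / x))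
      (Real.rpow_nonneg (abs_nonneg x) q)
    rw [← Real.mul_rpow (abs_nonneg _) (abs_nonneg _), ← abs_mul, mul_add, mul_one,
      mul_div_cancel₀ _ hx] at h
    have e1 : |x| ^ q * |y / x| ^ q = |y| ^ q := by
      rw [← Real.mul_rpow (abs_nonneg _) (abs_nonneg _), ← abs_mul, mul_div_cancel₀ _ hx]
    have e2 : |x| ^ q * (y / x) = |x| ^ (q - 2) * x * y := by
      rw [← abs_rpow_mul_sq hx]; field_simp
    have e3 : |x| ^ q * (y / x) ^ 2 = |x| ^ (q - 2) * y ^ 2 := by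
      rw [← abs_rpow_mul_sq hx]; field_simp
    calc _ ≤ _ := h
      _ = |x| ^ q + q * (|x| ^ q * (y / x))
          + 20 * (|x| ^ q * (y / x) ^ 2 + |x| ^ q * |y / x| ^ q) := by ring
      _ = _ := by rw [e1, e2, e3]

theorem rpow_mul_le_add_rpow {a b s t : ℝ} (ha : 0 ≤ a) (hb : 0 ≤ b) (hs : 0 ≤ s) (ht : 0 ≤ t) :
    a ^ s * b ^ t ≤ a ^ (s + t) + b ^ (s + t) := by
  rcases le_total a b with h | h
  · calc a ^ s * b ^ t ≤ b ^ s * b ^ t := by gcongr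
      _ = b ^ (s + t) := (Real.rpow_add_of_nonneg hb hs ht).symm
      _ ≤ _ := le_add_of_nonneg_left (by positivity)
  · calc a ^ s * b ^ t ≤ a ^ s * a ^ t := by gcongr
      _ = a ^ (s + t) := (Real.rpow_add_of_nonneg ha hs ht).symm
      _ ≤ _ := le_add_of_nonneg_right (by positivity)

/-- The induction step of the moment inequality for exponents above `2`. It is the average of
superadditivity of the power `s` and of Bernoulli's inequality, whence `40 = 2 * 20`. -/
theorem rpow_add_step_le {s u x : ℝ} (hs : 1 < s) (hu : 0 ≤ u) (hx : 0 ≤ x) :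
    (40 * u) ^ s + 20 * ((40 * u) ^ (s - 1) * x + x ^ s) ≤ (40 * (u + x)) ^ s := by
  set U := 40 * u with hU
  have hU0 : 0 ≤ U := by positivity
  have h1 : U ^ s + (40 * x) ^ s ≤ (U + 40 * x) ^ s :=
    Real.add_rpow_le_rpow_add hU0 (by positivity) hs.le
  have h2 : U ^ s + U ^ (s - 1) * (40 * x) ≤ (U + 40 * x) ^ s := by
    rcases eq_or_lt_of_le hU0 with h0 | h0
    · rw [← h0, Real.zero_rpow (by linarith), Real.zero_rpow (by linarith)]
      simp; positivity
    · have h3 := one_add_mul_self_le_rpow_one_add (s := 40 * x / U)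
        (by have : 0 ≤ 40 * x / U := by positivity
            linarith) hs.le
      have h4 := mul_le_mul_of_nonneg_left h3 (Real.rpow_nonneg hU0 s)
      rw [← Real.mul_rpow hU0 (by positivity)] at h4
      have e1 : U * (1 + 40 * x / U) = U + 40 * x := by field_simp
      have e2 : U ^ s * (40 * x / U) = U ^ (s - 1) * (40 * x) := by
        rw [Real.rpow_sub_one h0.ne']; field_simp
      rw [e1, mul_add, mul_one] at h4
      have h5 : 0 ≤ U ^ (s - 1) * (40 * x) := by positivity
      have h6 : U ^ s * (s * (40 * x / U)) = s * (U ^ (s - 1) * (40 * x)) := by rw [← e2]; ring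
      rw [h6] at h4
      nlinarith
  have h3 : 40 * x ^ s ≤ (40 * x) ^ s := by
    rw [Real.mul_rpow (by norm_num) hx]
    gcongr
    simpa using Real.rpow_le_rpow_of_exponent_le (by norm_num : (1 : ℝ) ≤ 40) hs.le
  have e : 40 * (u + x) = U + 40 * x := by rw [hU]; ring
  rw [e]
  nlinarith

end PowerInequalities

/-! ### Moment inequalities and convergence for martingale differences. -/

section MartingaleDifferences

variable {Ω : Type*} {mΩ : MeasurableSpace Ω} {Pr : Measure Ω}
  {ℱ : Filtration ℕ mΩ}

/-- `d 1, d 2, …` is a sequence of martingale differences. -/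
structure IsMartingaleDiff (Pr : Measure Ω) (ℱ : Filtration ℕ mΩ) (d : ℕ → Ω → ℝ) : Prop where
  adapted : ∀ n, 1 ≤ n → StronglyMeasurable[ℱ n] (d n)
  integrable : ∀ n, 1 ≤ n → Integrable (d n) Pr
  condExp : ∀ n, Pr[d (n + 1) | ℱ n] =ᵐ[Pr] 0

variable {d : ℕ → Ω → ℝ}

theorem IsMartingaleDiff.mul_prev (hd : IsMartingaleDiff Pr ℱ d) {a : ℕ → Ω → ℝ}
    (ha : ∀ n, StronglyMeasurable[ℱ n] (a n))
    (hint : ∀ n, Integrable (fun ω => a n ω * d (n + 1) ω) Pr) :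
    IsMartingaleDiff Pr ℱ (fun n ω => a (n - 1) ω * d n ω) where
  adapted n hn := ((ha (n - 1)).mono (ℱ.mono (Nat.sub_le _ _))).mul (hd.adapted n hn)
  integrable n hn := by
    obtain ⟨k, rfl⟩ := Nat.exists_eq_add_of_le' hn
    exact hint k
  condExp n := by
    have h := condExp_mul_of_stronglyMeasurable_left (μ := Pr) (ha n) (hint n)
      (hd.integrable (n + 1) (by omega))
    filter_upwards [h, hd.condExp n] with ω h1 h2
    have h3 : (a n * Pr[d (n + 1) | ℱ n]) ω = 0 := by
      rw [Pi.mul_apply, h2, Pi.zero_apply, mul_zero]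
    rw [h3] at h1
    exact h1

theorem IsMartingaleDiff.const_mul (hd : IsMartingaleDiff Pr ℱ d) (c : ℕ → ℝ) :
    IsMartingaleDiff Pr ℱ (fun n ω => c n * d n ω) := by
  have h := hd.mul_prev (a := fun n _ => c (n + 1)) (fun n => stronglyMeasurable_const)
    (fun n => (hd.integrable (n + 1) (by omega)).const_mul _)
  refine ⟨fun n hn => ?_, fun n hn => ?_, fun n => ?_⟩
  · exact (hd.adapted n hn).const_mul _
  · exact (hd.integrable n hn).const_mul _
  · exact h.condExp n

theorem IsMartingaleDiff.stronglyMeasurable_sum (hd : IsMartingaleDiff Pr ℱ d) (n : ℕ) :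
    StronglyMeasurable[ℱ n] (fun ω => ∑ i ∈ Finset.Icc 1 n, d i ω) :=
  Finset.stronglyMeasurable_fun_sum _ fun i hi =>
    (hd.adapted i (Finset.mem_Icc.1 hi).1).mono (ℱ.mono (Finset.mem_Icc.1 hi).2)

theorem memLp_of_integrable_abs_rpow {f : Ω → ℝ} {q : ℝ} (hq : 0 < q)
    (hf : AEStronglyMeasurable f Pr) (hint : Integrable (fun ω => |f ω| ^ q) Pr) :
    MemLp f (ENNReal.ofReal q) Pr := by
  rw [← integrable_norm_rpow_iff hf (by simpa using hq) ENNReal.ofReal_ne_top,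
    ENNReal.toReal_ofReal hq.le]
  simpa only [Real.norm_eq_abs] using hint

theorem integrable_abs_rpow_of_memLp {f : Ω → ℝ} {q : ℝ} (hq : 0 < q)
    (hf : MemLp f (ENNReal.ofReal q) Pr) : Integrable (fun ω => |f ω| ^ q) Pr := by
  have := hf.integrable_norm_rpow (by simpa using hq) ENNReal.ofReal_ne_top
  rw [ENNReal.toReal_ofReal hq.le] at this
  simpa only [Real.norm_eq_abs] using this

theorem integrable_abs_sum_rpow {q : ℝ} (hq : 0 < q) {ι : Type*} {d : ι → Ω → ℝ} (F : Finset ι)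
    (hmeas : ∀ i ∈ F, AEStronglyMeasurable (d i) Pr)
    (hint : ∀ i ∈ F, Integrable (fun ω => |d i ω| ^ q) Pr) :
    Integrable (fun ω => |∑ i ∈ F, d i ω| ^ q) Pr :=
  integrable_abs_rpow_of_memLp hq <| memLp_finsetSum F fun i hi =>
    memLp_of_integrable_abs_rpow hq (hmeas i hi) (hint i hi)

theorem integrable_rpow_mul_rpow {f g : Ω → ℝ} {s t : ℝ} (hs : 0 ≤ s) (ht : 0 ≤ t)
    (hf : AEStronglyMeasurable f Pr) (hg : AEStronglyMeasurable g Pr)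
    (hfi : Integrable (fun ω => |f ω| ^ (s + t)) Pr)
    (hgi : Integrable (fun ω => |g ω| ^ (s + t)) Pr) :
    Integrable (fun ω => |f ω| ^ s * |g ω| ^ t) Pr := by
  refine (hfi.add hgi).mono' ?_ (ae_of_all _ fun ω => ?_)
  · have h1 : AEMeasurable (fun ω => |f ω| ^ s) Pr := (hf.aemeasurable.abs).pow_const s
    have h2 : AEMeasurable (fun ω => |g ω| ^ t) Pr := (hg.aemeasurable.abs).pow_const t
    exact (h1.mul h2).aestronglyMeasurable
  · rw [Real.norm_eq_abs, abs_of_nonneg (by positivity)]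
    exact rpow_mul_le_add_rpow (abs_nonneg _) (abs_nonneg _) hs ht

variable [IsProbabilityMeasure Pr]

theorem IsMartingaleDiff.martingale_sum (hd : IsMartingaleDiff Pr ℱ d) :
    Martingale (fun n ω => ∑ i ∈ Finset.Icc 1 n, d i ω) ℱ Pr := by
  refine martingale_of_condExp_sub_eq_zero_nat hd.stronglyMeasurable_sum
    (fun n => integrable_finsetSum _ fun i hi => hd.integrable i (Finset.mem_Icc.1 hi).1)
    fun n => ?_
  have : ((fun ω => ∑ i ∈ Finset.Icc 1 (n + 1), d i ω)
      - fun ω => ∑ i ∈ Finset.Icc 1 n, d i ω) = d (n + 1) := by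
    ext ω
    simp only [Pi.sub_apply]
    rw [Finset.sum_Icc_succ_top (by omega)]; ring
  rw [this]
  exact hd.condExp n

theorem IsMartingaleDiff.integral_mul_eq_zero (hd : IsMartingaleDiff Pr ℱ d) {n : ℕ} {f : Ω → ℝ}
    (hf : StronglyMeasurable[ℱ n] f) (hint : Integrable (fun ω => f ω * d (n + 1) ω) Pr) :
    ∫ ω, f ω * d (n + 1) ω ∂Pr = 0 := by
  have h := condExp_mul_of_stronglyMeasurable_left (μ := Pr) hf hint
    (hd.integrable (n + 1) (by omega))
  have h2 := integral_condExp (μ := Pr) (f := f * d (n + 1)) (ℱ.le n)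
  have h3 : ∫ ω, (Pr[f * d (n + 1) | ℱ n]) ω ∂Pr = 0 := by
    rw [integral_eq_zero_of_ae]
    filter_upwards [h, hd.condExp n] with ω h1 h2
    rw [h1, Pi.mul_apply, h2, Pi.zero_apply, mul_zero]
  rw [← h3, h2]
  rfl

/-- Up to the factor `q`, this is the first-order term in the expansion of `|S + d| ^ q`. Its
coefficient is known at time `n`, so it is orthogonal to the next difference; integrability follows
from `a ^ (q - 1) * b ≤ a ^ q + b ^ q`. -/
theorem IsMartingaleDiff.cross_term (hd : IsMartingaleDiff Pr ℱ d) {q : ℝ} (hq : 1 ≤ q)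
    (hint : ∀ n, 1 ≤ n → Integrable (fun ω => |d n ω| ^ q) Pr) (n : ℕ) :
    Integrable (fun ω => |∑ i ∈ Finset.Icc 1 n, d i ω| ^ (q - 2)
      * (∑ i ∈ Finset.Icc 1 n, d i ω) * d (n + 1) ω) Pr ∧
    ∫ ω, |∑ i ∈ Finset.Icc 1 n, d i ω| ^ (q - 2)
      * (∑ i ∈ Finset.Icc 1 n, d i ω) * d (n + 1) ω ∂Pr = 0 := by
  set S : Ω → ℝ := fun ω => ∑ i ∈ Finset.Icc 1 n, d i ω with hS
  have hSm : StronglyMeasurable[ℱ n] S := hd.stronglyMeasurable_sum n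
  have hdm := ((hd.adapted (n + 1) (by omega)).mono (ℱ.le _))
  have hSint : Integrable (fun ω => |S ω| ^ q) Pr :=
    integrable_abs_sum_rpow (by linarith) _
      (fun i hi => ((hd.adapted i (Finset.mem_Icc.1 hi).1).mono (ℱ.le _)).aestronglyMeasurable)
      (fun i hi => hint i (Finset.mem_Icc.1 hi).1)
  have hψ : StronglyMeasurable[ℱ n] (fun ω => |S ω| ^ (q - 2) * S ω) := by
    have h1 : Measurable (fun x : ℝ => |x| ^ (q - 2) * x) := by fun_prop
    exact (h1.comp hSm.measurable).stronglyMeasurable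
  have hI : Integrable (fun ω => |S ω| ^ (q - 2) * S ω * d (n + 1) ω) Pr := by
    have hb := integrable_rpow_mul_rpow (s := q - 1) (t := 1) (by linarith) zero_le_one
      (hSm.mono (ℱ.le n)).aestronglyMeasurable hdm.aestronglyMeasurable
      (by simpa using hSint) (by simpa using hint (n + 1) (by omega))
    refine hb.mono' (((hψ.mono (ℱ.le n)).mul hdm).aestronglyMeasurable)
      (ae_of_all _ fun ω => ?_)
    rw [Real.norm_eq_abs, abs_mul, abs_mul, Real.rpow_one,
      abs_of_nonneg (Real.rpow_nonneg (abs_nonneg _) _)]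
    refine mul_le_mul_of_nonneg_right ?_ (abs_nonneg _)
    rcases eq_or_ne (S ω) 0 with h | h
    · rw [h, abs_zero, mul_zero]; exact Real.rpow_nonneg le_rfl _
    · refine le_of_eq ?_
      have : 0 < |S ω| := abs_pos.2 h
      rw [show q - 2 = (q - 1) - 1 by ring, Real.rpow_sub_one this.ne']
      field_simp
  exact ⟨hI, hd.integral_mul_eq_zero hψ hI⟩

/-- The von Bahr–Esseen inequality. -/
theorem IsMartingaleDiff.integral_abs_sum_rpow_le (hd : IsMartingaleDiff Pr ℱ d) {p : ℝ}
    (hp1 : 1 ≤ p) (hp2 : p ≤ 2) (hint : ∀ n, 1 ≤ n → Integrable (fun ω => |d n ω| ^ p) Pr)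
    (n : ℕ) :
    ∫ ω, |∑ i ∈ Finset.Icc 1 n, d i ω| ^ p ∂Pr
      ≤ 4 * ∑ i ∈ Finset.Icc 1 n, ∫ ω, |d i ω| ^ p ∂Pr := by
  have hSint : ∀ n, Integrable (fun ω => |∑ i ∈ Finset.Icc 1 n, d i ω| ^ p) Pr := fun n =>
    integrable_abs_sum_rpow (by linarith) _
      (fun i hi => ((hd.adapted i (Finset.mem_Icc.1 hi).1).mono (ℱ.le _)).aestronglyMeasurable)
      (fun i hi => hint i (Finset.mem_Icc.1 hi).1)
  induction n with
  | zero => simp [Real.zero_rpow (by linarith : p ≠ 0)]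
  | succ n ih =>
    obtain ⟨hc1, hc2⟩ := hd.cross_term hp1 hint n
    have hdi := hint (n + 1) (by omega)
    calc ∫ ω, |∑ i ∈ Finset.Icc 1 (n + 1), d i ω| ^ p ∂Pr
        ≤ ∫ ω, (|∑ i ∈ Finset.Icc 1 n, d i ω| ^ p
          + p * (|∑ i ∈ Finset.Icc 1 n, d i ω| ^ (p - 2)
            * (∑ i ∈ Finset.Icc 1 n, d i ω) * d (n + 1) ω) + 4 * |d (n + 1) ω| ^ p) ∂Pr := by
          refine integral_mono (hSint (n + 1))
            (((hSint n).add (hc1.const_mul p)).add (hdi.const_mul 4)) fun ω => ?_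
          simp only
          rw [Finset.sum_Icc_succ_top (by omega)]
          exact abs_add_rpow_le hp1 hp2 _ _
      _ = ∫ ω, |∑ i ∈ Finset.Icc 1 n, d i ω| ^ p ∂Pr + 4 * ∫ ω, |d (n + 1) ω| ^ p ∂Pr := by
          have hA : Integrable (fun ω => |∑ i ∈ Finset.Icc 1 n, d i ω| ^ p
            + p * (|∑ i ∈ Finset.Icc 1 n, d i ω| ^ (p - 2)
              * (∑ i ∈ Finset.Icc 1 n, d i ω) * d (n + 1) ω)) Pr :=
            (hSint n).add (hc1.const_mul p)
          rw [integral_add hA (hdi.const_mul 4),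
            integral_add (hSint n) (hc1.const_mul p), integral_const_mul, integral_const_mul, hc2]
          ring
      _ ≤ _ := by
          rw [Finset.sum_Icc_succ_top (by omega)]
          linarith

/-- A moment inequality of Burkholder type, for exponents between `2` and `4`. -/
theorem IsMartingaleDiff.integral_abs_sum_rpow_le_of_two_lt (hd : IsMartingaleDiff Pr ℱ d) {s : ℝ}
    (hs1 : 1 < s) (hs2 : s ≤ 2)
    (hint : ∀ n, 1 ≤ n → Integrable (fun ω => |d n ω| ^ (2 * s)) Pr) {m : ℕ → ℝ}
    (hm0 : ∀ n, 0 ≤ m n) (hm : ∀ n, 1 ≤ n → ∫ ω, |d n ω| ^ (2 * s) ∂Pr ≤ m n ^ s) (n : ℕ) :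
    ∫ ω, |∑ i ∈ Finset.Icc 1 n, d i ω| ^ (2 * s) ∂Pr
      ≤ (40 * ∑ i ∈ Finset.Icc 1 n, m i) ^ s := by
  have hmeas : ∀ i, 1 ≤ i → AEStronglyMeasurable (d i) Pr := fun i hi =>
    ((hd.adapted i hi).mono (ℱ.le _)).aestronglyMeasurable
  have hSmeas : ∀ n, AEStronglyMeasurable (fun ω => ∑ i ∈ Finset.Icc 1 n, d i ω) Pr := fun n =>
    ((hd.stronglyMeasurable_sum n).mono (ℱ.le _)).aestronglyMeasurable
  have hSint : ∀ n, Integrable (fun ω => |∑ i ∈ Finset.Icc 1 n, d i ω| ^ (2 * s)) Pr := fun n =>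
    integrable_abs_sum_rpow (by linarith) _ (fun i hi => hmeas i (Finset.mem_Icc.1 hi).1)
      (fun i hi => hint i (Finset.mem_Icc.1 hi).1)
  induction n with
  | zero => simp [Real.zero_rpow (by linarith : s ≠ 0), Real.zero_rpow (by linarith : 2 * s ≠ 0)]
  | succ n ih =>
    obtain ⟨hc1, hc2⟩ := hd.cross_term (by linarith : 1 ≤ 2 * s) hint n
    have hdi := hint (n + 1) (by omega)
    set S : Ω → ℝ := fun ω => ∑ i ∈ Finset.Icc 1 n, d i ω with hS
    set D : Ω → ℝ := d (n + 1) with hD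
    have hq : ∀ ω, |S ω| ^ (2 * s - 2) * D ω ^ 2 = |S ω| ^ (2 * s - 2) * |D ω| ^ (2 : ℝ) := by
      intro ω
      rw [← sq_abs (D ω), ← Real.rpow_natCast |D ω| 2]; norm_num
    have hsq : Integrable (fun ω => |S ω| ^ (2 * s - 2) * D ω ^ 2) Pr := by
      simp only [hq]
      exact integrable_rpow_mul_rpow (by linarith) (by norm_num) (hSmeas n)
        (hmeas (n + 1) (by omega)) (by simpa using hSint n) (by simpa using hdi)
    set u := ∑ i ∈ Finset.Icc 1 n, m i with hu
    have hu0 : 0 ≤ u := Finset.sum_nonneg fun i _ => hm0 i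
    set x := m (n + 1) with hx
    have hx0 : 0 ≤ x := hm0 _
    have hDx : ∫ ω, |D ω| ^ (2 * s) ∂Pr ≤ x ^ s := hm (n + 1) (by omega)
    -- Hölder with the conjugate exponents `s / (s - 1)` and `s`; the induction hypothesis bounds
    -- the first factor.
    have hholder : ∫ ω, |S ω| ^ (2 * s - 2) * D ω ^ 2 ∂Pr ≤ (40 * u) ^ (s - 1) * x := by
      have hconj : (s / (s - 1)).HolderConjugate s := by
        rw [Real.holderConjugate_iff]
        have : 0 < s - 1 := by linarith
        refine ⟨by rw [lt_div_iff₀ this]; linarith, by field_simp; ring⟩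
      have hs1' : s - 1 ≠ 0 := by linarith
      have e1 : ∀ ω, (|S ω| ^ (2 * s - 2)) ^ (s / (s - 1)) = |S ω| ^ (2 * s) := by
        intro ω
        rw [← Real.rpow_mul (abs_nonneg _)]
        congr 1; field_simp
      have e2 : ∀ ω, (D ω ^ 2) ^ s = |D ω| ^ (2 * s) := by
        intro ω
        rw [Real.rpow_mul (abs_nonneg _)]; norm_num
      have m1 : MemLp (fun ω => |S ω| ^ (2 * s - 2)) (ENNReal.ofReal (s / (s - 1))) Pr := by
        refine memLp_of_integrable_abs_rpow hconj.pos
          (((hSmeas n).aemeasurable.abs).pow_const _).aestronglyMeasurable ?_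
        simp only [abs_of_nonneg (Real.rpow_nonneg (abs_nonneg _) _), e1]
        exact hSint n
      have m2 : MemLp (fun ω => D ω ^ 2) (ENNReal.ofReal s) Pr := by
        refine memLp_of_integrable_abs_rpow (by linarith)
          ((hmeas (n + 1) (by omega)).pow 2) ?_
        simp only [abs_of_nonneg (sq_nonneg (_ : ℝ)), e2]
        exact hdi
      have h := integral_mul_le_Lp_mul_Lq_of_nonneg (μ := Pr) hconj
        (ae_of_all _ fun ω => Real.rpow_nonneg (abs_nonneg (S ω)) _)
        (ae_of_all _ fun ω => sq_nonneg (D ω)) m1 m2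
      simp only [e1, e2] at h
      refine h.trans ?_
      have f1 : (∫ ω, |S ω| ^ (2 * s) ∂Pr) ^ (1 / (s / (s - 1))) ≤ (40 * u) ^ (s - 1) := by
        calc _ ≤ ((40 * u) ^ s) ^ (1 / (s / (s - 1))) := by
              refine Real.rpow_le_rpow (integral_nonneg fun ω => by positivity) ih ?_
              exact one_div_nonneg.2 hconj.nonneg
          _ = _ := by
              rw [← Real.rpow_mul (by positivity)]
              congr 1; field_simp
      have f2 : (∫ ω, |D ω| ^ (2 * s) ∂Pr) ^ (1 / s) ≤ x := by
        calc _ ≤ (x ^ s) ^ (1 / s) := by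
              refine Real.rpow_le_rpow (integral_nonneg fun ω => by positivity) hDx (by positivity)
          _ = x := by
              rw [← Real.rpow_mul hx0, mul_one_div_cancel (by linarith), Real.rpow_one]
      have : 0 ≤ (∫ ω, |D ω| ^ (2 * s) ∂Pr) ^ (1 / s) :=
        Real.rpow_nonneg (integral_nonneg fun ω => by positivity) _
      gcongr
    calc ∫ ω, |∑ i ∈ Finset.Icc 1 (n + 1), d i ω| ^ (2 * s) ∂Pr
        ≤ ∫ ω, (|S ω| ^ (2 * s) + 2 * s * (|S ω| ^ (2 * s - 2) * S ω * D ω)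
          + 20 * (|S ω| ^ (2 * s - 2) * D ω ^ 2 + |D ω| ^ (2 * s))) ∂Pr := by
          refine integral_mono (hSint (n + 1))
            (((hSint n).add (hc1.const_mul _)).add ((hsq.add hdi).const_mul 20)) fun ω => ?_
          simp only
          rw [Finset.sum_Icc_succ_top (by omega)]
          exact abs_add_rpow_le_of_two_le (by linarith) (by linarith) _ _
      _ = ∫ ω, |S ω| ^ (2 * s) ∂Pr
          + 20 * (∫ ω, |S ω| ^ (2 * s - 2) * D ω ^ 2 ∂Pr + ∫ ω, |D ω| ^ (2 * s) ∂Pr) := by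
          have hA : Integrable (fun ω => |S ω| ^ (2 * s)
            + 2 * s * (|S ω| ^ (2 * s - 2) * S ω * D ω)) Pr := (hSint n).add (hc1.const_mul _)
          have hB : Integrable (fun ω => 20 * (|S ω| ^ (2 * s - 2) * D ω ^ 2
            + |D ω| ^ (2 * s))) Pr := (hsq.add hdi).const_mul 20
          rw [integral_add hA hB, integral_add (hSint n) (hc1.const_mul _), integral_const_mul, integral_const_mul,
            integral_add hsq hdi, hc2]
          ring
      _ ≤ (40 * u) ^ s + 20 * ((40 * u) ^ (s - 1) * x + x ^ s) := by gcongr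
      _ ≤ (40 * (u + x)) ^ s := rpow_add_step_le hs1 hu0 hx0
      _ = _ := by rw [Finset.sum_Icc_succ_top (by omega)]

/-- A martingale whose increments have summable moments of order `p ∈ [1, 2]` converges. -/
theorem IsMartingaleDiff.ae_exists_tendsto_sum (hd : IsMartingaleDiff Pr ℱ d) {p : ℝ}
    (hp1 : 1 ≤ p) (hp2 : p ≤ 2) (hint : ∀ n, 1 ≤ n → Integrable (fun ω => |d n ω| ^ p) Pr)
    {C : ℝ} (hC : ∀ n, ∑ i ∈ Finset.Icc 1 n, ∫ ω, |d i ω| ^ p ∂Pr ≤ C) :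
    ∀ᵐ ω ∂Pr, ∃ c, Tendsto (fun n => ∑ i ∈ Finset.Icc 1 n, d i ω) atTop (𝓝 c) := by
  -- Doob's theorem asks only for boundedness in `L¹`; since `|S| ≤ 1 + |S| ^ p`, the von
  -- Bahr-Esseen bound supplies it.
  refine hd.martingale_sum.submartingale.exists_ae_tendsto_of_bdd (R := (1 + 4 * C).toNNReal)
    fun n => ?_
  have hSint : Integrable (fun ω => |∑ i ∈ Finset.Icc 1 n, d i ω| ^ p) Pr :=
    integrable_abs_sum_rpow (by linarith) _
      (fun i hi => ((hd.adapted i (Finset.mem_Icc.1 hi).1).mono (ℱ.le _)).aestronglyMeasurable)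
      (fun i hi => hint i (Finset.mem_Icc.1 hi).1)
  have hS1 : Integrable (fun ω => ∑ i ∈ Finset.Icc 1 n, d i ω) Pr :=
    integrable_finsetSum _ fun i hi => hd.integrable i (Finset.mem_Icc.1 hi).1
  rw [eLpNorm_one_eq_lintegral_enorm, ← ofReal_integral_norm_eq_lintegral_enorm hS1]
  refine ENNReal.ofReal_le_ofReal ?_
  calc ∫ ω, ‖∑ i ∈ Finset.Icc 1 n, d i ω‖ ∂Pr
      ≤ ∫ ω, (1 + |∑ i ∈ Finset.Icc 1 n, d i ω| ^ p) ∂Pr := by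
        refine integral_mono hS1.norm ((integrable_const _).add hSint) fun ω => ?_
        simp only [Real.norm_eq_abs]
        have := rpow_mul_le_add_rpow (a := 1) zero_le_one
          (abs_nonneg (∑ i ∈ Finset.Icc 1 n, d i ω)) (by linarith : 0 ≤ p - 1) zero_le_one
        simpa using this
    _ = 1 + ∫ ω, |∑ i ∈ Finset.Icc 1 n, d i ω| ^ p ∂Pr := by
        rw [integral_add (integrable_const _) hSint]; simp
    _ ≤ 1 + 4 * C := by
        have := hd.integral_abs_sum_rpow_le hp1 hp2 hint n
        linarith [hC n]

end MartingaleDifferences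

/-! ### Weighted sup norms. -/

section WeightedNorms

theorem wNorm_le_ofReal {S : Type*} {W f : S → ℝ} {c : ℝ} (hW : ∀ x, 0 < W x) (hf : ∀ x, |f x| ≤ c * W x) :
    wNorm W f ≤ ENNReal.ofReal c :=
  iSup_le fun x => ENNReal.ofReal_le_ofReal ((div_le_iff₀ (hW x)).2 (hf x))

variable {S : Type*} [MeasurableSpace S]

theorem exists_abs_le_of_mem_LW {W f : S → ℝ} (hW : ∀ x, 0 < W x) (hf : f ∈ LW W) :
    ∃ c : ℝ, 0 < c ∧ ∀ x, |f x| ≤ c * W x := by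
  obtain ⟨-, hfin⟩ := hf
  refine ⟨(wNorm W f).toReal + 1, by positivity, fun x => ?_⟩
  have h1 : ENNReal.ofReal (|f x| / W x) ≤ wNorm W f := le_iSup (fun x => ENNReal.ofReal _) x
  have h2 := (ENNReal.ofReal_le_iff_le_toReal hfin.ne).1 h1
  rw [← div_le_iff₀ (hW x)]
  linarith

theorem abs_integral_sub_le_of_wNormSub_le {W f : S → ℝ} {μ ν : Measure S} {c B : ℝ}
    (hW : ∀ x, 0 < W x) (hf : Measurable f) (hc : 0 < c) (hB : 0 ≤ B)
    (hfc : ∀ x, |f x| ≤ c * W x) (hμ : Integrable f μ) (hν : Integrable f ν)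
    (h : wNormSub W μ ν ≤ ENNReal.ofReal B) :
    |∫ y, f y ∂μ - ∫ y, f y ∂ν| ≤ c * B := by
  have h1 : ENNReal.ofReal |∫ y, c⁻¹ * f y ∂μ - ∫ y, c⁻¹ * f y ∂ν| ≤ wNormSub W μ ν := by
    refine le_iSup₂ (f := fun (g : S → ℝ) (_ : Measurable g ∧ wNorm W g ≤ 1 ∧ Integrable g μ
      ∧ Integrable g ν) => ENNReal.ofReal |∫ y, g y ∂μ - ∫ y, g y ∂ν|) (fun y => c⁻¹ * f y)
      ⟨hf.const_mul _, ?_, hμ.const_mul _, hν.const_mul _⟩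
    rw [← ENNReal.ofReal_one]
    refine wNorm_le_ofReal hW fun x => ?_
    rw [abs_mul, abs_of_pos (inv_pos.2 hc), inv_mul_le_iff₀ hc, one_mul]
    exact hfc x
  have h2 := (ENNReal.ofReal_le_ofReal_iff hB).1 (h1.trans h)
  rw [integral_const_mul, integral_const_mul, ← mul_sub, abs_mul, abs_of_pos (inv_pos.2 hc),
    inv_mul_le_iff₀ hc] at h2
  exact h2

end WeightedNorms

/-! ### Geometric ergodicity with explicit constants. -/

section GeometricErgodicity

variable {S : Type*} [MeasurableSpace S]

/-- `Q` is geometrically ergodic in the weighted norm with weight `W`, with explicit constants. -/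
structure GeomErgodic (Q : Kernel S S) (π : Measure S) (W : S → ℝ) (C ρ : ℝ) : Prop where
  measurable_weight : Measurable W
  one_le_weight : ∀ x, 1 ≤ W x
  pos : 0 < C
  rate_pos : 0 < ρ
  rate_lt_one : ρ < 1
  invariant : Kernel.Invariant Q π
  integrable_pow : ∀ n x, Integrable W ((Q ^ n) x)
  integrable_inv : Integrable W π
  bound : ∀ (f : S → ℝ) (c : ℝ), Measurable f → 0 < c → (∀ x, |f x| ≤ c * W x) →
    ∀ n x, |∫ y, f y ∂((Q ^ n) x) - ∫ y, f y ∂π| ≤ c * C * ρ ^ n * W x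

theorem isMarkovKernel_pow (Q : Kernel S S) [IsMarkovKernel Q] (n : ℕ) :
    IsMarkovKernel (Q ^ n) := by
  induction n with
  | zero => rw [pow_zero]; exact inferInstanceAs (IsMarkovKernel Kernel.id)
  | succ n ih => rw [pow_succ]; exact inferInstanceAs (IsMarkovKernel ((Q ^ n) ∘ₖ Q))

theorem lintegral_pow_succ (Q : Kernel S S) (n : ℕ) (x : S) {f : S → ℝ≥0∞} (hf : Measurable f) :
    ∫⁻ y, f y ∂((Q ^ (n + 1)) x) = ∫⁻ y, ∫⁻ z, f z ∂(Q y) ∂((Q ^ n) x) := by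
  rw [pow_succ']
  exact Kernel.lintegral_comp Q (Q ^ n) x hf

/-- Linear growth in `n` is wasteful but enough: only integrability of `V` under each iterate is
wanted. -/
theorem lintegral_pow_le_of_drift {Q : Kernel S S} [IsMarkovKernel Q] {V : S → ℝ}
    (hV : Measurable V) (hV1 : ∀ x, 1 ≤ V x) {b lam : ℝ} (hb : 0 < b) (hlam : 0 < lam)
    (hlam1 : lam < 1)
    (hdrift : ∀ x, ∫⁻ y, ENNReal.ofReal (V y) ∂(Q x) ≤ ENNReal.ofReal (lam * V x + b))
    (n : ℕ) (x : S) :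
    ∫⁻ y, ENNReal.ofReal (V y) ∂((Q ^ n) x) ≤ ENNReal.ofReal (V x + n * b) := by
  have hV0 : ∀ x, 0 ≤ V x := fun x => zero_le_one.trans (hV1 x)
  induction n with
  | zero =>
    rw [pow_zero]
    change ∫⁻ y, ENNReal.ofReal (V y) ∂(Kernel.id x) ≤ _
    rw [Kernel.id_apply, lintegral_dirac' x hV.ennreal_ofReal]
    simp
  | succ n ih =>
    have := isMarkovKernel_pow Q n
    rw [lintegral_pow_succ Q n x hV.ennreal_ofReal]
    calc _ ≤ ∫⁻ y, (ENNReal.ofReal (V y) + ENNReal.ofReal b) ∂((Q ^ n) x) := by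
          refine lintegral_mono fun y => (hdrift y).trans ?_
          rw [← ENNReal.ofReal_add (hV0 y) hb.le]
          exact ENNReal.ofReal_le_ofReal (by nlinarith [hV0 y])
      _ = ∫⁻ y, ENNReal.ofReal (V y) ∂((Q ^ n) x) + ENNReal.ofReal b := by
          rw [lintegral_add_right _ measurable_const]; simp
      _ ≤ ENNReal.ofReal (V x + n * b) + ENNReal.ofReal b := by gcongr
      _ = _ := by
          rw [← ENNReal.ofReal_add (by have := hV0 x; positivity) hb.le]
          congr 1; push_cast; ring

theorem integrable_of_lintegral_ofReal_le {μ : Measure S} {f : S → ℝ} (hf : Measurable f)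
    (hf0 : ∀ x, 0 ≤ f x) {B : ℝ} (h : ∫⁻ x, ENNReal.ofReal (f x) ∂μ ≤ ENNReal.ofReal B) :
    Integrable f μ := by
  refine ⟨hf.aestronglyMeasurable, ?_⟩
  rw [hasFiniteIntegral_iff_ofReal (ae_of_all _ hf0)]
  exact h.trans_lt ENNReal.ofReal_lt_top

/-- The norm tests only functions integrable for both measures, so `W` itself cannot be inserted.
Its truncations can, with a bound uniform in the level, and monotone convergence concludes. -/
theorem integrable_weight_of_wNormSub_le {μ π : Measure S} [IsProbabilityMeasure π]
    [IsFiniteMeasure μ] {W : S → ℝ} (hW : Measurable W) (hW1 : ∀ x, 1 ≤ W x)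
    (hμ : Integrable W μ) {B : ℝ} (hB : 0 ≤ B) (h : wNormSub W μ π ≤ ENNReal.ofReal B) :
    Integrable W π := by
  have hW0 : ∀ x, 0 < W x := fun x => zero_lt_one.trans_le (hW1 x)
  have hmin0 : ∀ (N : ℕ) x, 0 ≤ min (W x) N := fun N x => le_min (hW0 x).le (by positivity)
  have hmeas : ∀ N : ℕ, Measurable fun x => min (W x) (N : ℝ) := fun N => hW.min measurable_const
  have hint : ∀ (N : ℕ) (ν : Measure S) [IsFiniteMeasure ν],
      Integrable (fun x => min (W x) (N : ℝ)) ν := fun N ν _ => by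
    refine Integrable.of_bound (hmeas N).aestronglyMeasurable (N : ℝ) (ae_of_all _ fun x => ?_)
    rw [Real.norm_eq_abs, abs_of_nonneg (hmin0 N x)]
    exact min_le_right _ _
  refine integrable_of_lintegral_ofReal_le hW (fun x => (hW0 x).le) (B := ∫ y, W y ∂μ + B) ?_
  have hN : ∀ N : ℕ, ∫⁻ x, ENNReal.ofReal (min (W x) N) ∂π ≤ ENNReal.ofReal (∫ y, W y ∂μ + B) := by
    intro N
    rw [← ofReal_integral_eq_lintegral_ofReal (hint N π) (ae_of_all _ (hmin0 N))]
    refine ENNReal.ofReal_le_ofReal ?_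
    have h1 := abs_integral_sub_le_of_wNormSub_le hW0 (hmeas N) one_pos hB
      (fun x => by rw [abs_of_nonneg (hmin0 N x), one_mul]; exact min_le_left _ _)
      (hint N μ) (hint N π) h
    have h2 : ∫ y, min (W y) (N : ℝ) ∂μ ≤ ∫ y, W y ∂μ :=
      integral_mono (hint N μ) hμ fun x => min_le_left _ _
    have := (abs_le.1 h1).1
    linarith
  have hsup : ∀ x, ENNReal.ofReal (W x) = ⨆ N : ℕ, ENNReal.ofReal (min (W x) N) := by
    intro x
    refine le_antisymm ?_ (iSup_le fun N => ENNReal.ofReal_le_ofReal (min_le_left _ _))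
    obtain ⟨N, hNx⟩ := exists_nat_ge (W x)
    exact le_iSup_of_le N (by rw [min_eq_left hNx])
  simp only [hsup]
  rw [lintegral_iSup (fun N => (hmeas N).ennreal_ofReal)]
  · exact iSup_le hN
  · intro M N hMN x
    refine ENNReal.ofReal_le_ofReal (min_le_min le_rfl ?_)
    exact_mod_cast hMN

variable {Θ : Type*} [MeasurableSpace Θ]

theorem A1.geomErgodic {P : Kernel (Θ × S) S} [IsMarkovKernel P] {π : Measure S}
    [IsProbabilityMeasure π] (hinv : ∀ θ, Kernel.Invariant (P.sectR θ) π) {V : S → ℝ}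
    {μ₀ : Measure (S × Θ)} (hA1 : A1 P π V μ₀) {β : ℝ} (hβ0 : 0 < β) (hβ1 : β ≤ 1) :
    ∃ C ρ : ℝ, ∀ θ, GeomErgodic (P.sectR θ) π (fun x => V x ^ β) C ρ := by
  obtain ⟨ρ, C, hρ0, hρ1, hC, herg⟩ := hA1.ergodic β hβ0 hβ1
  obtain ⟨b, lam, hb, hlam0, hlam1, hdrift⟩ := hA1.drift
  have hV1 := hA1.one_le_V
  have hVm := hA1.measurable_V
  have hWm : Measurable fun x => V x ^ β := hVm.pow_const β
  have hW1 : ∀ x, 1 ≤ V x ^ β := fun x => Real.one_le_rpow (hV1 x) hβ0.le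
  have hW0 : ∀ x, 0 < V x ^ β := fun x => zero_lt_one.trans_le (hW1 x)
  have hWV : ∀ x, V x ^ β ≤ V x := fun x => by
    simpa using Real.rpow_le_rpow_of_exponent_le (hV1 x) hβ1
  refine ⟨C, ρ, fun θ => ?_⟩
  have hpow : ∀ n, IsMarkovKernel (P.sectR θ ^ n) := isMarkovKernel_pow _
  have hint : ∀ n x, Integrable (fun x => V x ^ β) ((P.sectR θ ^ n) x) := by
    intro n x
    have hVint : Integrable V ((P.sectR θ ^ n) x) :=
      integrable_of_lintegral_ofReal_le hVm (fun x => zero_le_one.trans (hV1 x))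
        (lintegral_pow_le_of_drift hVm hV1 hb hlam0 hlam1 (fun x => hdrift x θ) n x)
    refine hVint.mono' hWm.aestronglyMeasurable (ae_of_all _ fun y => ?_)
    rw [Real.norm_eq_abs, abs_of_pos (hW0 y)]
    exact hWV y
  have hintπ : Integrable (fun x => V x ^ β) π := by
    obtain ⟨x⟩ : Nonempty S := nonempty_of_isProbabilityMeasure π
    exact integrable_weight_of_wNormSub_le hWm hW1 (hint 0 x)
      -- The ergodicity bound at `n = 0` already forces `V ^ β` to be integrable under `π`.
      (by have := hW0 x; positivity) (herg x θ 0)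
  refine ⟨hWm, hW1, hC, hρ0, hρ1, hinv θ, hint, hintπ, fun f c hf hc hfc n x => ?_⟩
  have hfint : ∀ μ : Measure S, Integrable (fun x => V x ^ β) μ → Integrable f μ := fun μ hμ =>
    (hμ.const_mul c).mono' hf.aestronglyMeasurable (ae_of_all _ hfc)
  have := abs_integral_sub_le_of_wNormSub_le hW0 hf hc (by have := hW0 x; positivity) hfc
    (hfint _ (hint n x)) (hfint _ hintπ) (herg x θ n)
  calc _ ≤ _ := this
    _ = _ := by ring

variable {Q : Kernel S S} {π : Measure S} {W : S → ℝ} {C ρ : ℝ}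

theorem GeomErgodic.integrable (hQ : GeomErgodic Q π W C ρ) {f : S → ℝ} {c : ℝ}
    (hf : Measurable f) (hfc : ∀ x, |f x| ≤ c * W x) (n : ℕ) (x : S) :
    Integrable f ((Q ^ n) x) :=
  ((hQ.integrable_pow n x).const_mul c).mono' hf.aestronglyMeasurable (ae_of_all _ hfc)

theorem GeomErgodic.integrable_one (hQ : GeomErgodic Q π W C ρ) {f : S → ℝ} {c : ℝ}
    (hf : Measurable f) (hfc : ∀ x, |f x| ≤ c * W x) (x : S) : Integrable f (Q x) := by
  have := hQ.integrable hf hfc 1 x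
  rwa [pow_one] at this

theorem GeomErgodic.integrable_stationary (hQ : GeomErgodic Q π W C ρ) {f : S → ℝ} {c : ℝ}
    (hf : Measurable f) (hfc : ∀ x, |f x| ≤ c * W x) : Integrable f π :=
  (hQ.integrable_inv.const_mul c).mono' hf.aestronglyMeasurable (ae_of_all _ hfc)

theorem GeomErgodic.integral_pow_succ (hQ : GeomErgodic Q π W C ρ) [IsMarkovKernel Q] {f : S → ℝ}
    {c : ℝ} (hf : Measurable f) (hfc : ∀ x, |f x| ≤ c * W x) (n : ℕ) (x : S) :
    ∫ y, f y ∂((Q ^ (n + 1)) x) = ∫ y, ∫ z, f z ∂(Q y) ∂((Q ^ n) x) := by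
  have h := hQ.integrable hf hfc (n + 1) x
  rw [pow_succ'] at h ⊢
  exact Kernel.integral_comp h

theorem GeomErgodic.integral_pow_succ' (hQ : GeomErgodic Q π W C ρ) [IsMarkovKernel Q] {f : S → ℝ}
    {c : ℝ} (hf : Measurable f) (hfc : ∀ x, |f x| ≤ c * W x) (n : ℕ) (x : S) :
    ∫ y, f y ∂((Q ^ (n + 1)) x) = ∫ y, ∫ z, f z ∂((Q ^ n) y) ∂(Q x) := by
  have h := hQ.integrable hf hfc (n + 1) x
  rw [pow_succ] at h ⊢
  exact Kernel.integral_comp h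

theorem GeomErgodic.integral_integral (hQ : GeomErgodic Q π W C ρ) {f : S → ℝ}
    {c : ℝ} (hf : Measurable f) (hfc : ∀ x, |f x| ≤ c * W x) :
    ∫ y, ∫ z, f z ∂(Q y) ∂π = ∫ y, f y ∂π := by
  have h := hQ.integrable_stationary hf hfc
  -- Viewing `π` as a kernel from a point turns invariance into a composition of kernels.
  have h2 : (Q ∘ₖ Kernel.const Unit π) () = π := by
    rw [Kernel.comp_apply, Kernel.const_apply]; exact hQ.invariant
  rw [← h2] at h
  have h3 := Kernel.integral_comp h
  rw [h2, Kernel.const_apply] at h3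
  exact h3.symm

theorem GeomErgodic.abs_integral_le (hQ : GeomErgodic Q π W C ρ) {f : S → ℝ} {c : ℝ}
    (hf : Measurable f) (hc : 0 < c) (hfc : ∀ x, |f x| ≤ c * W x) (n : ℕ) (x : S)
    (h0 : ∫ y, f y ∂π = 0) : |∫ y, f y ∂((Q ^ n) x)| ≤ c * C * ρ ^ n * W x := by
  have := hQ.bound f c hf hc hfc n x
  rwa [h0, sub_zero] at this

theorem measurable_integral_kernel (Q : Kernel S S) [IsMarkovKernel Q] {f : S → ℝ}
    (hf : Measurable f) : Measurable fun x => ∫ y, f y ∂(Q x) :=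
  (hf.stronglyMeasurable.integral_kernel).measurable

/-- A function `δ` with `π δ = 0` is controlled by `δ - Q δ`. -/
theorem GeomErgodic.abs_le_of_abs_sub_integral_le (hQ : GeomErgodic Q π W C ρ) [IsMarkovKernel Q]
    {δ : S → ℝ} {c D : ℝ} (hδ : Measurable δ) (hc : 0 < c) (hδc : ∀ x, |δ x| ≤ c * W x)
    (hπ : ∫ y, δ y ∂π = 0) (hD : 0 < D)
    (hφ : ∀ x, |δ x - ∫ y, δ y ∂(Q x)| ≤ D * W x) (x : S) :
    |δ x| ≤ D * C * (1 - ρ)⁻¹ * W x := by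
  set φ : S → ℝ := fun x => δ x - ∫ y, δ y ∂(Q x) with hφdef
  have hφm : Measurable φ := hδ.sub (measurable_integral_kernel Q hδ)
  have hQδint : Integrable (fun x => ∫ y, δ y ∂(Q x)) π := by
    have h1 := (hQ.integrable_stationary hδ hδc).sub (hQ.integrable_stationary hφm hφ)
    refine h1.congr (ae_of_all _ fun y => ?_)
    simp [hφdef]
  have hφ0 : ∫ y, φ y ∂π = 0 := by
    rw [integral_sub (hQ.integrable_stationary hδ hδc) hQδint, hQ.integral_integral hδ hδc,
      sub_self]
  -- Telescoping of `Q ^ i φ = Q ^ i δ - Q ^ (i + 1) δ`. Since `φ` and `δ` have mean zero under `π`,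
  -- the terms and the remainder decay geometrically.
  have hiter : ∀ N : ℕ, δ x = ∑ i ∈ Finset.range N, ∫ y, φ y ∂((Q ^ i) x)
      + ∫ y, δ y ∂((Q ^ N) x) := by
    intro N
    induction N with
    | zero =>
      rw [pow_zero]
      change _ = _ + ∫ y, δ y ∂(Kernel.id x)
      rw [Kernel.id_apply, integral_dirac' _ _ hδ.stronglyMeasurable]
      simp
    | succ N ih =>
      rw [Finset.sum_range_succ, hQ.integral_pow_succ hδ hδc N x]
      have h1 : ∫ y, δ y ∂((Q ^ N) x) - ∫ y, φ y ∂((Q ^ N) x)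
          = ∫ y, ∫ z, δ z ∂(Q y) ∂((Q ^ N) x) := by
        rw [← integral_sub (hQ.integrable hδ hδc N x) (hQ.integrable hφm hφ N x)]
        simp [hφdef]
      rw [← h1]
      linarith
  have hbound : ∀ N : ℕ, |δ x| ≤ D * C * (1 - ρ)⁻¹ * W x + c * C * ρ ^ N * W x := by
    intro N
    rw [hiter N]
    refine (abs_add_le _ _).trans (add_le_add ?_ (hQ.abs_integral_le hδ hc hδc N x hπ))
    refine (Finset.abs_sum_le_sum_abs _ _).trans ?_
    calc _ ≤ ∑ i ∈ Finset.range N, D * C * ρ ^ i * W x :=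
          Finset.sum_le_sum fun i _ => hQ.abs_integral_le hφm hD hφ i x hφ0
      _ = D * C * (∑ i ∈ Finset.range N, ρ ^ i) * W x := by
          rw [Finset.mul_sum, Finset.sum_mul]
      _ ≤ _ := by
          have := hQ.pos
          have := (zero_lt_one.trans_le (hQ.one_le_weight x)).le
          have hρ0 := hQ.rate_pos.le
          gcongr
          rw [← tsum_geometric_of_lt_one hρ0 hQ.rate_lt_one]
          exact (summable_geometric_of_lt_one hρ0 hQ.rate_lt_one).sum_le_tsum _
            fun i _ => by positivity
  have hlim : Tendsto (fun N : ℕ => D * C * (1 - ρ)⁻¹ * W x + c * C * ρ ^ N * W x) atTop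
      (𝓝 (D * C * (1 - ρ)⁻¹ * W x + c * C * 0 * W x)) :=
    (((tendsto_pow_atTop_nhds_zero_of_lt_one hQ.rate_pos.le hQ.rate_lt_one).const_mul _).mul_const
      _).const_add _
  have := ge_of_tendsto' hlim hbound
  simpa using this

end GeometricErgodicity

/-! ### The resolvent, the Poisson equation, and dependence on the parameter. -/

section Resolvent

variable {S Θ : Type*} [MeasurableSpace S] [MeasurableSpace Θ] {P : Kernel (Θ × S) S}
  {π : Measure S} {W h : S → ℝ} {C ρ c : ℝ}

theorem abs_integral_sub_le_of_D_le {V : S → ℝ} (hV : ∀ x, 1 ≤ V x) {β : ℝ} {f : S → ℝ}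
    {θ θ' : Θ} {B : ℝ} (hf : Measurable f) (hc : 0 < c) (hB : 0 ≤ B)
    (hfc : ∀ x, |f x| ≤ c * V x ^ β) (h : D P V β θ θ' ≤ ENNReal.ofReal B) (x : S) :
    |∫ y, f y ∂(P.sectR θ x) - ∫ y, f y ∂(P.sectR θ' x)| ≤ c * B * V x ^ β := by
  have hW0 : ∀ x, 0 < V x ^ β := fun x => Real.rpow_pos_of_pos (zero_lt_one.trans_le (hV x)) _
  have h1 : ENNReal.ofReal (|∫ y, c⁻¹ * f y ∂(P.sectR θ x) - ∫ y, c⁻¹ * f y ∂(P.sectR θ' x)|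
      / V x ^ β) ≤ D P V β θ θ' := by
    refine le_trans ?_ (le_iSup₂ (f := fun (g : S → ℝ) (_ : Measurable g ∧
      wNorm (fun x => V x ^ β) g ≤ 1) => ⨆ x, ENNReal.ofReal
        (|∫ y, g y ∂(P.sectR θ x) - ∫ y, g y ∂(P.sectR θ' x)| / V x ^ β)) (fun y => c⁻¹ * f y)
      ⟨hf.const_mul _, ?_⟩)
    · exact le_iSup (fun x => ENNReal.ofReal (|∫ y, c⁻¹ * f y ∂(P.sectR θ x)
        - ∫ y, c⁻¹ * f y ∂(P.sectR θ' x)| / V x ^ β)) x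
    · rw [← ENNReal.ofReal_one]
      refine wNorm_le_ofReal hW0 fun x => ?_
      rw [abs_mul, abs_of_pos (inv_pos.2 hc), inv_mul_le_iff₀ hc, one_mul]
      exact hfc x
  have h2 := (ENNReal.ofReal_le_ofReal_iff hB).1 (h1.trans h)
  rw [integral_const_mul, integral_const_mul, ← mul_sub, abs_mul, abs_of_pos (inv_pos.2 hc),
    div_le_iff₀ (hW0 x), inv_mul_le_iff₀ hc] at h2
  linarith

variable [IsMarkovKernel P]

/-- Joint measurability is needed because the resolvent is later evaluated at random parameters and
states. -/
theorem measurable_barP_iterate_uncurry [SFinite π] (hh : Measurable h) (j : ℕ) :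
    Measurable fun q : Θ × S => (barP P π q.1)^[j] h q.2 := by
  induction j with
  | zero => exact hh.comp measurable_snd
  | succ j ih =>
    simp only [Function.iterate_succ_apply']
    have h1 : Measurable fun q : Θ × S => ∫ y, (barP P π q.1)^[j] h y ∂(P q) := by
      have h2 : Measurable fun z : (Θ × S) × S => (barP P π z.1.1)^[j] h z.2 :=
        ih.comp ((measurable_fst.comp measurable_fst).prodMk measurable_snd)
      exact (h2.stronglyMeasurable.integral_kernel_prod_right' (κ := P)).measurable
    have h2 : Measurable fun q : Θ × S => ∫ y, (barP P π q.1)^[j] h y ∂π :=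
      (ih.stronglyMeasurable.integral_prod_right' (ν := π)).measurable.comp measurable_fst
    exact h1.sub h2

theorem measurable_barP_iterate [SFinite π] (hh : Measurable h) (θ : Θ) (j : ℕ) :
    Measurable ((barP P π θ)^[j] h) :=
  (measurable_barP_iterate_uncurry hh j).comp measurable_prodMk_left

variable [IsProbabilityMeasure π]

/-- After one application the function has mean zero under `π`, so later applications act as `P_θ`
alone. The iterate of order `0` is the uncentred `h`, hence the shift in the index. -/
theorem barP_iterate_succ {θ : Θ} (hQ : GeomErgodic (P.sectR θ) π W C ρ) (hh : Measurable h)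
    (hc : 0 < c) (hhc : ∀ x, |h x| ≤ c * W x) (j : ℕ) (x : S) :
    (barP P π θ)^[j + 1] h x = ∫ y, h y ∂((P.sectR θ ^ (j + 1)) x) - ∫ y, h y ∂π := by
  induction j generalizing x with
  | zero => simp [barP]
  | succ j ih =>
    have hpow := isMarkovKernel_pow (P.sectR θ) (j + 1)
    set f : S → ℝ := fun y => ∫ z, h z ∂((P.sectR θ ^ (j + 1)) y) - ∫ z, h z ∂π with hf
    have hfm : Measurable f := (measurable_integral_kernel _ hh).sub_const _
    have hfc : ∀ y, |f y| ≤ (c * C * ρ ^ (j + 1)) * W y := fun y => hQ.bound h c hh hc hhc _ y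
    have hstep : (barP P π θ)^[j + 1] h = f := funext ih
    have hfc' : ∀ y, |f y + ∫ z, h z ∂π| ≤ (c * C * ρ ^ (j + 1) + |∫ z, h z ∂π|) * W y := by
      intro y
      refine (abs_add_le _ _).trans ?_
      rw [add_mul]
      exact add_le_add (hfc y) (le_mul_of_one_le_right (abs_nonneg _) (hQ.one_le_weight y))
    have hπf : ∫ y, f y ∂π = 0 := by
      have hi : Integrable f π := hQ.integrable_stationary hfm hfc
      have : ∀ n : ℕ, ∫ y, ∫ z, h z ∂((P.sectR θ ^ n) y) ∂π = ∫ z, h z ∂π := by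
        intro n
        have hinv : Kernel.Invariant (P.sectR θ ^ n) π := by
          induction n with
          | zero => 
            rw [pow_zero]
            exact Measure.id_comp
          | succ n ih => rw [pow_succ]; exact ih.comp hQ.invariant
        have h1 := hQ.integrable_stationary hh hhc
        have h2 : ((P.sectR θ ^ n) ∘ₖ Kernel.const Unit π) () = π := by
          rw [Kernel.comp_apply, Kernel.const_apply]; exact hinv
        rw [← h2] at h1
        have h3 := Kernel.integral_comp h1
        rw [h2, Kernel.const_apply] at h3
        exact h3.symm
      have hi2 : Integrable (fun y => ∫ z, h z ∂((P.sectR θ ^ (j + 1)) y)) π := by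
        refine (hi.add (integrable_const (∫ z, h z ∂π))).congr (ae_of_all _ fun y => ?_)
        simp [hf]
      rw [hf, integral_sub hi2 (integrable_const _), this]
      simp
    rw [Function.iterate_succ_apply', hstep]
    unfold barP
    rw [hπf, sub_zero, hQ.integral_pow_succ' hh hhc]
    have hi2 : Integrable (fun y => ∫ z, h z ∂((P.sectR θ ^ (j + 1)) y)) (P.sectR θ x) := by
      refine (hQ.integrable_one (f := fun y => f y + ∫ z, h z ∂π) (hfm.add_const _) hfc' x).congr
        (ae_of_all _ fun y => ?_)
      simp [hf]
    rw [hf, integral_sub hi2 (integrable_const _)]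
    simp

/-- `C + 1` in place of `C` covers `j = 0`, where ergodicity says nothing. -/
theorem abs_barP_iterate_le {θ : Θ} (hQ : GeomErgodic (P.sectR θ) π W C ρ) (hh : Measurable h)
    (hc : 0 < c) (hhc : ∀ x, |h x| ≤ c * W x) (j : ℕ) (x : S) :
    |(barP P π θ)^[j] h x| ≤ c * (C + 1) * ρ ^ j * W x := by
  have hW := hQ.one_le_weight x
  have hC := hQ.pos
  have hρ := hQ.rate_pos
  cases j with
  | zero =>
    refine (hhc x).trans ?_
    rw [pow_zero, mul_one]
    gcongr
    nlinarith
  | succ j =>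
    rw [barP_iterate_succ hQ hh hc hhc]
    refine (hQ.bound h c hh hc hhc _ x).trans ?_
    gcongr
    linarith

theorem summable_barP_iterate {θ : Θ} (hQ : GeomErgodic (P.sectR θ) π W C ρ) (hh : Measurable h)
    (hc : 0 < c) (hhc : ∀ x, |h x| ≤ c * W x) (x : S) :
    Summable fun j => (barP P π θ)^[j] h x :=
  Summable.of_norm_bounded
    (((summable_geometric_of_lt_one hQ.rate_pos.le hQ.rate_lt_one).mul_left _).mul_right _)
    fun j => abs_barP_iterate_le hQ hh hc hhc j x

theorem abs_resolvent_le {θ : Θ} (hQ : GeomErgodic (P.sectR θ) π W C ρ) (hh : Measurable h)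
    (hc : 0 < c) (hhc : ∀ x, |h x| ≤ c * W x) (x : S) :
    |resolvent P π h θ x| ≤ c * (C + 1) * (1 - ρ)⁻¹ * W x := by
  have h1 := ((hasSum_geometric_of_lt_one hQ.rate_pos.le hQ.rate_lt_one).mul_left
    (c * (C + 1))).mul_right (W x)
  exact tsum_of_norm_bounded (f := fun j => (barP P π θ)^[j] h x) h1 fun j => abs_barP_iterate_le hQ hh hc hhc j x

theorem measurable_resolvent_uncurry (hQ : ∀ θ, GeomErgodic (P.sectR θ) π W C ρ)
    (hh : Measurable h) (hc : 0 < c) (hhc : ∀ x, |h x| ≤ c * W x) :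
    Measurable fun q : Θ × S => resolvent P π h q.1 q.2 := by
  refine measurable_of_tendsto_metrizable
    (f := fun (n : ℕ) (q : Θ × S) => ∑ j ∈ Finset.range n, (barP P π q.1)^[j] h q.2)
    (fun n => Finset.measurable_sum _ fun j _ => measurable_barP_iterate_uncurry hh j) ?_
  rw [tendsto_pi_nhds]
  intro q
  exact (summable_barP_iterate (hQ q.1) hh hc hhc q.2).hasSum.tendsto_sum_nat

theorem measurable_resolvent {θ : Θ} (hQ : GeomErgodic (P.sectR θ) π W C ρ)
    (hh : Measurable h) (hc : 0 < c) (hhc : ∀ x, |h x| ≤ c * W x) :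
    Measurable (resolvent P π h θ) := by
  refine measurable_of_tendsto_metrizable
    (f := fun (n : ℕ) (x : S) => ∑ j ∈ Finset.range n, (barP P π θ)^[j] h x)
    (fun n => Finset.measurable_sum _ fun j _ => measurable_barP_iterate hh θ j) ?_
  rw [tendsto_pi_nhds]
  intro x
  exact (summable_barP_iterate hQ hh hc hhc x).hasSum.tendsto_sum_nat

theorem hasSum_integral_barP_iterate {θ : Θ} (hQ : GeomErgodic (P.sectR θ) π W C ρ)
    (hh : Measurable h) (hc : 0 < c) (hhc : ∀ x, |h x| ≤ c * W x) {μ : Measure S}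
    (hμ : Integrable W μ) :
    HasSum (fun j => ∫ y, (barP P π θ)^[j] h y ∂μ) (∫ y, resolvent P π h θ y ∂μ) := by
  have hint : ∀ j, Integrable ((barP P π θ)^[j] h) μ := fun j =>
    (hμ.const_mul (c * (C + 1) * ρ ^ j)).mono'
      (measurable_barP_iterate hh θ j).aestronglyMeasurable
      (ae_of_all _ (abs_barP_iterate_le hQ hh hc hhc j))
  refine hasSum_integral_of_summable_integral_norm hint ?_
  refine Summable.of_nonneg_of_le (fun j => integral_nonneg fun y => norm_nonneg _) (fun j => ?_)
    (((summable_geometric_of_lt_one hQ.rate_pos.le hQ.rate_lt_one).mul_left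
      (c * (C + 1))).mul_right (∫ y, W y ∂μ))
  rw [← integral_const_mul]
  exact integral_mono (hint j).norm (hμ.const_mul _)
    fun y => abs_barP_iterate_le hQ hh hc hhc j y

theorem integral_barP_iterate_succ {θ : Θ} (hQ : GeomErgodic (P.sectR θ) π W C ρ)
    (hh : Measurable h) (hc : 0 < c) (hhc : ∀ x, |h x| ≤ c * W x) (j : ℕ) :
    ∫ y, (barP P π θ)^[j + 1] h y ∂π = 0 := by
  simp only [Function.iterate_succ_apply']
  set f := (barP P π θ)^[j] h with hf
  have hfm : Measurable f := measurable_barP_iterate hh θ j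
  have hfc := abs_barP_iterate_le hQ hh hc hhc j
  have h1 : Integrable (fun x => barP P π θ f x) π := by
    have := hQ.integrable_stationary (measurable_barP_iterate hh θ (j + 1))
      (abs_barP_iterate_le hQ hh hc hhc (j + 1))
    simpa only [Function.iterate_succ_apply'] using this
  have h2 : Integrable (fun x => ∫ y, f y ∂(P.sectR θ x)) π := by
    refine (h1.add (integrable_const (∫ y, f y ∂π))).congr (ae_of_all _ fun x => ?_)
    simp [barP]
  unfold barP
  rw [integral_sub h2 (integrable_const _), hQ.integral_integral hfm hfc]
  simp

/-- Only the term `j = 0` of the series has a nonzero mean. The value does not depend on `θ`, so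
differences of resolvents have mean zero. -/
theorem integral_resolvent {θ : Θ} (hQ : GeomErgodic (P.sectR θ) π W C ρ)
    (hh : Measurable h) (hc : 0 < c) (hhc : ∀ x, |h x| ≤ c * W x) :
    ∫ y, resolvent P π h θ y ∂π = ∫ y, h y ∂π := by
  have h1 := hasSum_integral_barP_iterate hQ hh hc hhc hQ.integrable_inv
  refine h1.unique ?_
  have : (fun j => ∫ y, (barP P π θ)^[j] h y ∂π)
      = fun j => if j = 0 then ∫ y, h y ∂π else 0 := by
    funext j
    cases j with
    | zero => simp
    | succ j => simp only [integral_barP_iterate_succ hQ hh hc hhc j]; simp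
  rw [this]
  exact hasSum_ite_eq 0 _

/-- The Poisson equation: `P_θ g_θ = g_θ - (h - π h)`. -/
theorem integral_resolvent_kernel {θ : Θ} (hQ : GeomErgodic (P.sectR θ) π W C ρ)
    (hh : Measurable h) (hc : 0 < c) (hhc : ∀ x, |h x| ≤ c * W x) (x : S) :
    ∫ y, resolvent P π h θ y ∂(P.sectR θ x) = resolvent P π h θ x - h x + ∫ y, h y ∂π := by
  have hW : Integrable W (P.sectR θ x) := by
    have := hQ.integrable_pow 1 x
    rwa [pow_one] at this
  have h1 := hasSum_integral_barP_iterate hQ hh hc hhc hW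
  have h2 := hasSum_integral_barP_iterate hQ hh hc hhc hQ.integrable_inv
  rw [integral_resolvent hQ hh hc hhc] at h2
  have h3 := h1.sub h2
  have h4 : HasSum (fun j => (barP P π θ)^[j + 1] h x) (resolvent P π h θ x - h x) := by
    have := (summable_barP_iterate hQ hh hc hhc x).hasSum
    rw [← hasSum_nat_add_iff' 1] at this
    simpa [resolvent] using this
  have h5 : (fun j => ∫ y, (barP P π θ)^[j] h y ∂(P.sectR θ x) - ∫ y, (barP P π θ)^[j] h y ∂π)
      = fun j => (barP P π θ)^[j + 1] h x := by
    funext j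
    rw [Function.iterate_succ_apply']
    rfl
  rw [h5] at h3
  linarith [h3.unique h4]

/-- The resolvent function depends on `θ` in a Lipschitz way. -/
theorem abs_resolvent_sub_le {V : S → ℝ} (hV : ∀ x, 1 ≤ V x) {β : ℝ} {θ θ' : Θ}
    (hQ : GeomErgodic (P.sectR θ) π (fun x => V x ^ β) C ρ)
    (hQ' : GeomErgodic (P.sectR θ') π (fun x => V x ^ β) C ρ)
    (hh : Measurable h) (hc : 0 < c) (hhc : ∀ x, |h x| ≤ c * V x ^ β) {B : ℝ} (hB : 0 ≤ B)
    (hD : D P V β θ θ' ≤ ENNReal.ofReal B) (x : S) :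
    |resolvent P π h θ x - resolvent P π h θ' x|
      ≤ (c * (C + 1) * (1 - ρ)⁻¹) * C * (1 - ρ)⁻¹ * B * V x ^ β := by
  have hC := hQ.pos
  have hρ : 0 < 1 - ρ := by linarith [hQ.rate_lt_one]
  set G := c * (C + 1) * (1 - ρ)⁻¹ with hG
  have hG0 : 0 < G := by positivity
  have hgm := measurable_resolvent hQ hh hc hhc
  have hgm' := measurable_resolvent hQ' hh hc hhc
  have hgb := abs_resolvent_le hQ hh hc hhc
  have hgb' := abs_resolvent_le hQ' hh hc hhc
  set δ : S → ℝ := fun x => resolvent P π h θ x - resolvent P π h θ' x with hδ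
  have hδb : ∀ x, |δ x| ≤ 2 * G * V x ^ β := fun x => by
    have h1 := hgb x
    have h2 := hgb' x
    have := abs_sub (resolvent P π h θ x) (resolvent P π h θ' x)
    linarith
  have hπ : ∫ y, δ y ∂π = 0 := by
    rw [integral_sub (hQ.integrable_stationary hgm hgb) (hQ.integrable_stationary hgm' hgb'),
      integral_resolvent hQ hh hc hhc, integral_resolvent hQ' hh hc hhc, sub_self]
  -- Subtracting the two Poisson equations gives `δ - P_θ δ = (P_θ - P_θ') g_θ'`, which `D_β`
  -- controls.
  have hφ : ∀ y, |δ y - ∫ z, δ z ∂(P.sectR θ y)| ≤ G * B * V y ^ β := by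
    intro y
    rw [integral_sub (hQ.integrable_one hgm hgb y) (hQ.integrable_one hgm' hgb' y),
      integral_resolvent_kernel hQ hh hc hhc]
    have h1 := integral_resolvent_kernel hQ' hh hc hhc y
    have h2 := abs_integral_sub_le_of_D_le hV hgm' hG0 hB hgb' hD y
    rw [h1] at h2
    convert h2 using 2
    simp only [hδ]
    ring
  -- `B` may vanish while the comparison lemma wants a positive constant; `ε` is sent to `0`
  -- afterwards.
  have hεb : ∀ ε : ℝ, 0 < ε → |δ x| ≤ (G * B + ε) * C * (1 - ρ)⁻¹ * V x ^ β := fun ε hε =>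
    hQ.abs_le_of_abs_sub_integral_le (hgm.sub hgm') (by positivity) hδb hπ (by positivity)
      (fun y => (hφ y).trans (by
        have := Real.rpow_nonneg (zero_le_one.trans (hV y)) β
        gcongr
        linarith)) x
  have hlim : Tendsto (fun ε : ℝ => (G * B + ε) * C * (1 - ρ)⁻¹ * V x ^ β) (𝓝[>] 0)
      (𝓝 ((G * B + 0) * C * (1 - ρ)⁻¹ * V x ^ β)) := by
    refine Tendsto.mono_left ?_ nhdsWithin_le_nhds
    exact Continuous.tendsto (by fun_prop) 0
  have := ge_of_tendsto hlim (eventually_nhdsWithin_of_forall fun ε hε => hεb ε hε)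
  calc |δ x| ≤ _ := this
    _ = _ := by ring

end Resolvent

/-! ### The adaptive chain: moments of `V` and conditional laws. -/

section Chain

variable {S Θ Ω : Type*} [MeasurableSpace S] [MeasurableSpace Θ] [mΩ : MeasurableSpace Ω]
  {P : Kernel (Θ × S) S} {Pr : Measure Ω} {X : ℕ → Ω → S} {θ : ℕ → Ω → Θ}

/-- The natural filtration of an adaptive chain. -/
noncomputable def IsAdaptiveChain.filtration (hchain : IsAdaptiveChain P Pr X θ) :
    Filtration ℕ mΩ where
  seq n := natFiltration X θ n
  mono' _ _ hmn := iSup₂_le fun k hk => le_iSup₂_of_le k (hk.trans hmn) le_rfl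
  le' _ := iSup₂_le fun k _ => Measurable.comap_le
    ((hchain.measurable_state k).prodMk (hchain.measurable_param k))

theorem IsAdaptiveChain.measurable_pair (hchain : IsAdaptiveChain P Pr X θ) {k n : ℕ}
    (hkn : k ≤ n) : Measurable[hchain.filtration n] fun ω => (X k ω, θ k ω) :=
  (comap_measurable _).mono (le_iSup₂_of_le (f := fun k (_ : k ≤ n) =>
    MeasurableSpace.comap (fun ω => (X k ω, θ k ω)) inferInstance) k hkn le_rfl) le_rfl

theorem IsAdaptiveChain.measurable_state_filtration (hchain : IsAdaptiveChain P Pr X θ) {k n : ℕ}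
    (hkn : k ≤ n) : Measurable[hchain.filtration n] (X k) :=
  measurable_fst.comp (hchain.measurable_pair hkn)

theorem IsAdaptiveChain.measurable_param_filtration (hchain : IsAdaptiveChain P Pr X θ) {k n : ℕ}
    (hkn : k ≤ n) : Measurable[hchain.filtration n] (θ k) :=
  measurable_snd.comp (hchain.measurable_pair hkn)

variable [IsProbabilityMeasure Pr]

theorem IsAdaptiveChain.setLIntegral_next (hchain : IsAdaptiveChain P Pr X θ) (n : ℕ) {f : S → ℝ≥0∞}
    (hf : Measurable f) {A : Set Ω} (hA : MeasurableSet[hchain.filtration n] A) :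
    ∫⁻ ω in A, f (X (n + 1) ω) ∂Pr = ∫⁻ ω in A, ∫⁻ y, f y ∂(P (θ n ω, X n ω)) ∂Pr := by
  rw [← setLIntegral_condLExp (hm := hchain.filtration.le n) Pr (fun ω => f (X (n + 1) ω)) hA]
  exact setLIntegral_congr_fun_ae (hchain.filtration.le n A hA)
    ((hchain.condExp_next n f hf).mono fun ω h _ => h)

theorem IsAdaptiveChain.exists_integral_le (hchain : IsAdaptiveChain P Pr X θ) {π : Measure S}
    {V : S → ℝ} (hA1 : A1 P π V (Pr.map fun ω => (X 0 ω, θ 0 ω))) :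
    ∃ M : ℝ, 0 < M ∧ ∀ n, Integrable (fun ω => V (X n ω)) Pr ∧ ∫ ω, V (X n ω) ∂Pr ≤ M := by
  obtain ⟨b, lam, hb, hlam0, hlam1, hdrift⟩ := hA1.drift
  have hV1 := hA1.one_le_V
  have hVm := hA1.measurable_V
  have hV0 : ∀ x, 0 ≤ V x := fun x => zero_le_one.trans (hV1 x)
  have hinit := hA1.initial
  have hVfst : Measurable fun z : S × Θ => ENNReal.ofReal (V z.1) :=
    hVm.ennreal_ofReal.comp measurable_fst
  rw [lintegral_map hVfst
    ((hchain.measurable_state 0).prodMk (hchain.measurable_param 0))] at hinit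
  simp only at hinit
  set m₀ := (∫⁻ ω, ENNReal.ofReal (V (X 0 ω)) ∂Pr).toReal with hm₀
  have h1l : 0 < 1 - lam := by linarith
  have hm₀0 : 0 ≤ m₀ := ENNReal.toReal_nonneg
  -- `M` dominates the initial moment and also the fixed point of `m ↦ lam * m + b`, so the drift
  -- preserves the bound.
  set M := m₀ + b / (1 - lam) with hM
  have hMpos : 0 < M := by positivity
  have hMb : lam * M + b ≤ M := by
    have : (1 - lam) * M = (1 - lam) * m₀ + b := by rw [hM]; field_simp
    nlinarith
  have hVX : ∀ n, Measurable fun ω => ENNReal.ofReal (V (X n ω)) := fun n =>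
    hVm.ennreal_ofReal.comp (hchain.measurable_state n)
  have hle : ∀ n, ∫⁻ ω, ENNReal.ofReal (V (X n ω)) ∂Pr ≤ ENNReal.ofReal M := by
    intro n
    induction n with
    | zero =>
      rw [← ENNReal.ofReal_toReal hinit.ne]
      exact ENNReal.ofReal_le_ofReal (by have : 0 ≤ b / (1 - lam) := by positivity
                                         linarith)
    | succ n ih =>
      have h := hchain.setLIntegral_next n hVm.ennreal_ofReal MeasurableSet.univ
      simp only [Measure.restrict_univ] at h
      rw [h]
      calc _ ≤ ∫⁻ ω, (ENNReal.ofReal lam * ENNReal.ofReal (V (X n ω)) + ENNReal.ofReal b) ∂Pr := by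
            refine lintegral_mono fun ω => ?_
            rw [← ENNReal.ofReal_mul hlam0.le,
              ← ENNReal.ofReal_add (mul_nonneg hlam0.le (hV0 _)) hb.le]
            exact hdrift (X n ω) (θ n ω)
        _ = ENNReal.ofReal lam * ∫⁻ ω, ENNReal.ofReal (V (X n ω)) ∂Pr + ENNReal.ofReal b := by
            rw [lintegral_add_right _ measurable_const,
              lintegral_const_mul _ (hVX n)]
            simp
        _ ≤ ENNReal.ofReal lam * ENNReal.ofReal M + ENNReal.ofReal b := by gcongr
        _ ≤ ENNReal.ofReal M := by
            rw [← ENNReal.ofReal_mul hlam0.le, ← ENNReal.ofReal_add (by positivity) hb.le]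
            exact ENNReal.ofReal_le_ofReal hMb
  refine ⟨M, hMpos, fun n => ?_⟩
  have hint : Integrable (fun ω => V (X n ω)) Pr :=
    integrable_of_lintegral_ofReal_le (hVm.comp (hchain.measurable_state n)) (fun ω => hV0 _)
      (hle n)
  refine ⟨hint, ?_⟩
  rw [← ENNReal.ofReal_le_ofReal_iff hMpos.le,
    ofReal_integral_eq_lintegral_ofReal hint (ae_of_all _ fun ω => hV0 _)]
  exact hle n

variable [IsMarkovKernel P]

/-- On an event of the past, the joint law of the past state and the next one. -/
theorem IsAdaptiveChain.map_restrict_eq (hchain : IsAdaptiveChain P Pr X θ) (n : ℕ) {A : Set Ω}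
    (hA : MeasurableSet[hchain.filtration n] A) :
    (Pr.restrict A).map (fun ω => ((θ n ω, X n ω), X (n + 1) ω))
      = ((Pr.restrict A).map fun ω => (θ n ω, X n ω)) ⊗ₘ P := by
  have hq : Measurable fun ω => (θ n ω, X n ω) :=
    (hchain.measurable_param n).prodMk (hchain.measurable_state n)
  have hqF : Measurable[hchain.filtration n] fun ω => (θ n ω, X n ω) :=
    (hchain.measurable_param_filtration le_rfl).prodMk (hchain.measurable_state_filtration le_rfl)
  have hX := hchain.measurable_state (n + 1)
  refine Measure.ext_prod fun {s t} hs ht => ?_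
  rw [Measure.map_apply (hq.prodMk hX) (hs.prod ht), Measure.compProd_apply_prod hs ht,
    setLIntegral_map hs (P.measurable_coe ht) hq, Measure.restrict_restrict (hq hs),
    Measure.restrict_apply ((hq.prodMk hX) (hs.prod ht))]
  have hA' := hchain.filtration.le n A hA
  have h := hchain.setLIntegral_next n (f := t.indicator 1) (measurable_one.indicator ht)
    (MeasurableSet.inter (hqF hs) hA)
  have e1 : ∀ q, ∫⁻ y, t.indicator 1 y ∂(P q) = P q t := fun q => lintegral_indicator_one ht
  simp only [e1] at h
  rw [← h]
  have e2 : (fun ω => t.indicator (1 : S → ℝ≥0∞) (X (n + 1) ω))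
      = (X (n + 1) ⁻¹' t).indicator 1 := by
    funext ω; simp only [Set.indicator, Pi.one_apply]; rfl
  rw [e2, lintegral_indicator_one (hX ht), Measure.restrict_apply (hX ht)]
  congr 1
  ext ω
  simp only [Set.mem_inter_iff, Set.mem_preimage, Set.mem_prod]
  tauto

/-- A function of the past state and the next one whose conditional mean under the kernel vanishes
is a martingale difference. -/
theorem IsAdaptiveChain.condExp_eq_zero (hchain : IsAdaptiveChain P Pr X θ) (n : ℕ)
    {F : (Θ × S) × S → ℝ} (hF : Measurable F)
    (hint : Integrable (fun ω => F ((θ n ω, X n ω), X (n + 1) ω)) Pr)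
    (hzero : ∀ q, ∫ y, F (q, y) ∂(P q) = 0) :
    Pr[fun ω => F ((θ n ω, X n ω), X (n + 1) ω) | hchain.filtration n] =ᵐ[Pr] 0 := by
  have hq : Measurable fun ω => (θ n ω, X n ω) :=
    (hchain.measurable_param n).prodMk (hchain.measurable_state n)
  have hX := hchain.measurable_state (n + 1)
  symm
  refine ae_eq_condExp_of_forall_setIntegral_eq (hchain.filtration.le n) hint
    (fun A _ _ => integrableOn_zero) (fun A hA _ => ?_)
    (stronglyMeasurable_zero.aestronglyMeasurable)
  have hmap := hchain.map_restrict_eq n hA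
  have hFs := hF.stronglyMeasurable
  have h1 : ∫ ω in A, F ((θ n ω, X n ω), X (n + 1) ω) ∂Pr
      = ∫ z, F z ∂((Pr.restrict A).map (fun ω => ((θ n ω, X n ω), X (n + 1) ω))) :=
    (integral_map (hq.prodMk hX).aemeasurable hFs.aestronglyMeasurable).symm
  have h2 : Integrable F ((Pr.restrict A).map (fun ω => ((θ n ω, X n ω), X (n + 1) ω))) :=
    (integrable_map_measure hFs.aestronglyMeasurable (hq.prodMk hX).aemeasurable).2 hint.restrict
  rw [hmap] at h1 h2
  rw [h1, Measure.integral_compProd h2]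
  simp [hzero]

end Chain

/-! ### Calculus of moment bounds. -/

section MomentBounds

variable {Ω : Type*} [MeasurableSpace Ω] {Pr : Measure Ω}

/-- `f` has a finite absolute moment of order `q`, bounded by `M`. -/
def HasMomentLE (Pr : Measure Ω) (q : ℝ) (f : Ω → ℝ) (M : ℝ) : Prop :=
  AEStronglyMeasurable f Pr ∧ Integrable (fun ω => |f ω| ^ q) Pr ∧ ∫ ω, |f ω| ^ q ∂Pr ≤ M

theorem HasMomentLE.of_abs_le {q M : ℝ} {f g : Ω → ℝ} (hf : AEStronglyMeasurable f Pr)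
    (hg : Integrable g Pr) (hfg : ∀ᵐ ω ∂Pr, |f ω| ^ q ≤ g ω) (hM : ∫ ω, g ω ∂Pr ≤ M) :
    HasMomentLE Pr q f M := by
  have hint : Integrable (fun ω => |f ω| ^ q) Pr := by
    refine hg.mono' (hf.aemeasurable.abs.pow_const q).aestronglyMeasurable ?_
    filter_upwards [hfg] with ω h
    rwa [Real.norm_eq_abs, abs_of_nonneg (Real.rpow_nonneg (abs_nonneg _) _)]
  exact ⟨hf, hint, (integral_mono_ae hint hg hfg).trans hM⟩

theorem HasMomentLE.nonneg {q M : ℝ} {f : Ω → ℝ} (hf : HasMomentLE Pr q f M) : 0 ≤ M :=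
  (integral_nonneg fun _ => Real.rpow_nonneg (abs_nonneg _) _).trans hf.2.2

theorem mul_rpow_rpow_le {c v s q : ℝ} (hc : 0 ≤ c) (hv : 1 ≤ v) (hsq : s * q ≤ 1) :
    (c * v ^ s) ^ q ≤ c ^ q * v := by
  have hv0 : 0 ≤ v := by linarith
  rw [Real.mul_rpow hc (by positivity), ← Real.rpow_mul hv0]
  gcongr
  simpa using Real.rpow_le_rpow_of_exponent_le hv hsq

theorem add_rpow_le_two_rpow_mul {a b q : ℝ} (ha : 0 ≤ a) (hb : 0 ≤ b) (hq : 0 ≤ q) :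
    (a + b) ^ q ≤ 2 ^ q * (a ^ q + b ^ q) := by
  have haq := Real.rpow_nonneg ha q
  have hbq := Real.rpow_nonneg hb q
  have h2 : (0 : ℝ) ≤ 2 ^ q := by positivity
  rcases le_total a b with h | h
  · calc (a + b) ^ q ≤ (2 * b) ^ q := by gcongr; linarith
      _ = 2 ^ q * b ^ q := Real.mul_rpow (by norm_num) hb
      _ ≤ _ := by gcongr; linarith
  · calc (a + b) ^ q ≤ (2 * a) ^ q := by gcongr; linarith
      _ = 2 ^ q * a ^ q := Real.mul_rpow (by norm_num) ha
      _ ≤ _ := by gcongr; linarith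

theorem HasMomentLE.add {q M N : ℝ} {f g : Ω → ℝ} (hq : 0 ≤ q) (hf : HasMomentLE Pr q f M)
    (hg : HasMomentLE Pr q g N) : HasMomentLE Pr q (fun ω => f ω + g ω) (2 ^ q * (M + N)) := by
  refine HasMomentLE.of_abs_le (hf.1.add hg.1) ((hf.2.1.add hg.2.1).const_mul (2 ^ q))
    (ae_of_all _ fun ω => ?_) ?_
  · refine le_trans ?_ (add_rpow_le_two_rpow_mul (abs_nonneg _) (abs_nonneg _) hq)
    exact Real.rpow_le_rpow (abs_nonneg _) (abs_add_le _ _) hq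
  · simp only [Pi.add_apply]
    rw [integral_const_mul, integral_add hf.2.1 hg.2.1]
    gcongr
    · exact hf.2.2
    · exact hg.2.2

theorem HasMomentLE.const_mul {q M : ℝ} {f : Ω → ℝ} (hf : HasMomentLE Pr q f M) (c : ℝ) :
    HasMomentLE Pr q (fun ω => c * f ω) (|c| ^ q * M) := by
  have h : ∀ ω, |c * f ω| ^ q = |c| ^ q * |f ω| ^ q := fun ω => by
    rw [abs_mul, Real.mul_rpow (abs_nonneg _) (abs_nonneg _)]
  refine HasMomentLE.of_abs_le (hf.1.const_mul c) (hf.2.1.const_mul (|c| ^ q))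
    (ae_of_all _ fun ω => (h ω).le) ?_
  rw [integral_const_mul]
  gcongr
  exact hf.2.2

theorem HasMomentLE.neg {q M : ℝ} {f : Ω → ℝ} (hf : HasMomentLE Pr q f M) :
    HasMomentLE Pr q (fun ω => -f ω) M :=
  ⟨hf.1.neg, by simpa using hf.2.1, by simpa using hf.2.2⟩

theorem HasMomentLE.mono {q M N : ℝ} {f : Ω → ℝ} (hf : HasMomentLE Pr q f M) (h : M ≤ N) :
    HasMomentLE Pr q f N := ⟨hf.1, hf.2.1, hf.2.2.trans h⟩

/-- Lowering the order of a moment. -/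
theorem HasMomentLE.of_le [IsProbabilityMeasure Pr] {q q' M : ℝ} {f : Ω → ℝ} (hq' : 0 ≤ q')
    (hqq' : q' ≤ q) (hf : HasMomentLE Pr q f M) : HasMomentLE Pr q' f (1 + M) := by
  refine HasMomentLE.of_abs_le hf.1 ((integrable_const 1).add hf.2.1) (ae_of_all _ fun ω => ?_) ?_
  · simp only [Pi.add_apply]
    have h0 : 0 ≤ |f ω| ^ q := Real.rpow_nonneg (abs_nonneg _) _
    rcases le_total |f ω| 1 with h | h
    · have := Real.rpow_le_one (abs_nonneg _) h hq'
      linarith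
    · have := Real.rpow_le_rpow_of_exponent_le h hqq'
      linarith
  · simp only [Pi.add_apply]
    rw [integral_add (integrable_const _) hf.2.1]
    simp only [integral_const, probReal_univ, smul_eq_mul, mul_one]
    linarith [hf.2.2]

end MomentBounds

/-! ### Almost sure summability and summation lemmas. -/

section SummationTools

variable {Ω : Type*} [MeasurableSpace Ω] {Pr : Measure Ω}

theorem ae_summable_of_integral_le {ι : Type*} [Countable ι] {f : ι → Ω → ℝ} {c : ι → ℝ}
    (hf0 : ∀ i ω, 0 ≤ f i ω) (hint : ∀ i, Integrable (f i) Pr) (hc : ∀ i, ∫ ω, f i ω ∂Pr ≤ c i)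
    (hsum : Summable c) : ∀ᵐ ω ∂Pr, Summable fun i => f i ω := by
  have hc0 : ∀ i, 0 ≤ c i := fun i => (integral_nonneg (hf0 i)).trans (hc i)
  have hmeas : ∀ i, AEMeasurable (fun ω => ENNReal.ofReal (f i ω)) Pr := fun i =>
    (hint i).1.aemeasurable.ennreal_ofReal
  have h1 : ∫⁻ ω, ∑' i, ENNReal.ofReal (f i ω) ∂Pr ≠ ∞ := by
    rw [lintegral_tsum hmeas]
    refine ne_top_of_le_ne_top (b := ∑' i, ENNReal.ofReal (c i)) ?_
      (ENNReal.tsum_le_tsum fun i => ?_)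
    · rw [← ENNReal.ofReal_tsum_of_nonneg hc0 hsum]; exact ENNReal.ofReal_ne_top
    · rw [← ofReal_integral_eq_lintegral_ofReal (hint i) (ae_of_all _ (hf0 i))]
      exact ENNReal.ofReal_le_ofReal (hc i)
  have h2 := ae_lt_top' (AEMeasurable.tsum hmeas) h1
  filter_upwards [h2] with ω hω
  have h3 := ENNReal.summable_toReal hω.ne
  simpa only [ENNReal.toReal_ofReal (hf0 _ ω)] using h3

/-- Averages of nonnegative functions with bounded integrals grow slower than any power. -/
theorem ae_exists_sum_le {f : ℕ → Ω → ℝ} {C : ℝ} (hf0 : ∀ i ω, 0 ≤ f i ω)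
    (hint : ∀ i, Integrable (f i) Pr) (hC : ∀ i, ∫ ω, f i ω ∂Pr ≤ C) {ε : ℝ} (hε : 0 < ε) :
    ∀ᵐ ω ∂Pr, ∃ K : ℝ, ∀ n : ℕ, 1 ≤ n → ∑ i ∈ Finset.Icc 1 n, f i ω ≤ K * (n : ℝ) ^ (1 + ε) := by
  have hsum : Summable fun i : ℕ => ((i : ℝ) ^ (1 + ε))⁻¹ * C :=
    (Real.summable_nat_rpow_inv.2 (by linarith)).mul_right C
  have h := ae_summable_of_integral_le (Pr := Pr) (f := fun (i : ℕ) ω => ((i : ℝ) ^ (1 + ε))⁻¹ * f i ω)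
    (fun i ω => mul_nonneg (by positivity) (hf0 i ω)) (fun i => (hint i).const_mul _)
    (fun i => by
      rw [integral_const_mul]
      exact mul_le_mul_of_nonneg_left (hC i) (by positivity)) hsum
  filter_upwards [h] with ω hω
  refine ⟨∑' i : ℕ, ((i : ℝ) ^ (1 + ε))⁻¹ * f i ω, fun n hn => ?_⟩
  have h1 := hω.sum_le_tsum (Finset.Icc 1 n) fun i _ => mul_nonneg (by positivity) (hf0 i ω)
  refine le_trans ?_ (mul_le_mul_of_nonneg_right h1 (by positivity))
  rw [Finset.sum_mul]
  refine Finset.sum_le_sum fun i hi => ?_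
  obtain ⟨hi1, hin⟩ := Finset.mem_Icc.1 hi
  have hi0 : (0 : ℝ) < (i : ℝ) ^ (1 + ε) := by
    have : (0 : ℝ) < i := by exact_mod_cast hi1
    positivity
  have h2 : (i : ℝ) ^ (1 + ε) ≤ (n : ℝ) ^ (1 + ε) := by gcongr
  rw [mul_right_comm]
  refine le_mul_of_one_le_left (hf0 i ω) ?_
  rw [← div_eq_inv_mul, one_le_div hi0]
  exact h2

/-- The Kronecker lemma. -/
theorem tendsto_inv_mul_of_tendsto_sum {N : ℕ → ℝ} (hN0 : N 0 = 0) {l : ℝ}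
    (h : Tendsto (fun n : ℕ => ∑ k ∈ Finset.Icc 1 n, (k : ℝ)⁻¹ * (N k - N (k - 1))) atTop (𝓝 l)) :
    Tendsto (fun n : ℕ => (n : ℝ)⁻¹ * N n) atTop (𝓝 0) := by
  set T : ℕ → ℝ := fun n => ∑ k ∈ Finset.Icc 1 n, (k : ℝ)⁻¹ * (N k - N (k - 1)) with hT
  have hT0 : T 0 = 0 := by simp [hT]
  -- Summation by parts writes `N n / n` as `T n` minus the average of `T 0, …, T (n - 1)`, and both
  -- tend to `l`.
  have hlim := h.sub h.cesaro
  rw [sub_self] at hlim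
  refine hlim.congr' ?_
  filter_upwards [eventually_ge_atTop 1] with n hn
  have h1 : N n = ∑ k ∈ Finset.Icc 1 n, (k : ℝ) * (T k - T (k - 1)) := by
    have h2 : ∑ k ∈ Finset.Icc 1 n, (k : ℝ) * (T k - T (k - 1))
        = ∑ k ∈ Finset.Icc 1 n, (N k - N (k - 1)) := by
      refine Finset.sum_congr rfl fun k hk => ?_
      have hk1 := (Finset.mem_Icc.1 hk).1
      have : (k : ℝ) ≠ 0 := by positivity
      rw [hT, partialSum_sub_prev _ hk1, mul_inv_cancel_left₀ this]
    have h3 := sum_prev_sub (fun k => -N k) n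
    rw [h2]
    have h4 : ∑ k ∈ Finset.Icc 1 n, (N k - N (k - 1))
        = ∑ k ∈ Finset.Icc 1 n, (-N (k - 1) - -N k) :=
      Finset.sum_congr rfl fun k _ => by ring
    rw [h4, h3, hN0]; ring
  rw [h1, sum_mul_sub_prev (fun k => (k : ℝ)) T 0 hn]
  have hn0 : (n : ℝ) ≠ 0 := by positivity
  have h5 : ∑ j ∈ Finset.Ico 1 n, (((j + 1 : ℕ) : ℝ) - (j : ℝ)) * (T j - 0)
      = ∑ i ∈ Finset.range n, T i := by
    rw [Finset.range_eq_Ico, Finset.sum_eq_sum_Ico_succ_bot (by omega) T, hT0, zero_add]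
    refine Finset.sum_congr rfl fun j _ => ?_
    push_cast; ring
  rw [h5, hT0]
  field_simp
  push_cast
  ring

/-- A sequence whose weighted series is bounded grows at most like the weights. -/
theorem abs_sum_le_of_abs_weighted_sum_le {z : ℕ → ℝ} {κ R : ℝ} (hκ : 0 ≤ κ)
    (hR : ∀ n : ℕ, |∑ k ∈ Finset.Icc 1 n, ((k : ℝ) ^ κ)⁻¹ * z k| ≤ R) {n : ℕ} (hn : 1 ≤ n) :
    |∑ k ∈ Finset.Icc 1 n, z k| ≤ 2 * R * (n : ℝ) ^ κ := by
  set T : ℕ → ℝ := fun n : ℕ => ∑ k ∈ Finset.Icc 1 n, ((k : ℝ) ^ κ)⁻¹ * z k with hT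
  have h1 : ∑ k ∈ Finset.Icc 1 n, z k
      = ∑ k ∈ Finset.Icc 1 n, (k : ℝ) ^ κ * (T k - T (k - 1)) := by
    refine Finset.sum_congr rfl fun k hk => ?_
    have hk1 := (Finset.mem_Icc.1 hk).1
    have : (0 : ℝ) < k := by exact_mod_cast hk1
    rw [hT, partialSum_sub_prev _ hk1, mul_inv_cancel_left₀ (by positivity)]
  rw [h1]
  refine (abs_sum_mul_sub_prev_le (f := fun k => (k : ℝ) ^ κ) (c := 0) (R := R) hn
    (fun _ => by rw [sub_zero]; exact hR 0) (fun _ => by rw [sub_zero]; exact hR n)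
    (fun j _ _ => by rw [sub_zero]; exact hR j)).trans (le_of_eq ?_)
  have h2 : ∀ j : ℕ, |((j + 1 : ℕ) : ℝ) ^ κ - (j : ℝ) ^ κ| = ((j + 1 : ℕ) : ℝ) ^ κ - (j : ℝ) ^ κ := by
    intro j
    refine abs_of_nonneg (sub_nonneg.2 ?_)
    gcongr
    omega
  simp only [h2]
  rw [Finset.sum_Ico_sub (fun j : ℕ => (j : ℝ) ^ κ) hn, abs_of_nonneg (by positivity),
    abs_of_nonneg (by positivity)]
  push_cast
  ring

end SummationTools

/-! ### Moments of products and of weighted sums. -/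

section ProductMoments

variable {Ω : Type*} {mΩ : MeasurableSpace Ω} {Pr : Measure Ω}

/-- Cauchy-Schwarz in the form of a weighted arithmetic-geometric mean inequality, with the weights
chosen so that each half contributes `√A √B / 2`. -/
theorem HasMomentLE.mul {s A B : ℝ} {f g : Ω → ℝ} (hA : 0 < A) (hB : 0 < B)
    (hf : HasMomentLE Pr (2 * s) f A) (hg : HasMomentLE Pr (2 * s) g B) :
    HasMomentLE Pr s (fun ω => f ω * g ω) (√A * √B) := by
  have hsA := Real.sqrt_pos.2 hA
  have hsB := Real.sqrt_pos.2 hB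
  refine HasMomentLE.of_abs_le (g := fun ω => (√B / √A / 2) * |f ω| ^ (2 * s)
    + (√A / √B / 2) * |g ω| ^ (2 * s)) (hf.1.mul hg.1)
    ((hf.2.1.const_mul _).add (hg.2.1.const_mul _)) (ae_of_all _ fun ω => ?_) ?_
  · have e : ∀ x : ℝ, |x| ^ (2 * s) = (|x| ^ s) ^ 2 := fun x => by
      rw [← Real.rpow_natCast, ← Real.rpow_mul (abs_nonneg _)]; congr 1; push_cast; ring
    rw [abs_mul, Real.mul_rpow (abs_nonneg _) (abs_nonneg _), e, e]
    set a := |f ω| ^ s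
    set b := |g ω| ^ s
    have h1 := sq_nonneg (√B * a - √A * b)
    rw [← sub_nonneg]
    have h2 : √B / √A / 2 * a ^ 2 + √A / √B / 2 * b ^ 2 - a * b
        = (√B * a - √A * b) ^ 2 / (2 * √A * √B) := by field_simp; ring
    rw [h2]
    positivity
  · rw [integral_add (hf.2.1.const_mul _) (hg.2.1.const_mul _), integral_const_mul,
      integral_const_mul]
    calc _ ≤ √B / √A / 2 * A + √A / √B / 2 * B := by
          gcongr
          · exact hf.2.2
          · exact hg.2.2
      _ = √B / √A / 2 * (√A * √A) + √A / √B / 2 * (√B * √B) := by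
          rw [Real.mul_self_sqrt hA.le, Real.mul_self_sqrt hB.le]
      _ = _ := by field_simp; ring

/-- A first moment at the correct scale, from `|f| ≤ lam + lam ^ (1 - s) * |f| ^ s`. -/
theorem HasMomentLE.integral_abs_le [IsProbabilityMeasure Pr] {s A lam : ℝ} {f : Ω → ℝ}
    (hs : 1 ≤ s) (hlam : 0 < lam)
    (hf : HasMomentLE Pr s f (A * lam ^ s)) :
    Integrable f Pr ∧ ∫ ω, |f ω| ∂Pr ≤ (1 + A) * lam := by
  have hle : ∀ ω, |f ω| ≤ lam + lam ^ (1 - s) * |f ω| ^ s := by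
    intro ω
    rcases le_total |f ω| lam with h | h
    · exact h.trans (le_add_of_nonneg_right (by positivity))
    · have h0 : 0 < |f ω| := hlam.trans_le h
      have h1 : |f ω| = |f ω| ^ (1 - s) * |f ω| ^ s := by
        rw [← Real.rpow_add h0]; simp
      have h2 : |f ω| ^ (1 - s) ≤ lam ^ (1 - s) :=
        Real.rpow_le_rpow_of_nonpos hlam h (by linarith)
      have h3 : |f ω| ^ (1 - s) * |f ω| ^ s ≤ lam ^ (1 - s) * |f ω| ^ s := by gcongr
      linarith
  have hint : Integrable (fun ω => lam + lam ^ (1 - s) * |f ω| ^ s) Pr :=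
    (integrable_const _).add (hf.2.1.const_mul _)
  have hfi : Integrable f Pr := hint.mono' hf.1 (ae_of_all _ hle)
  refine ⟨hfi, (integral_mono hfi.abs hint hle).trans ?_⟩
  rw [integral_add (integrable_const _) (hf.2.1.const_mul _), integral_const_mul]
  have h4 : lam ^ (1 - s) * lam ^ s = lam := by rw [← Real.rpow_add hlam]; simp
  calc _ ≤ lam + lam ^ (1 - s) * (A * lam ^ s) := by
        simp only [integral_const, probReal_univ, smul_eq_mul, one_mul]
        gcongr
        exact hf.2.2
    _ = lam + A * (lam ^ (1 - s) * lam ^ s) := by ring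
    _ = _ := by rw [h4]; ring

variable [IsProbabilityMeasure Pr] {ℱ : Filtration ℕ mΩ} {z : ℕ → Ω → ℝ} {s Cz : ℝ}

theorem IsMartingaleDiff.hasMomentLE_sum (hz : IsMartingaleDiff Pr ℱ z) (hs1 : 1 < s) (hs2 : s ≤ 2)
    (hm : ∀ n, 1 ≤ n → HasMomentLE Pr (2 * s) (z n) Cz) (a : ℕ → ℝ) (n : ℕ) :
    HasMomentLE Pr (2 * s) (fun ω => ∑ i ∈ Finset.Icc 1 n, a i * z i ω)
      ((40 * ∑ i ∈ Finset.Icc 1 n, a i ^ 2 * Cz ^ s⁻¹) ^ s) := by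
  have hCz : 0 ≤ Cz := (hm 1 le_rfl).nonneg
  have hd := hz.const_mul a
  have hdm : ∀ i, 1 ≤ i → HasMomentLE Pr (2 * s) (fun ω => a i * z i ω) (|a i| ^ (2 * s) * Cz) :=
    fun i hi => (hm i hi).const_mul _
  have hpow : ∀ i, |a i| ^ (2 * s) * Cz = (a i ^ 2 * Cz ^ s⁻¹) ^ s := by
    intro i
    rw [Real.mul_rpow (sq_nonneg _) (by positivity), ← Real.rpow_mul hCz,
      inv_mul_cancel₀ (by linarith), Real.rpow_one, Real.rpow_mul (abs_nonneg _)]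
    norm_num
  refine ⟨((hd.stronglyMeasurable_sum n).mono (ℱ.le n)).aestronglyMeasurable,
    integrable_abs_sum_rpow (by linarith) _ (fun i hi => (hdm i (Finset.mem_Icc.1 hi).1).1)
      (fun i hi => (hdm i (Finset.mem_Icc.1 hi).1).2.1), ?_⟩
  exact hd.integral_abs_sum_rpow_le_of_two_lt hs1 hs2 (fun i hi => (hdm i hi).2.1)
    (fun i => by positivity) (fun i hi => ((hdm i hi).2.2).trans (hpow i).le) n

end ProductMoments

/-! ### The off-diagonal part of the form in martingale differences. -/

section OffDiagonal

variable {Ω : Type*} {mΩ : MeasurableSpace Ω} {Pr : Measure Ω}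

theorem tendsto_sum_Icc_of_summable {f : ℕ → ℝ} (hf : Summable f) :
    Tendsto (fun n => ∑ k ∈ Finset.Icc 1 n, f k) atTop (𝓝 ((∑' k, f k) - f 0)) := by
  have h := (((tendsto_add_atTop_iff_nat 1).2 hf.hasSum.tendsto_sum_nat).sub_const (f 0))
  refine h.congr fun n => ?_
  rw [Finset.sum_range_eq_add_Ico _ (by omega), add_sub_cancel_left]
  rfl

theorem lagOffDiag_sub (K K' : ℤ → ℝ) (n : ℕ) (x : ℕ → ℝ) :
    lagOffDiag (fun k => K k - K' k) n x = lagOffDiag K n x - lagOffDiag K' n x := by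
  unfold lagOffDiag
  simp only [sub_mul, Finset.sum_sub_distrib, mul_sub]

theorem lagOffDiag_zero (K : ℤ → ℝ) (x : ℕ → ℝ) : lagOffDiag K 0 x = 0 := by
  simp [lagOffDiag]

theorem lagOffDiag_eq_add (K : ℤ → ℝ) {n : ℕ} (hn : 1 ≤ n) (x : ℕ → ℝ) :
    lagOffDiag K n x = lagOffDiag K (n - 1) x
      + x n * ∑ i ∈ Finset.Ico 1 n, K ((n : ℤ) - i) * x i := by
  obtain ⟨m, rfl⟩ := Nat.exists_eq_add_of_le' hn
  unfold lagOffDiag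
  rw [Finset.sum_Icc_succ_top (by omega), Nat.add_sub_cancel]

variable {ℱ : Filtration ℕ mΩ} {z : ℕ → Ω → ℝ} {s Cz : ℝ}

theorem IsMartingaleDiff.stronglyMeasurable_lag_sum (hz : IsMartingaleDiff Pr ℱ z) (A : ℤ → ℝ)
    (n : ℕ) : StronglyMeasurable[ℱ n]
      (fun ω => ∑ i ∈ Finset.Ico 1 (n + 1), A (((n + 1 : ℕ) : ℤ) - i) * z i ω) := by
  refine Finset.stronglyMeasurable_fun_sum _ fun i hi => ?_
  obtain ⟨h1, h2⟩ := Finset.mem_Ico.1 hi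
  exact ((hz.adapted i h1).mono (ℱ.mono (by omega))).const_mul _

variable [IsProbabilityMeasure Pr]

theorem IsMartingaleDiff.hasMomentLE_lag_sum (hz : IsMartingaleDiff Pr ℱ z) (hs1 : 1 < s)
    (hs2 : s ≤ 2) (hm : ∀ n, 1 ≤ n → HasMomentLE Pr (2 * s) (z n) Cz) {A : ℤ → ℝ} {Q : ℝ}
    (hA : ∀ F : Finset ℤ, ∑ k ∈ F, A k ^ 2 ≤ Q) (j : ℕ) :
    HasMomentLE Pr (2 * s) (fun ω => ∑ i ∈ Finset.Ico 1 j, A ((j : ℤ) - i) * z i ω)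
      ((40 * (Q * Cz ^ s⁻¹)) ^ s) := by
  have hCz : 0 ≤ Cz := (hm 1 le_rfl).nonneg
  have hIco : Finset.Ico 1 j = Finset.Icc 1 (j - 1) := by ext i; simp; omega
  rw [hIco]
  refine (hz.hasMomentLE_sum hs1 hs2 hm (fun i => A ((j : ℤ) - i)) (j - 1)).mono ?_
  have h1 : ∑ i ∈ Finset.Icc 1 (j - 1), A ((j : ℤ) - i) ^ 2 ≤ Q := by
    refine le_trans (le_of_eq ?_) (hA ((Finset.Icc 1 (j - 1)).image fun i : ℕ => (j : ℤ) - i))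
    rw [Finset.sum_image]
    intro a _ b _ hab
    simpa using hab
  rw [← Finset.sum_mul]
  have h0 : 0 ≤ ∑ i ∈ Finset.Icc 1 (j - 1), A ((j : ℤ) - i) ^ 2 :=
    Finset.sum_nonneg fun _ _ => sq_nonneg _
  refine Real.rpow_le_rpow (by positivity) ?_ (by linarith)
  gcongr

theorem IsMartingaleDiff.hasMomentLE_mul_lag_sum (hz : IsMartingaleDiff Pr ℱ z) (hs1 : 1 < s)
    (hs2 : s ≤ 2) (hCz : 0 < Cz) (hm : ∀ n, 1 ≤ n → HasMomentLE Pr (2 * s) (z n) Cz)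
    {A : ℤ → ℝ} {Q : ℝ} (hQ : 0 < Q) (hA : ∀ F : Finset ℤ, ∑ k ∈ F, A k ^ 2 ≤ Q) {j : ℕ}
    (hj : 1 ≤ j) :
    HasMomentLE Pr s (fun ω => z j ω * ∑ i ∈ Finset.Ico 1 j, A ((j : ℤ) - i) * z i ω)
      (40 ^ (s / 2) * Cz * Q ^ (s / 2)) := by
  refine ((hm j hj).mul hCz (by positivity) (hz.hasMomentLE_lag_sum hs1 hs2 hm hA j)).mono
    (le_of_eq ?_)
  have h1 : (40 * (Q * Cz ^ s⁻¹)) ^ s = 40 ^ s * Q ^ s * Cz := by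
    rw [Real.mul_rpow (by norm_num) (by positivity), Real.mul_rpow hQ.le (by positivity),
      ← Real.rpow_mul hCz.le, inv_mul_cancel₀ (by linarith), Real.rpow_one, mul_assoc]
  have h2 : ∀ x : ℝ, 0 < x → √(x ^ s) = x ^ (s / 2) := fun x hx => by
    rw [Real.sqrt_eq_rpow, ← Real.rpow_mul hx.le]; congr 1; ring
  rw [h1, Real.sqrt_mul (by positivity), Real.sqrt_mul (by positivity), h2 _ (by norm_num),
    h2 _ hQ, mul_comm, mul_assoc, Real.mul_self_sqrt hCz.le]
  ring

theorem IsMartingaleDiff.mul_lag_sum (hz : IsMartingaleDiff Pr ℱ z) (hs1 : 1 < s) (hs2 : s ≤ 2)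
    (hCz : 0 < Cz) (hm : ∀ n, 1 ≤ n → HasMomentLE Pr (2 * s) (z n) Cz) {A : ℕ → ℤ → ℝ}
    {Q : ℕ → ℝ} (hQ : ∀ n, 1 ≤ n → 0 < Q n)
    (hA : ∀ n, 1 ≤ n → ∀ F : Finset ℤ, ∑ k ∈ F, A n k ^ 2 ≤ Q n) :
    IsMartingaleDiff Pr ℱ
      (fun n ω => z n ω * ∑ i ∈ Finset.Ico 1 n, A n ((n : ℤ) - i) * z i ω) := by
  have h := hz.mul_prev
    (a := fun n ω => ∑ i ∈ Finset.Ico 1 (n + 1), A (n + 1) (((n + 1 : ℕ) : ℤ) - i) * z i ω)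
    (fun n => hz.stronglyMeasurable_lag_sum (A (n + 1)) n) (fun n => by
      have h1 := hz.hasMomentLE_mul_lag_sum hs1 hs2 hCz hm (hQ (n + 1) (by omega))
        (hA (n + 1) (by omega)) (j := n + 1) (by omega)
      have h2 := memLp_of_integrable_abs_rpow (by linarith) h1.1 h1.2.1
      refine (h2.integrable ?_).congr (ae_of_all _ fun ω => mul_comm _ _)
      rw [← ENNReal.ofReal_one]
      exact ENNReal.ofReal_le_ofReal hs1.le)
  have e : ∀ n : ℕ, 1 ≤ n → (fun ω => (∑ i ∈ Finset.Ico 1 (n - 1 + 1),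
      A (n - 1 + 1) (((n - 1 + 1 : ℕ) : ℤ) - i) * z i ω) * z n ω)
      = fun ω => z n ω * ∑ i ∈ Finset.Ico 1 n, A n ((n : ℤ) - i) * z i ω := fun n hn => by
    funext ω
    rw [Nat.sub_add_cancel hn, mul_comm]
  refine ⟨fun n hn => ?_, fun n hn => ?_, fun n => ?_⟩
  · rw [← e n hn]; exact h.adapted n hn
  · rw [← e n hn]; exact h.integrable n hn
  · rw [← e (n + 1) (by omega)]; exact h.condExp n

/-- For fixed weights the off-diagonal form is itself a martingale in `n`, with differences `z_j`
times a lag sum of the past. These are bounded in `L^s` and `s ≤ 2`, so von Bahr-Esseen applies. -/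
theorem IsMartingaleDiff.hasMomentLE_lagOffDiag (hz : IsMartingaleDiff Pr ℱ z) (hs1 : 1 < s)
    (hs2 : s ≤ 2) (hCz : 0 < Cz) (hm : ∀ n, 1 ≤ n → HasMomentLE Pr (2 * s) (z n) Cz)
    {A : ℤ → ℝ} {Q : ℝ} (hQ : 0 < Q) (hA : ∀ F : Finset ℤ, ∑ k ∈ F, A k ^ 2 ≤ Q) (n : ℕ) :
    HasMomentLE Pr s (fun ω => lagOffDiag A n (fun i => z i ω))
      (4 * (n * (40 ^ (s / 2) * Cz * Q ^ (s / 2)))) := by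
  have hd := hz.mul_lag_sum hs1 hs2 hCz hm (A := fun _ => A) (fun _ _ => hQ) (fun _ _ => hA)
  have hdm : ∀ j, 1 ≤ j → HasMomentLE Pr s
      (fun ω => z j ω * ∑ i ∈ Finset.Ico 1 j, A ((j : ℤ) - i) * z i ω) _ := fun j hj =>
    hz.hasMomentLE_mul_lag_sum hs1 hs2 hCz hm hQ hA hj
  refine ⟨((hd.stronglyMeasurable_sum n).mono (ℱ.le n)).aestronglyMeasurable,
    integrable_abs_sum_rpow (by linarith) _ (fun i hi => (hdm i (Finset.mem_Icc.1 hi).1).1)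
      (fun i hi => (hdm i (Finset.mem_Icc.1 hi).1).2.1), ?_⟩
  refine (hd.integral_abs_sum_rpow_le hs1.le hs2 (fun i hi => (hdm i hi).2.1) n).trans ?_
  gcongr
  refine (Finset.sum_le_sum fun i hi => (hdm i (Finset.mem_Icc.1 hi).1).2.2).trans ?_
  simp

/-- The rows use the current weights `K j`, which are deterministic, so the products remain
martingale differences. After division by `j` their moments of order `s` are `O((j⁻² b_j⁻¹) ^ (s /
2))`. -/
theorem IsMartingaleDiff.ae_exists_tendsto_sum_lag (hz : IsMartingaleDiff Pr ℱ z) (hs1 : 1 < s)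
    (hs2 : s ≤ 2) (hCz : 0 < Cz) (hm : ∀ n, 1 ≤ n → HasMomentLE Pr (2 * s) (z n) Cz)
    {K : ℕ → ℤ → ℝ} {b : ℕ → ℝ} {L : ℝ} (hL : 0 < L) (hb : ∀ n, 1 ≤ n → 0 < b n)
    (hK : ∀ n, 1 ≤ n → ∀ F : Finset ℤ, ∑ k ∈ F, K n k ^ 2 ≤ L * (b n)⁻¹)
    (hsum2 : Summable fun n : ℕ+ => ((n : ℝ) ^ (-2 : ℝ) * (b n)⁻¹) ^ (s / 2)) :
    ∀ᵐ ω ∂Pr, ∃ c, Tendsto (fun n : ℕ => ∑ j ∈ Finset.Icc 1 n, (j : ℝ)⁻¹ *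
      (z j ω * ∑ i ∈ Finset.Ico 1 j, K j ((j : ℤ) - i) * z i ω)) atTop (𝓝 c) := by
  set c₀ := (40 : ℝ) ^ (s / 2) * Cz * L ^ (s / 2) with hc₀
  have hc₀0 : 0 < c₀ := by positivity
  have hQ : ∀ n, 1 ≤ n → 0 < L * (b n)⁻¹ := fun n hn => by have := hb n hn; positivity
  have hd := (hz.mul_lag_sum hs1 hs2 hCz hm hQ hK).const_mul fun n => (n : ℝ)⁻¹
  have hdm : ∀ n : ℕ, 1 ≤ n → HasMomentLE Pr s
      (fun ω => (n : ℝ)⁻¹ * (z n ω * ∑ i ∈ Finset.Ico 1 n, K n ((n : ℤ) - i) * z i ω))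
      (c₀ * ((n : ℝ) ^ (-2 : ℝ) * (b n)⁻¹) ^ (s / 2)) := by
    intro n hn
    refine ((hz.hasMomentLE_mul_lag_sum hs1 hs2 hCz hm (hQ n hn) (hK n hn) hn).const_mul _).mono
      (le_of_eq ?_)
    have h1 := hb n hn
    have h2 : (0 : ℝ) < n := by exact_mod_cast hn
    rw [abs_of_pos (by positivity), Real.mul_rpow hL.le (by positivity),
      Real.mul_rpow (x := (n : ℝ) ^ (-2 : ℝ)) (by positivity) (by positivity),
      ← Real.rpow_mul h2.le, Real.inv_rpow h2.le, ← Real.rpow_neg h2.le,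
      show (-2 : ℝ) * (s / 2) = -s by ring, hc₀]
    ring
  have hsumN : Summable fun n : ℕ => c₀ * ((n : ℝ) ^ (-2 : ℝ) * (b n)⁻¹) ^ (s / 2) :=
    (summable_pnat_iff_summable_nat.1 hsum2).mul_left c₀
  refine hd.ae_exists_tendsto_sum hs1.le hs2 (fun n hn => (hdm n hn).2.1)
    (C := ∑' n : ℕ, c₀ * ((n : ℝ) ^ (-2 : ℝ) * (b n)⁻¹) ^ (s / 2)) fun n => ?_
  refine (Finset.sum_le_sum fun i hi => (hdm i (Finset.mem_Icc.1 hi).1).2.2).trans ?_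
  refine hsumN.sum_le_tsum _ fun i _ => mul_nonneg hc₀0.le (Real.rpow_nonneg ?_ _)
  rcases Nat.eq_zero_or_pos i with h | h
  · simp [h]
  · have := hb i h
    positivity

/-- Meant for `A = K n - K (n - 1)`. The scale is `n ^ (1 / s)` from the number of rows times `n⁻¹ b
^ (-1/2)` from the `ℓ²` size of the weights, divided by `n`. -/
theorem IsMartingaleDiff.integral_abs_inv_mul_lagOffDiag_le (hz : IsMartingaleDiff Pr ℱ z)
    (hs1 : 1 < s) (hs2 : s ≤ 2) (hCz : 0 < Cz)
    (hm : ∀ n, 1 ≤ n → HasMomentLE Pr (2 * s) (z n) Cz)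
    {A : ℤ → ℝ} {L b : ℝ} (hL : 0 < L) (hb : 0 < b) {n : ℕ} (hn : 1 ≤ n)
    (hA : ∀ F : Finset ℤ, ∑ k ∈ F, A k ^ 2 ≤ L * ((n : ℝ) ^ (-2 : ℝ) * b⁻¹)) :
    Integrable (fun ω => (n : ℝ)⁻¹ * lagOffDiag A (n - 1) (fun i => z i ω)) Pr ∧
      ∫ ω, |(n : ℝ)⁻¹ * lagOffDiag A (n - 1) (fun i => z i ω)| ∂Pr
        ≤ (1 + 4 * (40 ^ (s / 2) * Cz * L ^ (s / 2))) *
          ((n : ℝ) ^ (-2 + 1 / s) * b ^ (-(1 / 2) : ℝ)) := by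
  have hs0 : 0 < s := by linarith
  have hn0 : (0 : ℝ) < n := by exact_mod_cast hn
  set x : ℝ := (n : ℝ) ^ (-2 : ℝ) * b⁻¹ with hx
  have hxn : 0 < x := by positivity
  have h2 := hz.hasMomentLE_lagOffDiag hs1 hs2 hCz hm (mul_pos hL hxn) hA (n - 1)
  have h3 : HasMomentLE Pr s (fun ω => lagOffDiag A (n - 1) (fun i => z i ω))
      (4 * (40 ^ (s / 2) * Cz * L ^ (s / 2)) * ((n : ℝ) ^ (1 / s) * x ^ (1 / 2 : ℝ)) ^ s) := by
    refine h2.mono ?_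
    rw [Real.mul_rpow hL.le hxn.le, Real.mul_rpow (x := (n : ℝ) ^ (1 / s)) (by positivity)
      (by positivity), ← Real.rpow_mul hn0.le, ← Real.rpow_mul hxn.le,
      one_div_mul_cancel hs0.ne', Real.rpow_one, show (1 / 2 : ℝ) * s = s / 2 by ring]
    have h4 : ((n - 1 : ℕ) : ℝ) ≤ n := by exact_mod_cast Nat.sub_le _ _
    calc 4 * (((n - 1 : ℕ) : ℝ) * (40 ^ (s / 2) * Cz * (L ^ (s / 2) * x ^ (s / 2))))
        ≤ 4 * ((n : ℝ) * (40 ^ (s / 2) * Cz * (L ^ (s / 2) * x ^ (s / 2)))) := by gcongr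
      _ = _ := by ring
  obtain ⟨h5, h6⟩ := h3.integral_abs_le hs1.le (by positivity)
  refine ⟨h5.const_mul _, ?_⟩
  simp only [abs_mul, abs_of_pos (inv_pos.2 hn0)]
  rw [integral_const_mul]
  calc _ ≤ (n : ℝ)⁻¹ * ((1 + 4 * (40 ^ (s / 2) * Cz * L ^ (s / 2))) *
          ((n : ℝ) ^ (1 / s) * x ^ (1 / 2 : ℝ))) := by gcongr
    _ = _ := by
        rw [hx, Real.mul_rpow (by positivity) (by positivity), ← Real.rpow_mul hn0.le,
          Real.rpow_neg hb.le, Real.inv_rpow hb.le,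
          show (-2 + 1 / s : ℝ) = 1 / s + -1 + -1 by ring, Real.rpow_add hn0,
          Real.rpow_add hn0, show (-2 : ℝ) * (1 / 2) = -1 by norm_num, Real.rpow_neg_one]
        ring

/-- The off-diagonal part of a normalized quadratic form in martingale differences vanishes. -/
theorem IsMartingaleDiff.tendsto_lagOffDiag (hz : IsMartingaleDiff Pr ℱ z) (hs1 : 1 < s)
    (hs2 : s ≤ 2) (hCz : 0 < Cz) (hm : ∀ n, 1 ≤ n → HasMomentLE Pr (2 * s) (z n) Cz)
    {K : ℕ → ℤ → ℝ} {b : ℕ → ℝ} {L : ℝ} (hL : 0 < L) (hb : ∀ n, 1 ≤ n → 0 < b n)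
    (hK : ∀ n, 1 ≤ n → ∀ F : Finset ℤ, ∑ k ∈ F, K n k ^ 2 ≤ L * (b n)⁻¹)
    (hdK : ∀ n, 2 ≤ n → ∀ F : Finset ℤ,
      ∑ k ∈ F, (K n k - K (n - 1) k) ^ 2 ≤ L * ((n : ℝ) ^ (-2 : ℝ) * (b n)⁻¹))
    (hsum2 : Summable fun n : ℕ+ => ((n : ℝ) ^ (-2 : ℝ) * (b n)⁻¹) ^ (s / 2))
    (hsum3 : Summable fun n : ℕ+ => (n : ℝ) ^ (-2 + 1 / s) * (b n) ^ (-(1 / 2) : ℝ)) :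
    ∀ᵐ ω ∂Pr, Tendsto (fun n : ℕ => (n : ℝ)⁻¹ * lagOffDiag (K n) n (fun i => z i ω))
      atTop (𝓝 0) := by
  have hconv := hz.ae_exists_tendsto_sum_lag hs1 hs2 hCz hm hL hb hK hsum2
  set R : ℕ → Ω → ℝ := fun n ω =>
    (n : ℝ)⁻¹ * lagOffDiag (fun k => K n k - K (n - 1) k) (n - 1) (fun i => z i ω) with hR
  have hRint : ∀ n : ℕ, 1 ≤ n → Integrable (R n) Pr ∧ ∫ ω, |R n ω| ∂Pr
      ≤ (1 + 4 * (40 ^ (s / 2) * Cz * L ^ (s / 2))) *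
        ((n : ℝ) ^ (-2 + 1 / s) * (b n) ^ (-(1 / 2) : ℝ)) := by
    intro n hn
    -- At `n = 1` there is no earlier index, so the form is empty and the arbitrary weights `K 0` do
    -- not matter.
    rcases eq_or_lt_of_le hn with h1 | h1
    · have h0 : R n = fun _ => 0 := by
        funext ω; simp only [hR, ← h1, Nat.sub_self, lagOffDiag_zero, mul_zero]
      rw [h0]
      simp only [abs_zero, integral_zero]
      have := hb n hn
      exact ⟨integrable_zero _ _ _, by positivity⟩
    · exact hz.integral_abs_inv_mul_lagOffDiag_le hs1 hs2 hCz hm hL (hb n hn) hn (hdK n h1)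
  have hRsum := ae_summable_of_integral_le (Pr := Pr) (f := fun (n : ℕ+) ω => |R n ω|)
    (fun _ _ => abs_nonneg _) (fun n => (hRint n n.2).1.abs) (fun n => (hRint n n.2).2)
    (hsum3.mul_left _)
  filter_upwards [hconv, hRsum] with ω ⟨l, hl⟩ hω
  have h1 : Summable fun n : ℕ => R n ω :=
    (summable_pnat_iff_summable_nat.1 hω).of_abs
  -- The increment of `N` is the new row plus the change of weights `R` on the old indices.
  refine tendsto_inv_mul_of_tendsto_sum (N := fun n => lagOffDiag (K n) n (fun i => z i ω))
    (lagOffDiag_zero _ _) ((hl.add (tendsto_sum_Icc_of_summable h1)).congr fun n => ?_)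
  rw [← Finset.sum_add_distrib]
  refine Finset.sum_congr rfl fun k hk => ?_
  have hk1 := (Finset.mem_Icc.1 hk).1
  rw [hR, ← mul_add, lagOffDiag_sub, lagOffDiag_eq_add (K k) hk1]
  ring

end OffDiagonal

/-! ### Change of the window with the bandwidth. -/

section KernelVariation

/-- The increments in `n` of the weights `w (k b_n)`. -/
theorem A4.exists_sum_sq_le {w : ℝ → ℝ} {r : ℕ} (hw : A4 w r) {b : ℕ → ℝ} (hb : IsBandwidth b) :
    ∃ L : ℝ, 0 < L ∧
      (∀ n, 1 ≤ n → ∀ F : Finset ℤ, ∑ k ∈ F, w ((k : ℝ) * b n) ^ 2 ≤ L * (b n)⁻¹) ∧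
      ∀ n, 2 ≤ n → ∀ F : Finset ℤ, ∑ k ∈ F, (w ((k : ℝ) * b n) - w ((k : ℝ) * b (n - 1))) ^ 2
        ≤ L * ((n : ℝ) ^ (-2 : ℝ) * (b n)⁻¹) := by
  obtain ⟨L, hL, habs, hlip⟩ := hw.exists_lipschitz
  -- The bound holds for every `n`: the comparison sequence vanishes only at `n = 0`, where
  -- truncated subtraction makes the difference vanish too.
  obtain ⟨C, hC⟩ := (Asymptotics.isBigO_nat_atTop_iff (f := fun n : ℕ => b n - b (n - 1))
    (g := fun n : ℕ => b n * (n : ℝ)⁻¹) (fun n hn => by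
      rcases Nat.eq_zero_or_pos n with h | h
      · simp [h]
      · have h1 := hb.pos n h
        have h2 : (0 : ℝ) < n := by exact_mod_cast h
        exact absurd hn (by positivity))).1 hb.sub_isBigO
  have hb1 : 0 < b 1 := hb.pos 1 le_rfl
  have hinv : ∀ n, 1 ≤ n → 2 * (b n)⁻¹ + 1 ≤ (2 + b 1) * (b n)⁻¹ := by
    intro n hn
    have h1 := hb.pos n hn
    have h2 : b n ≤ b 1 := hb.antitone (Set.mem_Ici.2 le_rfl) (Set.mem_Ici.2 hn) hn
    have h3 : 1 ≤ b 1 * (b n)⁻¹ := by rwa [← div_eq_mul_inv, one_le_div h1]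
    linarith
  have hsupp : ∀ (c : ℝ), 0 < c → ∀ k : ℤ, c⁻¹ < |(k : ℝ)| → w (k * c) = 0 := by
    intro c hc k hk
    refine hw.support _ ?_
    rw [abs_mul, abs_of_pos hc]
    have := mul_lt_mul_of_pos_right hk hc
    rw [inv_mul_cancel₀ hc.ne'] at this
    exact this.le
  refine ⟨(L ^ 2 + (L * C) ^ 2) * (2 + b 1), by positivity, fun n hn F => ?_, fun n hn F => ?_⟩
  · have h1 := hb.pos n hn
    have h2 := sum_abs_le_of_support (g := fun k : ℤ => w ((k : ℝ) * b n) ^ 2) (c := 0)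
      (r := (b n)⁻¹) (A := L ^ 2) (by positivity) (by positivity) (fun k hk => by
        by_contra hcon
        rw [sub_zero, not_le] at hcon
        exact hk (by simp [hsupp _ h1 k hcon])) (fun k => by
        rw [abs_pow]
        gcongr
        exact habs _) F
    simp only [abs_pow, sq_abs] at h2
    refine h2.trans ?_
    calc L ^ 2 * (2 * (b n)⁻¹ + 1) ≤ L ^ 2 * ((2 + b 1) * (b n)⁻¹) := by
          gcongr; exact hinv n hn
      _ ≤ (L ^ 2 + (L * C) ^ 2) * ((2 + b 1) * (b n)⁻¹) := by
          gcongr; exact le_add_of_nonneg_right (sq_nonneg _)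
      _ = _ := by ring
  · have hn1 : 1 ≤ n := by omega
    have h1 := hb.pos n hn1
    have h1' := hb.pos (n - 1) (by omega)
    have hn0 : (0 : ℝ) < n := by exact_mod_cast hn1
    have hle : b n ≤ b (n - 1) :=
      hb.antitone (Set.mem_Ici.2 (by omega)) (Set.mem_Ici.2 hn1) (by omega)
    have hbn := hC n
    rw [Real.norm_eq_abs, Real.norm_eq_abs,
      abs_of_pos (by positivity : 0 < b n * (n : ℝ)⁻¹)] at hbn
    -- As `b n ≤ b (n - 1)`, both windows end by `(b n)⁻¹`. On the remaining lags the arguments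
    -- differ by at most `(b n)⁻¹ * C * b n / n = C / n`.
    have hzero : ∀ k : ℤ, (b n)⁻¹ < |(k : ℝ)| →
        w ((k : ℝ) * b n) - w ((k : ℝ) * b (n - 1)) = 0 := by
      intro k hk
      rw [hsupp _ h1 k hk, hsupp _ h1' k (lt_of_le_of_lt (by gcongr) hk), sub_zero]
    have h2 := sum_abs_le_of_support
      (g := fun k : ℤ => (w ((k : ℝ) * b n) - w ((k : ℝ) * b (n - 1))) ^ 2) (c := 0)
      (r := (b n)⁻¹) (A := (L * C * (n : ℝ)⁻¹) ^ 2) (by positivity) (by positivity)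
      (fun k hk => by
        by_contra hcon
        rw [sub_zero, not_le] at hcon
        exact hk (by simp [hzero k hcon])) (fun k => by
        rw [abs_pow]
        rcases lt_or_ge (b n)⁻¹ |(k : ℝ)| with hk | hk
        · rw [hzero k hk]; simp; positivity
        · refine pow_le_pow_left₀ (abs_nonneg _) ((hlip _ _).trans ?_) 2
          rw [← mul_sub, abs_mul]
          calc L * (|(k : ℝ)| * |b n - b (n - 1)|)
              ≤ L * ((b n)⁻¹ * (C * (b n * (n : ℝ)⁻¹))) := by gcongr
            _ = _ := by field_simp) F
    simp only [abs_pow, sq_abs] at h2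
    refine h2.trans ?_
    have h3 : (n : ℝ) ^ (-2 : ℝ) = ((n : ℝ)⁻¹) ^ 2 := by
      rw [Real.rpow_neg hn0.le, inv_pow]; norm_cast
    rw [h3]
    calc (L * C * (n : ℝ)⁻¹) ^ 2 * (2 * (b n)⁻¹ + 1)
        ≤ (L * C * (n : ℝ)⁻¹) ^ 2 * ((2 + b 1) * (b n)⁻¹) := by gcongr; exact hinv n hn1
      _ = (L * C) ^ 2 * ((2 + b 1) * (((n : ℝ)⁻¹) ^ 2 * (b n)⁻¹)) := by ring
      _ ≤ (L ^ 2 + (L * C) ^ 2) * ((2 + b 1) * (((n : ℝ)⁻¹) ^ 2 * (b n)⁻¹)) := by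
          gcongr; exact le_add_of_nonneg_left (sq_nonneg _)
      _ = _ := by ring

end KernelVariation

/-! ### Hölder control of partial sums around each index. -/

section Chaining

theorem sum_Icc_sub_sum_Icc (f : ℕ → ℝ) {i j : ℕ} (hij : i ≤ j) :
    ∑ k ∈ Finset.Icc 1 j, f k - ∑ k ∈ Finset.Icc 1 i, f k = ∑ k ∈ Finset.Ioc i j, f k := by
  have h : ∀ n, Finset.Icc 1 n = Finset.Ioc 0 n := fun n => by ext; simp; omega
  rw [h, h, ← Finset.sum_Ioc_consecutive f (Nat.zero_le i) hij, add_sub_cancel_left]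

/-- Partial sums of a square-summable sequence are `1/2`-Hölder. -/
theorem abs_sum_sub_sum_le {e : ℕ → ℝ} {C : ℝ} (hC : ∀ n, ∑ i ∈ Finset.Icc 1 n, e i ^ 2 ≤ C)
    {τ : ℝ} (hτ : 1 / 2 ≤ τ) (i j : ℕ) :
    |∑ k ∈ Finset.Icc 1 j, e k - ∑ k ∈ Finset.Icc 1 i, e k| ≤ √C * |(j : ℝ) - i| ^ τ := by
  wlog hij : i ≤ j generalizing i j
  · rw [abs_sub_comm, abs_sub_comm (j : ℝ)]
    exact this j i (by omega)
  have hC0 : 0 ≤ C := by simpa using hC 0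
  rcases eq_or_lt_of_le hij with h | h
  · subst h; simp; positivity
  have hd : (1 : ℝ) ≤ (j : ℝ) - i := by
    have : (i : ℝ) + 1 ≤ j := by exact_mod_cast h
    linarith
  rw [sum_Icc_sub_sum_Icc _ hij, abs_of_nonneg (by linarith : (0 : ℝ) ≤ (j : ℝ) - i)]
  have h1 : (∑ k ∈ Finset.Ioc i j, e k) ^ 2 ≤ C * ((j : ℝ) - i) := by
    have h2 := sq_sum_le_card_mul_sum_sq (s := Finset.Ioc i j) (f := e)
    have h3 : ∑ k ∈ Finset.Ioc i j, e k ^ 2 ≤ C :=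
      (Finset.sum_le_sum_of_subset_of_nonneg (fun k hk => by
        simp only [Finset.mem_Ioc, Finset.mem_Icc] at hk ⊢; omega)
        fun _ _ _ => sq_nonneg _).trans (hC j)
    rw [Nat.card_Ioc, Nat.cast_sub hij] at h2
    nlinarith
  calc |∑ k ∈ Finset.Ioc i j, e k| ≤ √(C * ((j : ℝ) - i)) := Real.abs_le_sqrt h1
    _ = √C * ((j : ℝ) - i) ^ (1 / 2 : ℝ) := by rw [Real.sqrt_mul hC0, ← Real.sqrt_eq_rpow]
    _ ≤ _ := by gcongr

variable {Ω : Type*} {mΩ : MeasurableSpace Ω} {Pr : Measure Ω}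

theorem exists_sum_tsum_le_of_summable {φ : ℕ → ℕ → ℝ} (hφ : ∀ i j, 0 ≤ φ i j) {ε : ℝ}
    (hε : 0 < ε) (h : Summable fun x : ℕ × ℕ => ((x.1 + 1 : ℝ) ^ (1 + ε))⁻¹ * φ x.1 x.2) :
    (∀ i, Summable (φ i)) ∧ ∃ K : ℝ, 0 ≤ K ∧ ∀ n : ℕ, 1 ≤ n →
      ∑ i ∈ Finset.Icc 1 n, ∑' j, φ i j ≤ K * (n : ℝ) ^ (1 + ε) := by
  have hg : ∀ i, 0 ≤ ∑' j, φ i j := fun i => tsum_nonneg (hφ i)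
  refine ⟨fun i => ?_, ?_⟩
  · have h1 : (((i : ℝ) + 1) ^ (1 + ε))⁻¹ ≠ 0 := by positivity
    exact (summable_mul_left_iff h1).1 (h.prod_factor i)
  · have h1 := h.prod
    simp only [tsum_mul_left] at h1
    have hT0 : 0 ≤ ∑' i : ℕ, ((i + 1 : ℝ) ^ (1 + ε))⁻¹ * ∑' j, φ i j :=
      tsum_nonneg fun i => mul_nonneg (by positivity) (hg i)
    -- The factor `2 ^ (1 + ε)` comes from `i + 1 ≤ 2n`.
    refine ⟨2 ^ (1 + ε) * ∑' i : ℕ, ((i + 1 : ℝ) ^ (1 + ε))⁻¹ * ∑' j, φ i j, by positivity,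
      fun n hn => ?_⟩
    have hn1 : (1 : ℝ) ≤ n := by exact_mod_cast hn
    have h3 := h1.sum_le_tsum (Finset.Icc 1 n) fun i _ => mul_nonneg (by positivity) (hg i)
    rw [mul_right_comm, ← Real.mul_rpow (by norm_num) (by positivity)]
    refine le_trans ?_ (mul_le_mul_of_nonneg_left h3 (by positivity))
    rw [Finset.mul_sum]
    refine Finset.sum_le_sum fun i hi => ?_
    have hin : (i : ℝ) ≤ n := by exact_mod_cast (Finset.mem_Icc.1 hi).2
    rw [← mul_assoc]
    refine le_mul_of_one_le_left (hg i) ?_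
    rw [← div_eq_mul_inv, one_le_div (by positivity)]
    gcongr
    linarith

theorem ae_summable_weighted_increments {Y : ℕ → Ω → ℝ} {q τ ν C ε : ℝ} (hq : 0 < q) (hν : 1 < ν)
    (hε : 0 < ε)
    (hY : ∀ i j : ℕ, i ≠ j →
      HasMomentLE Pr q (fun ω => Y j ω - Y i ω) (C * |(j : ℝ) - i| ^ (q * τ - ν))) :
    ∀ᵐ ω ∂Pr, Summable fun x : ℕ × ℕ => ((x.1 + 1 : ℝ) ^ (1 + ε))⁻¹ *
      (|Y x.2 ω - Y x.1 ω| ^ q * |(x.2 : ℝ) - x.1| ^ (-(q * τ))) := by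
  have hint : ∀ i j : ℕ,
      Integrable (fun ω => |Y j ω - Y i ω| ^ q * |(j : ℝ) - i| ^ (-(q * τ))) Pr ∧
      ∫ ω, |Y j ω - Y i ω| ^ q * |(j : ℝ) - i| ^ (-(q * τ)) ∂Pr
        ≤ C * |(((j : ℤ) - i : ℤ) : ℝ)| ^ (-ν) := by
    intro i j
    rcases eq_or_ne i j with h | h
    · subst h
      simp only [sub_self, abs_zero, Real.zero_rpow hq.ne', zero_mul, integral_zero, Int.cast_zero,
        Real.zero_rpow (show -ν ≠ 0 by linarith), mul_zero, le_refl, and_true]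
      exact integrable_zero _ _ _
    · have h1 := hY i j h
      have hd : (0 : ℝ) < |(j : ℝ) - i| := abs_pos.2 (sub_ne_zero.2 (by exact_mod_cast h.symm))
      refine ⟨h1.2.1.mul_const _, ?_⟩
      push_cast
      rw [integral_mul_const]
      calc _ ≤ C * |(j : ℝ) - i| ^ (q * τ - ν) * |(j : ℝ) - i| ^ (-(q * τ)) := by
            gcongr
            exact h1.2.2
        _ = C * |(j : ℝ) - i| ^ (-ν) := by
            rw [mul_assoc, ← Real.rpow_add hd]
            congr 2
            ring
  have hC0 : 0 ≤ C := by
    have := (hY 0 1 (by omega)).nonneg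
    simpa using this
  have hs1 : Summable fun i : ℕ => ((i + 1 : ℝ) ^ (1 + ε))⁻¹ := by
    have := (summable_nat_add_iff 1).2 (Real.summable_nat_rpow_inv.2 (by linarith : 1 < 1 + ε))
    simpa using this
  have hs2 := hs1.mul_of_nonneg ((Real.summable_abs_int_rpow hν).mul_left C)
    (Pi.le_def.2 fun i => by rw [Pi.zero_apply]; positivity)
    (Pi.le_def.2 fun i => by rw [Pi.zero_apply]; positivity)
  -- Indexed by position and lag, the bound is a product of two convergent series; `ν > 1` is used
  -- for the lag.
  have hinj : Function.Injective fun x : ℕ × ℕ => (x.1, (x.2 : ℤ) - x.1) := by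
    rintro ⟨a, b⟩ ⟨c, d⟩ h
    simp only [Prod.mk.injEq] at h ⊢
    omega
  refine ae_summable_of_integral_le (fun x ω => by positivity)
    (fun x => (hint x.1 x.2).1.const_mul _) (fun x => ?_) (hs2.comp_injective hinj)
  rw [integral_const_mul]
  exact mul_le_mul_of_nonneg_left (hint x.1 x.2).2 (by positivity)

/-- Increments with moments of order `q` growing slower than `|j - i| ^ (q τ - 1)` are controlled,
uniformly in `j`, by `|j - i| ^ τ` times a factor which is of order one on average over `i`. -/
theorem ae_exists_increment_bound {Y : ℕ → Ω → ℝ} {q τ ν C : ℝ} (hq : 0 < q) (hν : 1 < ν)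
    (hY : ∀ i j : ℕ, i ≠ j →
      HasMomentLE Pr q (fun ω => Y j ω - Y i ω) (C * |(j : ℝ) - i| ^ (q * τ - ν))) :
    ∀ᵐ ω ∂Pr, ∃ g : ℕ → ℝ, (∀ i, 0 ≤ g i) ∧
      (∀ i j : ℕ, |Y j ω - Y i ω| ≤ g i ^ q⁻¹ * |(j : ℝ) - i| ^ τ) ∧
      ∀ ε : ℝ, 0 < ε → ∃ K : ℝ, ∀ n : ℕ, 1 ≤ n →
        ∑ i ∈ Finset.Icc 1 n, g i ≤ K * (n : ℝ) ^ (1 + ε) := by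
  -- Countably many exponents suffice, so one null set serves all `ε`.
  have hmain := ae_all_iff.2 fun m : ℕ =>
    ae_summable_weighted_increments (ε := 1 / ((m : ℝ) + 1)) hq hν (by positivity) hY
  filter_upwards [hmain] with ω hω
  set φ : ℕ → ℕ → ℝ := fun i j => |Y j ω - Y i ω| ^ q * |(j : ℝ) - i| ^ (-(q * τ)) with hφ
  have hφ0 : ∀ i j, 0 ≤ φ i j := fun i j => by positivity
  have key := fun m : ℕ => exists_sum_tsum_le_of_summable hφ0 (by positivity) (hω m)
  -- `g i` sums the normalised increments over all `j`, so it dominates each of them.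
  refine ⟨fun i => ∑' j, φ i j, fun i => tsum_nonneg (hφ0 i), fun i j => ?_, fun ε hε => ?_⟩
  · rcases eq_or_ne i j with h | h
    · subst h
      simp only [sub_self, abs_zero]
      exact mul_nonneg (Real.rpow_nonneg (tsum_nonneg (hφ0 i)) _) (Real.rpow_nonneg le_rfl _)
    · have hd : (0 : ℝ) < |(j : ℝ) - i| := abs_pos.2 (sub_ne_zero.2 (by exact_mod_cast h.symm))
      have h1 : φ i j ≤ ∑' j, φ i j := ((key 0).1 i).le_tsum j fun k _ => hφ0 i k
      have h2 : |Y j ω - Y i ω| = φ i j ^ q⁻¹ * |(j : ℝ) - i| ^ τ := by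
        rw [hφ, Real.mul_rpow (by positivity) (by positivity), ← Real.rpow_mul (abs_nonneg _),
          mul_inv_cancel₀ hq.ne', Real.rpow_one, ← Real.rpow_mul hd.le, mul_assoc,
          ← Real.rpow_add hd, show -(q * τ) * q⁻¹ + τ = 0 by field_simp; ring, Real.rpow_zero,
          mul_one]
      rw [h2]
      exact mul_le_mul_of_nonneg_right
        (Real.rpow_le_rpow (hφ0 i j) h1 (inv_nonneg.2 hq.le)) (by positivity)
  · obtain ⟨m, hm⟩ := exists_nat_one_div_lt hε
    obtain ⟨K, hK0, hK⟩ := (key m).2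
    refine ⟨K, fun n hn => (hK n hn).trans ?_⟩
    have hn1 : (1 : ℝ) ≤ n := by exact_mod_cast hn
    gcongr

end Chaining

/-! ### Consistency for sequences approximated by martingale differences. -/

section MartingaleApproximation

variable {Ω : Type*} {mΩ : MeasurableSpace Ω} {Pr : Measure Ω}
  {ℱ : Filtration ℕ mΩ} {z u : ℕ → Ω → ℝ} {s Cz Cu : ℝ}

theorem ae_exists_abs_le_rpow (hs1 : 1 < s) (hu : ∀ n, HasMomentLE Pr (2 * s) (u n) Cu) {σ : ℝ}
    (hσ : 1 < 2 * s * σ) : ∀ᵐ ω ∂Pr, ∃ C : ℝ, ∀ n : ℕ, 1 ≤ n → |u n ω| ≤ C * (n : ℝ) ^ σ := by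
  have h := ae_exists_sum_le (Pr := Pr) (f := fun n ω => |u n ω| ^ (2 * s))
    (fun i ω => Real.rpow_nonneg (abs_nonneg _) _) (fun n => (hu n).2.1) (fun n => (hu n).2.2)
    (sub_pos.2 hσ)
  filter_upwards [h] with ω ⟨K, hK⟩
  have hs0 : 0 < 2 * s := by linarith
  refine ⟨K ^ (2 * s)⁻¹, fun n hn => ?_⟩
  have h1 : |u n ω| ^ (2 * s) ≤ K * (n : ℝ) ^ (2 * s * σ) := by
    have h2 := (Finset.single_le_sum (f := fun i => |u i ω| ^ (2 * s))
      (fun i _ => Real.rpow_nonneg (abs_nonneg _) _) (Finset.mem_Icc.2 ⟨hn, le_rfl⟩)).trans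
        (hK n hn)
    rwa [add_sub_cancel] at h2
  have hK0 : 0 ≤ K := by
    have h2 := hK 1 le_rfl
    simp only [Nat.cast_one, Real.one_rpow, mul_one] at h2
    exact (Finset.sum_nonneg fun i _ => Real.rpow_nonneg (abs_nonneg _) _).trans h2
  calc |u n ω| = (|u n ω| ^ (2 * s)) ^ (2 * s)⁻¹ := by
        rw [← Real.rpow_mul (abs_nonneg _), mul_inv_cancel₀ hs0.ne', Real.rpow_one]
    _ ≤ (K * (n : ℝ) ^ (2 * s * σ)) ^ (2 * s)⁻¹ := by gcongr
    _ = _ := by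
        rw [Real.mul_rpow hK0 (by positivity), ← Real.rpow_mul (by positivity)]
        congr 2
        field_simp

variable [IsProbabilityMeasure Pr]

/-- The martingale block has a moment of order `|j - i| ^ s`; the `u` part telescopes to `u i - u
j`, which is bounded in `L^{2s}` and absorbed because `|j - i| ≥ 1`. -/
theorem IsMartingaleDiff.hasMomentLE_increment (hz : IsMartingaleDiff Pr ℱ z) (hs1 : 1 < s)
    (hs2 : s ≤ 2) (hm : ∀ n, 1 ≤ n → HasMomentLE Pr (2 * s) (z n) Cz)
    (hu : ∀ n, HasMomentLE Pr (2 * s) (u n) Cu) {i j : ℕ} (hij : i ≠ j) :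
    HasMomentLE Pr (2 * s)
      (fun ω => ∑ k ∈ Finset.Icc 1 j, (2 * z k ω + (u (k - 1) ω - u k ω))
        - ∑ k ∈ Finset.Icc 1 i, (2 * z k ω + (u (k - 1) ω - u k ω)))
      (2 ^ (2 * s) * ((160 * Cz ^ s⁻¹) ^ s + 2 ^ (2 * s) * (Cu + Cu)) * |(j : ℝ) - i| ^ s) := by
  wlog h : i < j generalizing i j
  · have h1 := (this hij.symm (by omega)).neg
    rw [abs_sub_comm]
    simpa only [neg_sub] using h1
  have hCz : 0 ≤ Cz := (hm 1 le_rfl).nonneg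
  have hCu : 0 ≤ Cu := (hu 0).nonneg
  have hd : (1 : ℝ) ≤ (j : ℝ) - i := by
    have : (i : ℝ) + 1 ≤ j := by exact_mod_cast h
    linarith
  rw [abs_of_nonneg (by linarith)]
  have h1 := hz.hasMomentLE_sum hs1 hs2 hm (fun k => if i < k then 2 else 0) j
  have h2 := (hu i).add (by linarith) (hu j).neg
  have hfilter : Finset.filter (fun k => i < k) (Finset.Icc 1 j) = Finset.Ioc i j := by
    ext k; simp; omega
  have h3 : ∑ k ∈ Finset.Icc 1 j, (if i < k then (2 : ℝ) else 0) ^ 2 * Cz ^ s⁻¹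
      = 4 * Cz ^ s⁻¹ * ((j : ℝ) - i) := by
    simp only [ite_pow, ite_mul, zero_pow two_ne_zero, zero_mul]
    rw [← Finset.sum_filter, hfilter, Finset.sum_const, Nat.card_Ioc, nsmul_eq_mul,
      Nat.cast_sub h.le]
    ring
  have h4 : (fun ω => ∑ k ∈ Finset.Icc 1 j, (2 * z k ω + (u (k - 1) ω - u k ω))
        - ∑ k ∈ Finset.Icc 1 i, (2 * z k ω + (u (k - 1) ω - u k ω)))
      = fun ω => ∑ k ∈ Finset.Icc 1 j, (if i < k then 2 else 0) * z k ω + (u i ω + -u j ω) := by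
    funext ω
    have h5 : ∑ k ∈ Finset.Icc 1 j, (if i < k then 2 else 0) * z k ω
        = ∑ k ∈ Finset.Ioc i j, 2 * z k ω := by
      simp only [ite_mul, zero_mul]
      rw [← Finset.sum_filter, hfilter]
    rw [h5, ← sum_Icc_sub_sum_Icc _ h.le, Finset.sum_add_distrib, Finset.sum_add_distrib,
      sum_prev_sub (fun k => u k ω) i, sum_prev_sub (fun k => u k ω) j]
    ring
  rw [h4]
  have h2s : 0 ≤ 2 * s := by linarith
  have hd0 : (0 : ℝ) ≤ (j : ℝ) - i := by linarith
  refine (h1.add h2s h2).mono ?_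
  rw [h3, show 40 * (4 * Cz ^ s⁻¹ * ((j : ℝ) - i)) = 160 * Cz ^ s⁻¹ * ((j : ℝ) - i) by ring,
    Real.mul_rpow (x := 160 * Cz ^ s⁻¹) (by positivity) hd0, mul_assoc]
  have h6 : (1 : ℝ) ≤ ((j : ℝ) - i) ^ s := Real.one_le_rpow hd (by linarith)
  have h7 : 0 ≤ 2 ^ (2 * s) * (Cu + Cu) := by positivity
  refine mul_le_mul_of_nonneg_left ?_ (by positivity)
  rw [add_mul]
  exact add_le_add le_rfl (le_mul_of_one_le_right h7 h6)

/-- Since `2κ > 1`, the series `∑ k ^ (-κ) z_k` has summable second moments and converges; summation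
by parts removes the weights. -/
theorem IsMartingaleDiff.ae_exists_abs_sum_le (hz : IsMartingaleDiff Pr ℱ z) (hs1 : 1 < s)
    (hm : ∀ n, 1 ≤ n → HasMomentLE Pr (2 * s) (z n) Cz) {κ : ℝ} (hκ : 1 / 2 < κ) :
    ∀ᵐ ω ∂Pr, ∃ C : ℝ, ∀ n : ℕ, 1 ≤ n → |∑ i ∈ Finset.Icc 1 n, z i ω| ≤ C * (n : ℝ) ^ κ := by
  have hm2 : ∀ n : ℕ, 1 ≤ n →
      HasMomentLE Pr 2 (fun ω => ((n : ℝ) ^ κ)⁻¹ * z n ω) (((n : ℝ) ^ (2 * κ))⁻¹ * (1 + Cz)) := by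
    intro n hn
    refine (((hm n hn).of_le (by norm_num) (by linarith)).const_mul _).mono (le_of_eq ?_)
    rw [abs_of_nonneg (by positivity), Real.inv_rpow (by positivity),
      ← Real.rpow_mul (by positivity), mul_comm κ]
  have hsum : Summable fun n : ℕ => ((n : ℝ) ^ (2 * κ))⁻¹ * (1 + Cz) :=
    (Real.summable_nat_rpow_inv.2 (by linarith)).mul_right _
  have hCz : 0 ≤ Cz := (hm 1 le_rfl).nonneg
  have h := (hz.const_mul fun n => ((n : ℝ) ^ κ)⁻¹).ae_exists_tendsto_sum (p := 2) (by norm_num)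
    le_rfl (fun n hn => (hm2 n hn).2.1)
    (C := ∑' n : ℕ, ((n : ℝ) ^ (2 * κ))⁻¹ * (1 + Cz)) fun n =>
      (Finset.sum_le_sum fun i hi => (hm2 i (Finset.mem_Icc.1 hi).1).2.2).trans
        (hsum.sum_le_tsum _ fun i _ => by positivity)
  filter_upwards [h] with ω ⟨l, hl⟩
  obtain ⟨R, hR⟩ := (Metric.isBounded_range_of_tendsto _ hl).exists_norm_le
  refine ⟨2 * R, fun n hn => abs_sum_le_of_abs_weighted_sum_le (by linarith) (fun k => ?_) hn⟩
  exact hR _ (Set.mem_range_self k)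

/-- Consistency of the kernel estimator for a sequence which is approximated by martingale
differences. -/
theorem IsMartingaleDiff.ae_tendsto_kernelEstimator_sub (hz : IsMartingaleDiff Pr ℱ z)
    (hs1 : 1 < s) (hs2 : s ≤ 2) (hCz : 0 < Cz)
    (hm : ∀ n, 1 ≤ n → HasMomentLE Pr (2 * s) (z n) Cz)
    (hu : ∀ n, HasMomentLE Pr (2 * s) (u n) Cu) {e : ℕ → Ω → ℝ}
    (he : ∀ᵐ ω ∂Pr, ∃ C : ℝ, ∀ n : ℕ, ∑ i ∈ Finset.Icc 1 n, e i ω ^ 2 ≤ C)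
    {w : ℝ → ℝ} {r : ℕ} (hw : A4 w r) {b : ℕ → ℝ} (hb : IsBandwidth b) {δ Kb : ℝ} (hδ : 0 < δ)
    (hbδ : ∀ n : ℕ, 1 ≤ n → b n ≤ Kb * (n : ℝ) ^ (-δ))
    (hsum2 : Summable fun n : ℕ+ => ((n : ℝ) ^ (-2 : ℝ) * (b n)⁻¹) ^ (s / 2))
    (hsum3 : Summable fun n : ℕ+ => (n : ℝ) ^ (-2 + 1 / s) * (b n) ^ (-(1 / 2) : ℝ))
    {y : ℕ → Ω → ℝ} {c : ℝ}
    (hy : ∀ ω j, 1 ≤ j → y j ω - c = z j ω + ((u (j - 1) ω - u j ω) + e j ω)) :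
    ∀ᵐ ω ∂Pr, Tendsto (fun n : ℕ => kernelEstimator w b (fun k => y k ω) n
      - (n : ℝ)⁻¹ * ∑ k ∈ Finset.Icc 1 n, z k ω ^ 2) atTop (𝓝 0) := by
  -- Then `2sσ = (s + 1) / 2 > 1`, which yields `u_n = O(n ^ σ)`, while `σ < 1/2` gives `τ = 1/2 + σ
  -- < 1`. The choice `κ = (3/2 - σ) / 2` lies in `(1/2, 3/4)` and satisfies `κ + σ < 1`.
  set σ : ℝ := (s + 1) / (4 * s) with hσ
  have hs0 : 0 < s := by linarith
  have hσs : 2 * s * σ = (s + 1) / 2 := by rw [hσ]; field_simp; ring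
  have hσ0 : 0 < σ := by positivity
  have hσ1 : σ < 1 / 2 := by
    rw [hσ, div_lt_iff₀ (by positivity)]; linarith
  obtain ⟨L, hL, hK, hdK⟩ := hw.exists_sum_sq_le hb
  have hoff := hz.tendsto_lagOffDiag hs1 hs2 hCz hm (K := fun n k => w ((k : ℝ) * b n)) hL hb.pos
    hK hdK hsum2 hsum3
  have hM := hz.ae_exists_abs_sum_le hs1 hm (κ := (3 / 2 - σ) / 2) (by linarith)
  have hub := ae_exists_abs_le_rpow hs1 hu (σ := σ) (by rw [hσs]; linarith)
  have hexp : 2 * s * (1 / 2 + σ) - (s + 1) / 2 = s := by rw [mul_add, hσs]; ring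
  -- With `ν = (s + 1) / 2 > 1`, the exponent `q τ - ν` is exactly `s`, the order of the moments of
  -- the increments. The part from `e` is left out here and added pathwise.
  have hinc := ae_exists_increment_bound (Pr := Pr) (q := 2 * s) (τ := 1 / 2 + σ)
    (ν := (s + 1) / 2)
    (Y := fun j ω => ∑ k ∈ Finset.Icc 1 j, (2 * z k ω + (u (k - 1) ω - u k ω)))
    (by linarith) (by linarith) (fun i j hij => by
      rw [hexp]
      exact hz.hasMomentLE_increment hs1 hs2 hm hu hij)
  have husq : ∀ m : ℕ, ∀ᵐ ω ∂Pr, ∃ K : ℝ, ∀ n : ℕ, 1 ≤ n →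
      ∑ i ∈ Finset.Icc 1 n, u i ω ^ 2 ≤ K * (n : ℝ) ^ (1 + 1 / ((m : ℝ) + 1)) := fun m => by
    have h1 : ∀ n, HasMomentLE Pr 2 (u n) (1 + Cu) := fun n =>
      (hu n).of_le (by norm_num) (by linarith)
    have h2 := ae_exists_sum_le (Pr := Pr) (f := fun n ω => |u n ω| ^ (2 : ℝ))
      (fun i ω => Real.rpow_nonneg (abs_nonneg _) _) (fun n => (h1 n).2.1) (fun n => (h1 n).2.2)
      (ε := 1 / ((m : ℝ) + 1)) (by positivity)
    simpa only [Real.rpow_two, sq_abs] using h2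
  filter_upwards [he, hoff, hM, hub, hinc, ae_all_iff.2 husq] with ω ⟨Ce, hCe⟩ h2 h3 h4
    ⟨g, hg0, hg, hgsum⟩ h6
  have hCe0 : 0 ≤ Ce := by simpa using hCe 0
  refine tendsto_kernelEstimator_sub hw hb hδ hbδ (y := fun k => y k ω) (z := fun k => z k ω)
    (u := fun k => u k ω) (e := fun k => e k ω) (v := fun i => g i ^ (2 * s)⁻¹ + √Ce)
    (hy ω) (σ := σ) (κ := (3 / 2 - σ) / 2) (τ := 1 / 2 + σ) (by linarith) (by linarith)
    (by linarith) (by linarith) (by linarith) (by linarith)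
    (fun i => add_nonneg (Real.rpow_nonneg (hg0 i) _) (Real.sqrt_nonneg _)) (fun i j => ?_)
    (fun ε hε => ?_) ⟨Ce, hCe⟩ h3 h4 h2
  · have h7 := hg i j
    have h8 := abs_sum_sub_sum_le hCe (by linarith : 1 / 2 ≤ 1 / 2 + σ) i j
    have h9 : ∀ n, ∑ k ∈ Finset.Icc 1 n, (2 * z k ω + (u (k - 1) ω - u k ω + e k ω))
        = ∑ k ∈ Finset.Icc 1 n, (2 * z k ω + (u (k - 1) ω - u k ω))
          + ∑ k ∈ Finset.Icc 1 n, e k ω := fun n => by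
      rw [← Finset.sum_add_distrib]
      exact Finset.sum_congr rfl fun k _ => by ring
    rw [h9, h9, add_sub_add_comm, add_mul]
    exact (abs_add_le _ _).trans (add_le_add h7 h8)
  · obtain ⟨m, hm'⟩ := exists_nat_one_div_lt hε
    obtain ⟨K₁, hK₁⟩ := h6 m
    obtain ⟨K₂, hK₂⟩ := hgsum ε hε
    refine ⟨2 + 2 * K₂ + 2 * Ce + |K₁|, fun n hn => ?_⟩
    have hn1 : (1 : ℝ) ≤ n := by exact_mod_cast hn
    have hv : ∀ i, (g i ^ (2 * s)⁻¹ + √Ce) ^ 2 ≤ (2 + 2 * Ce) + 2 * g i := by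
      intro i
      have h7 : (g i ^ (2 * s)⁻¹) ^ 2 ≤ 1 + g i := by
        rw [← Real.rpow_natCast, ← Real.rpow_mul (hg0 i)]
        rcases le_total (g i) 1 with h | h
        · have := Real.rpow_le_one (hg0 i) h
            (by positivity : 0 ≤ (2 * s)⁻¹ * ((2 : ℕ) : ℝ))
          linarith [hg0 i]
        · have h8 : (2 * s)⁻¹ * ((2 : ℕ) : ℝ) ≤ 1 := by
            push_cast
            rw [← div_eq_inv_mul, div_le_one (by linarith)]
            linarith
          have := Real.rpow_le_rpow_of_exponent_le h h8
          rw [Real.rpow_one] at this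
          linarith
      have h8 := Real.sq_sqrt hCe0
      nlinarith [sq_nonneg (g i ^ (2 * s)⁻¹ - √Ce)]
    have hpow : (n : ℝ) ≤ (n : ℝ) ^ (1 + ε) := by
      simpa using Real.rpow_le_rpow_of_exponent_le hn1 (by linarith : (1 : ℝ) ≤ 1 + ε)
    have hpow' : (n : ℝ) ^ (1 + 1 / ((m : ℝ) + 1)) ≤ (n : ℝ) ^ (1 + ε) :=
      Real.rpow_le_rpow_of_exponent_le hn1 (by linarith)
    have h10 : K₁ * (n : ℝ) ^ (1 + 1 / ((m : ℝ) + 1)) ≤ |K₁| * (n : ℝ) ^ (1 + ε) := by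
      gcongr
      exact le_abs_self _
    have h11 : ∑ i ∈ Finset.Icc 1 n, (g i ^ (2 * s)⁻¹ + √Ce) ^ 2
        ≤ n * (2 + 2 * Ce) + 2 * (K₂ * (n : ℝ) ^ (1 + ε)) := by
      refine (Finset.sum_le_sum fun i _ => hv i).trans ?_
      rw [Finset.sum_add_distrib, ← Finset.mul_sum]
      have := hK₂ n hn
      simp only [Finset.sum_const, Nat.card_Icc, Nat.add_sub_cancel, nsmul_eq_mul]
      linarith
    rw [Finset.sum_add_distrib]
    have h12 := hK₁ n hn
    nlinarith [mul_le_mul_of_nonneg_right hpow (by linarith : 0 ≤ 2 + 2 * Ce)]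

end MartingaleApproximation

/-! ### Polynomial decay of the bandwidth. -/

section Bandwidth

/-- A nonincreasing sequence whose `q`-th powers are summable decays polynomially. -/
theorem exists_le_rpow_neg_of_summable {b : ℕ → ℝ} (hb : ∀ n, 1 ≤ n → 0 < b n)
    (hanti : AntitoneOn b (Set.Ici 1)) {q : ℝ} (hq : 0 < q)
    (hsum : Summable fun n : ℕ+ => b n ^ q) :
    ∃ K : ℝ, ∀ n : ℕ, 1 ≤ n → b n ≤ K * (n : ℝ) ^ (-q⁻¹) := by
  have h : Summable fun n : ℕ => |b n ^ q| :=
    (summable_pnat_iff_summable_nat.1 hsum).abs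
  refine ⟨(∑' n, |b n ^ q|) ^ q⁻¹, fun n hn => ?_⟩
  have hn0 : (0 : ℝ) < n := by exact_mod_cast hn
  have hbn := hb n hn
  have hT0 : 0 ≤ ∑' n, |b n ^ q| := tsum_nonneg fun _ => abs_nonneg _
  -- By monotonicity each of the first `n` terms is at least `b n ^ q`.
  have h1 : (n : ℝ) * b n ^ q ≤ ∑' n, |b n ^ q| := by
    refine le_trans ?_ (h.sum_le_tsum (Finset.Icc 1 n) fun _ _ => abs_nonneg _)
    have h2 : ∑ _k ∈ Finset.Icc 1 n, b n ^ q = (n : ℝ) * b n ^ q := by simp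
    rw [← h2]
    refine Finset.sum_le_sum fun k hk => le_trans ?_ (le_abs_self _)
    obtain ⟨hk1, hkn⟩ := Finset.mem_Icc.1 hk
    exact Real.rpow_le_rpow hbn.le (hanti (Set.mem_Ici.2 hk1) (Set.mem_Ici.2 hn) hkn) hq.le
  calc b n = (b n ^ q) ^ q⁻¹ := by
        rw [← Real.rpow_mul hbn.le, mul_inv_cancel₀ hq.ne', Real.rpow_one]
    _ ≤ ((∑' n, |b n ^ q|) * (n : ℝ)⁻¹) ^ q⁻¹ := by
        gcongr
        rwa [← div_eq_mul_inv, le_div_iff₀ hn0, mul_comm]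
    _ = _ := by
        rw [Real.mul_rpow hT0 (by positivity), Real.inv_rpow hn0.le, Real.rpow_neg hn0.le]

end Bandwidth

/-! ### The martingale decomposition of the adaptive chain. -/

section PoissonDecomposition

theorem hasMomentLE_of_abs_le_rpow {S Ω : Type*} [MeasurableSpace Ω] {Pr : Measure Ω} {V : S → ℝ}
    {f : Ω → ℝ} {ξ : Ω → S} (hV : ∀ x, 1 ≤ V x)
    (hf : AEStronglyMeasurable f Pr) {a s q M : ℝ} (ha : 0 ≤ a) (hq : 0 ≤ q) (hsq : s * q ≤ 1)
    (hint : Integrable (fun ω => V (ξ ω)) Pr) (hM : ∫ ω, V (ξ ω) ∂Pr ≤ M)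
    (hle : ∀ᵐ ω ∂Pr, |f ω| ≤ a * V (ξ ω) ^ s) : HasMomentLE Pr q f (a ^ q * M) := by
  refine HasMomentLE.of_abs_le hf (hint.const_mul (a ^ q)) ?_ ?_
  · filter_upwards [hle] with ω h
    exact (Real.rpow_le_rpow (abs_nonneg _) h hq).trans (mul_rpow_rpow_le ha (hV _) hsq)
  · rw [integral_const_mul]
    gcongr

variable {S Θ Ω : Type*} [MeasurableSpace S] [MeasurableSpace Θ] [mΩ : MeasurableSpace Ω]
  {P : Kernel (Θ × S) S} {Pr : Measure Ω} {X : ℕ → Ω → S} {θ : ℕ → Ω → Θ} {V : S → ℝ}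

variable {π : Measure S} {h : S → ℝ} {C ρ c β : ℝ} [IsMarkovKernel P] [IsProbabilityMeasure π]

theorem G_eq (hQ : ∀ θ, GeomErgodic (P.sectR θ) π (fun x => V x ^ β) C ρ) (hh : Measurable h)
    (hc : 0 < c) (hhc : ∀ x, |h x| ≤ c * V x ^ β) (θ : Θ) (x y : S) :
    G P π h θ x y = resolvent P π h θ y - (resolvent P π h θ x - h x + ∫ y, h y ∂π) := by
  rw [G, integral_resolvent_kernel (hQ θ) hh hc hhc]

theorem measurable_G (hQ : ∀ θ, GeomErgodic (P.sectR θ) π (fun x => V x ^ β) C ρ)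
    (hh : Measurable h) (hc : 0 < c) (hhc : ∀ x, |h x| ≤ c * V x ^ β) :
    Measurable fun z : (Θ × S) × S => G P π h z.1.1 z.1.2 z.2 := by
  simp only [G_eq hQ hh hc hhc]
  have hg := measurable_resolvent_uncurry hQ hh hc hhc
  have h1 : Measurable fun z : (Θ × S) × S => resolvent P π h z.1.1 z.2 :=
    hg.comp ((measurable_fst.comp measurable_fst).prodMk measurable_snd)
  have h2 : Measurable fun z : (Θ × S) × S => resolvent P π h z.1.1 z.1.2 :=
    hg.comp measurable_fst
  exact h1.sub ((h2.sub (hh.comp (measurable_snd.comp measurable_fst))).add_const _)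

theorem integral_G_eq_zero (hQ : ∀ θ, GeomErgodic (P.sectR θ) π (fun x => V x ^ β) C ρ)
    (hh : Measurable h) (hc : 0 < c) (hhc : ∀ x, |h x| ≤ c * V x ^ β) (q : Θ × S) :
    ∫ y, G P π h q.1 q.2 y ∂(P q) = 0 := by
  have hint : Integrable (resolvent P π h q.1) (P.sectR q.1 q.2) :=
    (hQ q.1).integrable_one (measurable_resolvent (hQ q.1) hh hc hhc)
      (abs_resolvent_le (hQ q.1) hh hc hhc) q.2
  have h1 : ∫ y, G P π h q.1 q.2 y ∂(P.sectR q.1 q.2) = 0 := by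
    unfold G
    rw [integral_sub hint (integrable_const _)]
    simp
  exact h1

/-- The fluctuations of the resolvent due to adaptation are square summable. -/
theorem A2.ae_exists_sum_sq_le {η : ℝ} (hA2 : A2 P V Pr X θ η)
    (hX : ∀ n, Measurable (X n)) (hθ : ∀ n, Measurable (θ n)) (hV : ∀ x, 1 ≤ V x)
    (hQ : ∀ θ, GeomErgodic (P.sectR θ) π (fun x => V x ^ β) C ρ) (hh : Measurable h)
    (hc : 0 < c) (hhc : ∀ x, |h x| ≤ c * V x ^ β) (hβ0 : 0 ≤ β) (hβ1 : β ≤ 1)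
    (hβη : (β + η) * 2 ≤ 1) {M : ℝ}
    (hM : ∀ n, Integrable (fun ω => V (X n ω)) Pr ∧ ∫ ω, V (X n ω) ∂Pr ≤ M) :
    ∀ᵐ ω ∂Pr, ∃ K : ℝ, ∀ n : ℕ, ∑ i ∈ Finset.Icc 1 n,
      (resolvent P π h (θ i ω) (X i ω) - resolvent P π h (θ (i - 1) ω) (X i ω)) ^ 2 ≤ K := by
  obtain ⟨-, -, γ, α, hα, hγ0, -, hγ, hD⟩ := hA2
  obtain ⟨CD, hCD⟩ := hD β hβ0 hβ1
  -- A parameter is needed only to read off the signs of the constants `C` and `ρ`.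
  rcases isEmpty_or_nonempty Θ with hΘ | ⟨⟨θ₀⟩⟩
  · exact ae_of_all _ fun ω => (hΘ.false (θ 0 ω)).elim
  have hC := (hQ θ₀).pos
  have hρ : 0 < 1 - ρ := by linarith [(hQ θ₀).rate_lt_one]
  set R : ℝ := (c * (C + 1) * (1 - ρ)⁻¹) * C * (1 - ρ)⁻¹ with hR
  have hR0 : 0 < R := by positivity
  have hg := measurable_resolvent_uncurry hQ hh hc hhc
  -- The Lipschitz bound for the resolvent costs `V ^ β` and diminishing adaptation costs `V ^ η`;
  -- the product is square integrable because `2 (β + η) ≤ 1`.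
  have hmom : ∀ n, 1 ≤ n → HasMomentLE Pr 2
      (fun ω => resolvent P π h (θ n ω) (X n ω) - resolvent P π h (θ (n - 1) ω) (X n ω))
      ((R * |CD| * γ n) ^ (2 : ℝ) * M) := by
    intro n hn
    have hγn := hγ0 n hn
    refine hasMomentLE_of_abs_le_rpow (s := β + η) (ξ := X n) hV ?_ (by positivity) (by norm_num)
      hβη (hM n).1 (hM n).2 ?_
    · exact ((hg.comp ((hθ n).prodMk (hX n))).sub
        (hg.comp ((hθ (n - 1)).prodMk (hX n)))).aestronglyMeasurable
    · filter_upwards [hCD n hn] with ω hω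
      have hVn : 0 < V (X n ω) := zero_lt_one.trans_le (hV _)
      have h1 : D P V β (θ (n - 1) ω) (θ n ω)
          ≤ ENNReal.ofReal (|CD| * γ n * V (X n ω) ^ η) := by
        refine hω.trans (ENNReal.ofReal_le_ofReal ?_)
        gcongr
        exact le_abs_self _
      have h2 := abs_resolvent_sub_le hV (hQ _) (hQ _) hh hc hhc (by positivity) h1 (X n ω)
      rw [abs_sub_comm]
      refine h2.trans (le_of_eq ?_)
      rw [Real.rpow_add hVn]
      ring
  have hsum : Summable fun n : ℕ+ => (R * |CD| * γ n) ^ (2 : ℝ) * M := by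
    have h1 : Summable fun n : ℕ => γ n ^ 2 := by
      refine summable_of_isBigO_nat (g := fun n : ℕ => (n : ℝ) ^ (-(2 * α)))
        (Real.summable_nat_rpow.2 (by linarith)) ((hγ.pow 2).trans_eventuallyEq ?_)
      filter_upwards with n
      rw [← Real.rpow_natCast, ← Real.rpow_mul (by positivity)]
      congr 1
      push_cast
      ring
    have h2 := summable_pnat_iff_summable_nat.2 ((h1.mul_left ((R * |CD|) ^ 2)).mul_right M)
    refine h2.congr fun n => ?_
    rw [Real.rpow_two]
    ring
  have hae := ae_summable_of_integral_le (Pr := Pr) (f := fun (n : ℕ+) ω =>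
      |resolvent P π h (θ n ω) (X n ω) - resolvent P π h (θ (n - 1 : ℕ) ω) (X n ω)| ^ (2 : ℝ))
    (fun _ _ => Real.rpow_nonneg (abs_nonneg _) _) (fun n => (hmom n n.2).2.1)
    (fun n => (hmom n n.2).2.2) hsum
  filter_upwards [hae] with ω hω
  simp only [Real.rpow_two, sq_abs] at hω
  have h1 : Summable fun n : ℕ =>
      (resolvent P π h (θ n ω) (X n ω) - resolvent P π h (θ (n - 1) ω) (X n ω)) ^ 2 :=
    summable_pnat_iff_summable_nat.1 hω
  exact ⟨_, fun n => h1.sum_le_tsum _ fun _ _ => sq_nonneg _⟩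

variable [IsProbabilityMeasure Pr]

theorem IsAdaptiveChain.isMartingaleDiff_G (hchain : IsAdaptiveChain P Pr X θ)
    (hQ : ∀ θ, GeomErgodic (P.sectR θ) π (fun x => V x ^ β) C ρ) (hh : Measurable h)
    (hc : 0 < c) (hhc : ∀ x, |h x| ≤ c * V x ^ β)
    (hint : ∀ n, 1 ≤ n →
      Integrable (fun ω => G P π h (θ (n - 1) ω) (X (n - 1) ω) (X n ω)) Pr) :
    IsMartingaleDiff Pr hchain.filtration
      (fun n ω => G P π h (θ (n - 1) ω) (X (n - 1) ω) (X n ω)) where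
  adapted n _ := by
    have h1 : Measurable[hchain.filtration n]
        fun ω => ((θ (n - 1) ω, X (n - 1) ω), X n ω) :=
      ((hchain.measurable_param_filtration (Nat.sub_le _ _)).prodMk
        (hchain.measurable_state_filtration (Nat.sub_le _ _))).prodMk
          (hchain.measurable_state_filtration le_rfl)
    exact ((measurable_G hQ hh hc hhc).comp h1).stronglyMeasurable
  integrable := hint
  condExp n := hchain.condExp_eq_zero n (F := fun z => G P π h z.1.1 z.1.2 z.2)
    (measurable_G hQ hh hc hhc) (hint (n + 1) (by omega)) (integral_G_eq_zero hQ hh hc hhc)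

/-- Consistency of the kernel estimator along an adaptive chain. -/
theorem IsAdaptiveChain.ae_tendsto_kernelEstimator_sub (hchain : IsAdaptiveChain P Pr X θ)
    (hinv : ∀ θ, Kernel.Invariant (P.sectR θ) π) {η : ℝ}
    (hA1 : A1 P π V (Pr.map fun ω => (X 0 ω, θ 0 ω))) (hA2 : A2 P V Pr X θ η)
    {w : ℝ → ℝ} {r : ℕ} (hA4 : A4 w r) {b : ℕ → ℝ} (hb : IsBandwidth b)
    (hβ_pos : 0 < β) (hβ_lt : β < 1 / 2 - η) (hh : h ∈ LW fun x => V x ^ β)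
    {p : ℝ} (hp : 1 < p) (hpβη : 2 * p * (β + η) ≤ 1)
    (hsum2 : Summable fun n : ℕ+ => ((n : ℝ) ^ (-2 : ℝ) * (b n)⁻¹) ^ min 1 (p / 2))
    (hsum3 : Summable fun n : ℕ+ =>
      (n : ℝ) ^ (-2 + max (1 / 2) (1 / p)) * (b n) ^ (-(1 / 2) : ℝ))
    (hsum4 : Summable fun n : ℕ+ => (b n) ^ (((r : ℝ) - 1) * p)) :
    ∀ᵐ ω ∂Pr, Tendsto
      (fun n : ℕ => kernelEstimator w b (fun k => h (X k ω)) n -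
        (n : ℝ)⁻¹ * ∑ k ∈ Finset.Icc 1 n, G P π h (θ (k - 1) ω) (X (k - 1) ω) (X k ω) ^ 2)
      atTop (𝓝 0) := by
  have hη0 : 0 ≤ η := hA2.1
  have hβ1 : β ≤ 1 := by linarith
  have hV := hA1.one_le_V
  obtain ⟨C, ρ, hQ⟩ := hA1.geomErgodic hinv hβ_pos hβ1
  obtain ⟨c, hc, hhc⟩ := exists_abs_le_of_mem_LW
    (fun x => Real.rpow_pos_of_pos (zero_lt_one.trans_le (hV x)) β) hh
  have hhm := hh.1
  obtain ⟨M, hM0, hM⟩ := hchain.exists_integral_le hA1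
  have hX := hchain.measurable_state
  have hθ := hchain.measurable_param
  have hg := measurable_resolvent_uncurry hQ hhm hc hhc
  rcases isEmpty_or_nonempty Θ with hΘ | ⟨⟨θ₀⟩⟩
  · exact ae_of_all _ fun ω => (hΘ.false (θ 0 ω)).elim
  have hC := (hQ θ₀).pos
  have hρ : 0 < 1 - ρ := by linarith [(hQ θ₀).rate_lt_one]
  set A : ℝ := c * (C + 1) * (1 - ρ)⁻¹ with hA
  have hA0 : 0 < A := by positivity
  have hgb : ∀ t x, |resolvent P π h t x| ≤ A * V x ^ β := fun t =>
    abs_resolvent_le (hQ t) hhm hc hhc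
  have hub : ∀ t x, |resolvent P π h t x - h x + ∫ y, h y ∂π|
      ≤ (A + c + |∫ y, h y ∂π|) * V x ^ β := by
    intro t x
    have h1 : 1 ≤ V x ^ β := (hQ t).one_le_weight x
    have h2 := abs_add_le (resolvent P π h t x - h x) (∫ y, h y ∂π)
    have h3 := abs_sub (resolvent P π h t x) (h x)
    have h4 : |∫ y, h y ∂π| ≤ |∫ y, h y ∂π| * V x ^ β := le_mul_of_one_le_right (abs_nonneg _) h1
    linarith [hgb t x, hhc x]
  -- Moments of order `2s` are available since `2pβ ≤ 1`; the cap at `2` is what the martingale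
  -- inequalities require.
  set s : ℝ := min p 2 with hs
  have hs1 : 1 < s := lt_min hp (by norm_num)
  have hs2 : s ≤ 2 := min_le_right _ _
  have hβs : β * (2 * s) ≤ 1 := by
    have : s ≤ p := min_le_left _ _
    nlinarith
  have hβη : (β + η) * 2 ≤ 1 := by nlinarith
  have h2s : 0 ≤ 2 * s := by linarith
  -- By the Poisson equation this function is `P_θ g_θ` at `(θ n, X n)`, the telescoping part of the
  -- decomposition.
  have hu : ∀ n, HasMomentLE Pr (2 * s)
      (fun ω => resolvent P π h (θ n ω) (X n ω) - h (X n ω) + ∫ y, h y ∂π) _ := fun n =>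
    hasMomentLE_of_abs_le_rpow (ξ := X n) hV (((hg.comp ((hθ n).prodMk (hX n))).sub
      (hhm.comp (hX n))).add_const _).aestronglyMeasurable (by positivity) h2s hβs (hM n).1 (hM n).2
      (ae_of_all _ fun ω => hub _ _)
  have hz : ∀ n, 1 ≤ n → HasMomentLE Pr (2 * s)
      (fun ω => G P π h (θ (n - 1) ω) (X (n - 1) ω) (X n ω)) _ := fun n _ => by
    have h1 : HasMomentLE Pr (2 * s) (fun ω => resolvent P π h (θ (n - 1) ω) (X n ω)) _ :=
      hasMomentLE_of_abs_le_rpow (ξ := X n) hV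
        (hg.comp ((hθ (n - 1)).prodMk (hX n))).aestronglyMeasurable hA0.le h2s hβs (hM n).1
        (hM n).2 (ae_of_all _ fun ω => hgb _ _)
    have h2 := h1.add h2s (hu (n - 1)).neg
    simpa only [← sub_eq_add_neg, ← G_eq hQ hhm hc hhc] using h2
  have hmart := hchain.isMartingaleDiff_G hQ hhm hc hhc fun n hn => by
    refine (memLp_of_integrable_abs_rpow (by linarith) (hz n hn).1 (hz n hn).2.1).integrable ?_
    rw [← ENNReal.ofReal_one]
    exact ENNReal.ofReal_le_ofReal (by linarith)
  have he := hA2.ae_exists_sum_sq_le hX hθ hV hQ hhm hc hhc hβ_pos.le hβ1 hβη hM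
  have hr : (2 : ℝ) ≤ r := by exact_mod_cast hA4.two_le
  have hq : 0 < ((r : ℝ) - 1) * p := mul_pos (by linarith) (by linarith)
  -- The last summability condition serves to give the bandwidth a polynomial rate.
  obtain ⟨Kb, hKb⟩ := exists_le_rpow_neg_of_summable hb.pos hb.antitone hq hsum4
  have e2 : min 1 (p / 2) = s / 2 := by
    rw [hs, ← min_div_div_right zero_le_two, min_comm, div_self two_ne_zero]
  have e3 : max (1 / 2) (1 / p) = 1 / s := by
    rcases le_total p 2 with h2 | h2
    · rw [hs, min_eq_left h2, max_eq_right (by gcongr)]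
    · rw [hs, min_eq_right h2, max_eq_left (by gcongr)]
  rw [e2] at hsum2
  rw [e3] at hsum3
  refine hmart.ae_tendsto_kernelEstimator_sub hs1 hs2 (by positivity) hz hu he hA4 hb
    (inv_pos.2 hq) hKb hsum2 hsum3 (c := ∫ y, h y ∂π) fun ω j hj => ?_
  rw [G_eq hQ hhm hc hhc]
  ring

end PoissonDecomposition

end AdaptiveMCMC

theorem theorem4p3
    {S Θ Ω : Type*} [MeasurableSpace S] [MeasurableSpace.CountablyGenerated S]
    [MeasurableSpace Θ] [MeasurableSpace Ω]
    (P : Kernel (Θ × S) S) [IsMarkovKernel P]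
    (π : Measure S) [IsProbabilityMeasure π]
    (hinv : ∀ θ, Kernel.Invariant (P.sectR θ) π)
    (Pr : Measure Ω) [IsProbabilityMeasure Pr]
    (X : ℕ → Ω → S) (θ : ℕ → Ω → Θ)
    (hchain : AdaptiveMCMC.IsAdaptiveChain P Pr X θ)
    (V : S → ℝ) (η : ℝ)
    (hA1 : AdaptiveMCMC.A1 P π V (Pr.map fun ω => (X 0 ω, θ 0 ω)))
    (hA2 : AdaptiveMCMC.A2 P V Pr X θ η)
    (w : ℝ → ℝ) (r : ℕ) (hA4 : AdaptiveMCMC.A4 w r)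
    (b : ℕ → ℝ) (hb : AdaptiveMCMC.IsBandwidth b)
    (β : ℝ) (hβ_pos : 0 < β) (hβ_lt : β < 1 / 2 - η)
    (h : S → ℝ) (hh : h ∈ AdaptiveMCMC.LW fun x => V x ^ β)
    (p : ℝ) (hp : 1 < p) (hpβη : 2 * p * (β + η) ≤ 1)
    (hsum1 : Summable fun n : ℕ+ => ((n : ℝ)⁻¹ * (b n)⁻¹) ^ p)
    (hsum2 : Summable fun n : ℕ+ => ((n : ℝ) ^ (-2 : ℝ) * (b n)⁻¹) ^ min 1 (p / 2))
    (hsum3 : Summable fun n : ℕ+ =>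
      (n : ℝ) ^ (-2 + max (1 / 2) (1 / p)) * (b n) ^ (-(1 / 2) : ℝ))
    (hsum4 : Summable fun n : ℕ+ => (b n) ^ (((r : ℝ) - 1) * p)) :
    ∀ᵐ ω ∂Pr, Tendsto
      (fun n : ℕ =>
        AdaptiveMCMC.kernelEstimator w b (fun k => h (X k ω)) n -
          (n : ℝ)⁻¹ * ∑ k ∈ Finset.Icc 1 n,
            AdaptiveMCMC.G P π h (θ (k - 1) ω) (X (k - 1) ω) (X k ω) ^ 2)
      atTop (𝓝 0) :=
  hchain.ae_tendsto_kernelEstimator_sub hinv hA1 hA2 hA4 hb hβ_pos hβ_lt hh hp hpβη hsum2 hsum3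
    hsum4
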